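/- **Setting.** Let $(\mathbb A,p)$ be a probability space, $\Omega=\mathbb A^{\mathbb Z}$ with the product measure $P=p^{\mathbb Z}$ and the left shift $\sigma$. Let $X$ be a metric space with its Borel $\sigma$-algebra, $m$ a measure on $X$, and $\Lambda\subset X$ a measurable set with $m(\Lambda)=1$. Let $f_u:X\to X$ ($u\in\mathbb A$) be maps with $(u,x)\mapsto f_u(x)$ measurable; write $f_\omega=f_{\omega_0}$ and $f^n_\omega=f_{\sigma^{n-1}\omega}\circ\dots\circ f_\omega$. Let $(\omega,x)\mapsto R_\omega(x)\in\{1,2,\dots\}$ be a measurable return time on $\Omega\times\Lambda$ and, for almost every $\omega$, let $\{\Lambda_j(\omega)\}_j$ be a countable measurable partition of $\Lambda$ such that $R_\omega$ is constant on each $\Lambda_j(\omega)$ and $f_\omega^{R_\omega}(x)\in\Lambda$ for $m$-a.e. $x\in\Lambda$. The tower over $\omega$ is $$\Delta_\omega=\{(x,\ell):x\in\Lambda,\ \ell\in\mathbb Z_{\ge0},\ \ell<R_{\sigma^{-\ell}\omega}(x)\},$$ with the lifted measure, again denoted $m$, and lifted $\sigma$-algebra $\mathcal B_\omega$. The tower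 map $F_\omega:\Delta_\omega\to\Delta_{\sigma\omega}$ is $F_\omega(x,\ell)=(x,\ell+1)$ if $\ell+1<R_{\sigma^{-\ell}\omega}(x)$ and $F_\omega(x,\ell)=(f^{\ell+1}_{\sigma^{-\ell}\omega}(x),0)$ otherwise; $F^n_\omega=F_{\sigma^{n-1}\omega}\circ\dots\circ F_\omega$. The partition $\mathcal P_\omega$ of $\Delta_\omega$ consists of the sets $\Lambda_j(\sigma^{-\ell}\omega)\times\{\ell\}$ with $R_{\sigma^{-\ell}\omega}|_{\Lambda_j(\sigma^{-\ell}\omega)}\ge\ell+1$. The first return to the base of $(x,\ell)\in\Delta_\omega$ is $F^{R}_\omega(x,\ell):=F_\omega^{\hat R}(x,\ell)$ with $\hat R=R_{\sigma^{-\ell}\omega}(x)-\ell$. The separation time $s(z_1,z_2)\in\{0,1,\dots,\infty\}$ of two points of the same tower is the least $n\ge0$ such that their $n$-th returns to the base lie in distinct partition elements ($\infty$ if there is none, and $\gamma^\infty=0$); it is $0$ for points of different towers. **Assumptions.** Each fibrewise condition holds for almost every $\omega$, with constants independent of $\omega$. * (P1) For each $j$, $f_\omega^{R_\omega}:\Lambda_j(\omega)\to\Lambda$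 is a bijection. * (P2) There are $D>0$ and $0<\gamma<1$ such that, on each $\Lambda_j(\omega)$, the map $f_\omega^{R_\omega}$ and its inverse are non-singular with respect to $m$, with positive Jacobian $J$ satisfying $\left|\frac{J(x)}{J(y)}-1\right|\le D\,\gamma^{s(F^{R}_\omega(x,0),F^{R}_\omega(y,0))}$ for $x,y\in\Lambda_j(\omega)$. * (P3) The partition is generating: for every $z\in\Delta_\omega$ the diameter of the element of $\bigvee_{j=0}^nF_\omega^{-j}\mathcal P_{\sigma^j\omega}$ containing $z$ tends to $0$ as $n\to\infty$. * (P4) There are $C>0$, $a>1$, $b\ge0$, $u>0$, $v>0$ and a random variable $n_1:\Omega\to\mathbb N$ such that $m\{x\in\Lambda: R_\omega(x)>n\}\le C(\log n)^b n^{-a}$ for all $n\ge n_1(\omega)$, $n\ge 1$, and $P\{n_1>n\}\le Ce^{-un^v}$ for all $n\ge1$. * (P5) There are finitely many $t_1,\dots,t_N\in\mathbb Z_{\ge 0}$ with $\gcd\{t_i\}=1$ and $\epsilon_i>0$ with $m\{x\in\Lambda:R_\omega(x)=t_i\}>\epsilon_i$. * (P6) There is $M>0$ with $m(\Delta_\omega)\le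 M$. * (P7) There are $C'>0$, $\hat b\ge0$, $a'>1$ with $(P\times m)\{(\omega,x)\in\Omega\times\Lambda:R_\omega(x)=n\}\le C'(\log n)^{\hat b}n^{-(a'+1)}$ for all $n\ge2$. **Theorem.** Under these assumptions there is a family of absolutely continuous probability measures $\nu_\omega=h_\omega m$ on $\Delta_\omega$, defined for almost every $\omega$ and measurable in $\omega$, such that: 1. (equivariance) $(F_\omega)_*\nu_\omega=\nu_{\sigma\omega}$ for almost every $\omega$; 2. (exactness) for almost every $\omega$, every $B\in\bigcap_{n\ge0}(F^n_\omega)^{-1}\mathcal B_{\sigma^n\omega}$ has $\nu_\omega(B)\in\{0,1\}$; 3. (mixing) for all $\varphi,\psi\in L^2(\nu_\omega\,dP)$, $$\lim_{n\to\infty}\left|\int_\Omega\int_{\Delta_\omega}(\varphi_{\sigma^n\omega}\circ F^n_\omega)\,\psi_\omega\,d\nu_\omega dP-\int_\Omega\int_{\Delta_\omega}\varphi_\omega\,d\nu_\omega dP\int_\Omega\int_{\Delta_\omega}\psi_\omega\,d\nu_\omega dP\right|=0;$$ 4. (regularity) there is a random variable $K_\omega$ with $\inf_\Omega K_\omega>0$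 and $P\{K_\omega>n\}\le e^{-un^v}$ for all $n\in\mathbb Z_{\ge0}$ ($u,v$ as in (P4)), and there is a constant $C_h>0$ independent of $\omega$, such that for almost every $\omega$: $|h_\omega(x)|\le C_hK_\omega$ and $|h_\omega(x)-h_\omega(y)|\le C_hK_\omega\gamma^{s(x,y)}$ for all $x,y\in\Delta_\omega$ (that is, $h\in\mathcal F_\gamma^{K_\omega}$); and on each $I\in\mathcal P_\omega$ either $h_\omega\equiv0$, or $h_\omega>0$ and $\left|\log\frac{h_\omega(x)}{h_\omega(y)}\right|\le C_h\gamma^{s(x,y)}$ for all $x,y\in I$ (that is, $h\in\mathcal F_\gamma^+$). -/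

import Mathlib

open MeasureTheory ProbabilityTheory Filter Topology
open scoped ENNReal

noncomputable section

namespace RandomTowers

/-! ### The noise space, the shift, and random compositions -/

/-- The two-sided sequence space `Ω = A^ℤ`. -/
abbrev Noise (A : Type*) : Type _ := ℤ → A

/-- The product probability measure `P = p^ℤ` on `Ω`. -/
def noiseMeasure {A : Type*} [MeasurableSpace A] (p : Measure A) [IsProbabilityMeasure p] :
    Measure (Noise A) :=
  Measure.infinitePi (fun _ : ℤ => p)

/-- The `n`-th power `σ^n` (with `n ∈ ℤ`) of the left shift on `Ω`. -/
def shift {A : Type*} (n : ℤ) (ω : Noise A) : Noise A := fun k => ω (k + n)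

/-- The random composition `f_{σ^{n-1} ω} ∘ ⋯ ∘ f_ω`, where `f_ω = f_{ω 0}`. -/
def randIter {A X : Type*} (f : A → X → X) (ω : Noise A) : ℕ → X → X
  | 0, x => x
  | n + 1, x => f (ω n) (randIter f ω n x)

/-- `γ ^ s` for `s ∈ ℕ ∪ {∞}`, with `γ ^ ∞ = 0` (used for `0 < γ < 1`). -/
def powTop (γ : ℝ) (s : ℕ∞) : ℝ := if s = ⊤ then 0 else γ ^ s.toNat

/-- The data of a random tower over the base `Λ`, with `m Λ = 1`: fibre maps `f_a`, return times
`R_ω : Λ → {1, 2, …}`, and for almost every `ω` a countable measurable partition of `Λ` on whose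
elements `R_ω` is constant, such that `f_ω^{R_ω} x ∈ Λ` for almost every `x ∈ Λ`.
(The values of `R_ω` outside `Λ` play no role.) -/
structure RandomTower {A X : Type*} [MeasurableSpace A] [MeasurableSpace X]
    (p : Measure A) [IsProbabilityMeasure p] (m : Measure X) where
  /-- the fibre maps -/
  f : A → X → X
  measurable_f : Measurable (Function.uncurry f)
  /-- the base of the tower -/
  base : Set X
  measurableSet_base : MeasurableSet base
  measure_base : m base = 1
  /-- the return times -/
  R : Noise A → X → ℕ
  measurable_R : Measurable (Function.uncurry R)
  R_pos : ∀ᵐ ω ∂(noiseMeasure p), ∀ x ∈ base, 1 ≤ R ω x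
  /-- the partition of the base over `ω` -/
  part : Noise A → Set (Set X)
  part_countable : ∀ᵐ ω ∂(noiseMeasure p), (part ω).Countable
  part_measurable : ∀ᵐ ω ∂(noiseMeasure p), ∀ E ∈ part ω, MeasurableSet E
  part_disjoint : ∀ᵐ ω ∂(noiseMeasure p), (part ω).PairwiseDisjoint id
  part_cover : ∀ᵐ ω ∂(noiseMeasure p), ⋃₀ part ω = base
  R_const : ∀ᵐ ω ∂(noiseMeasure p), ∀ E ∈ part ω, ∀ x ∈ E, ∀ y ∈ E, R ω x = R ω y
  return_mem : ∀ᵐ ω ∂(noiseMeasure p), ∀ᵐ x ∂(m.restrict base),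
    randIter f ω (R ω x) x ∈ base

namespace RandomTower

variable {A X : Type*} [MeasurableSpace A] [MeasurableSpace X]
  {p : Measure A} [IsProbabilityMeasure p] {m : Measure X}

/-! ### The tower, the tower map, partitions and separation time -/

/-- The induced map `f_ω^{R_ω}` on the base. -/
def baseReturn (T : RandomTower p m) (ω : Noise A) (x : X) : X :=
  randIter T.f ω (T.R ω x) x

/-- The tower `Δ_ω = {(x, ℓ) | x ∈ Λ, 0 ≤ ℓ ≤ R_{σ^{-ℓ} ω}(x) - 1}`. -/
def fiber (T : RandomTower p m) (ω : Noise A) : Set (X × ℕ) :=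
  {z | z.1 ∈ T.base ∧ z.2 < T.R (shift (-(z.2 : ℤ)) ω) z.1}

/-- The tower map `F_ω : Δ_ω → Δ_{σ ω}`. -/
def towerMap (T : RandomTower p m) (ω : Noise A) (z : X × ℕ) : X × ℕ :=
  if z.2 + 1 < T.R (shift (-(z.2 : ℤ)) ω) z.1 then (z.1, z.2 + 1)
  else (randIter T.f (shift (-(z.2 : ℤ)) ω) (z.2 + 1) z.1, 0)

/-- The composition `F_ω^n = F_{σ^{n-1} ω} ∘ ⋯ ∘ F_ω : Δ_ω → Δ_{σ^n ω}`. -/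
def towerIter (T : RandomTower p m) (ω : Noise A) : ℕ → X × ℕ → X × ℕ
  | 0, z => z
  | n + 1, z => T.towerMap (shift n ω) (T.towerIter ω n z)

/-- The reference measure on `Δ_ω`: the lift of `m` to every level. -/
def refMeasure (T : RandomTower p m) (ω : Noise A) : Measure (X × ℕ) :=
  ((m.restrict T.base).prod Measure.count).restrict (T.fiber ω)

/-- The partition `𝒫_ω` of `Δ_ω`: its elements are the copies `E × {ℓ}` at level `ℓ` of the
elements `E` of the base partition over `σ^{-ℓ} ω` with `R_{σ^{-ℓ} ω} ≥ ℓ + 1` on `E`. -/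
def towerPart (T : RandomTower p m) (ω : Noise A) : Set (Set (X × ℕ)) :=
  {I | ∃ ℓ : ℕ, ∃ E ∈ T.part (shift (-(ℓ : ℤ)) ω),
    (∀ x ∈ E, ℓ + 1 ≤ T.R (shift (-(ℓ : ℤ)) ω) x) ∧ I = E ×ˢ {ℓ}}

/-- The first return time to the base, `R̂_ω(x, ℓ) = R_{σ^{-ℓ} ω}(x) - ℓ` on `Δ_ω`. -/
def hatR (T : RandomTower p m) (ω : Noise A) (z : X × ℕ) : ℕ :=
  T.R (shift (-(z.2 : ℤ)) ω) z.1 - z.2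

/-- The first return map to the base on the whole fibred tower `Δ`: it sends `z ∈ Δ_ω` to
`F_ω^{R̂_ω(z)}(z)`, which is a point of the tower over `σ^{R̂_ω(z)} ω`. -/
def returnMap (T : RandomTower p m) (q : Noise A × (X × ℕ)) : Noise A × (X × ℕ) :=
  (shift (T.hatR q.1 q.2 : ℤ) q.1, T.towerIter q.1 (T.hatR q.1 q.2) q.2)

/-- Two points of `Δ` lie over the same `ω` and in the same element of `𝒫_ω`. -/
def SamePiece (T : RandomTower p m) (q q' : Noise A × (X × ℕ)) : Prop :=
  q.1 = q'.1 ∧ ∃ I ∈ T.towerPart q.1, q.2 ∈ I ∧ q'.2 ∈ I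

/-- The separation time: the least `n ≥ 0` such that the `n`-th returns to the base of the two
points lie in distinct partition elements, and `∞` if there is no such `n`. It is `0` for points
of different towers. -/
def sep (T : RandomTower p m) (q q' : Noise A × (X × ℕ)) : ℕ∞ :=
  ⨅ (n : ℕ) (_ : ¬ T.SamePiece (T.returnMap^[n] q) (T.returnMap^[n] q')), (n : ℕ∞)

/-- The element of `⋁_{j=0}^n F_ω^{-j} 𝒫_{σ^j ω}` that contains `z ∈ Δ_ω`. -/
def atom (T : RandomTower p m) (ω : Noise A) (n : ℕ) (z : X × ℕ) : Set (X × ℕ) :=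
  {w | w ∈ T.fiber ω ∧ ∀ j ≤ n, ∃ I ∈ T.towerPart (shift (j : ℤ) ω),
    T.towerIter ω j z ∈ I ∧ T.towerIter ω j w ∈ I}

/-! ### The standing assumptions on the tower -/

/-- Markov property: every partition element of the base returns bijectively onto the base. -/
def Markov (T : RandomTower p m) : Prop :=
  ∀ᵐ ω ∂(noiseMeasure p), ∀ E ∈ T.part ω, Set.BijOn (T.baseReturn ω) E T.base

/-- Bounded distortion: on every partition element the return map and its inverse are measurable
and non-singular, with a positive Jacobian `J` (`m (f_ω^{R_ω} B) = ∫_B J dm` for measurable `B`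
in the element) that satisfies
`|J x / J y - 1| ≤ D γ ^ s(F_ω^{R_ω} (x, 0), F_ω^{R_ω} (y, 0))`. -/
def BoundedDistortion (T : RandomTower p m) (D γ : ℝ) : Prop :=
  ∀ᵐ ω ∂(noiseMeasure p), ∀ E ∈ T.part ω, ∃ J : X → ℝ, Measurable J ∧
    (∀ x ∈ E, 0 < J x) ∧
    (∀ B ⊆ E, MeasurableSet B → MeasurableSet (T.baseReturn ω '' B) ∧
      m (T.baseReturn ω '' B) = ∫⁻ x in B, ENNReal.ofReal (J x) ∂m) ∧
    ∀ x ∈ E, ∀ y ∈ E, |J x / J y - 1| ≤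
      D * powTop γ (T.sep (T.returnMap (ω, (x, 0))) (T.returnMap (ω, (y, 0))))

/-- Weak expansion: the partition is generating, i.e. the diameters of the elements of
`⋁_{j=0}^n F_ω^{-j} 𝒫_{σ^j ω}` around any given point tend to zero. Every such element lies in
one level of the tower, so its diameter is that of its projection to `X`. -/
def WeakExpansion {A X : Type*} [MeasurableSpace A] [MetricSpace X] [MeasurableSpace X]
    {p : Measure A} [IsProbabilityMeasure p] {m : Measure X} (T : RandomTower p m) : Prop :=
  ∀ᵐ ω ∂(noiseMeasure p), ∀ z ∈ T.fiber ω,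
    Tendsto (fun n : ℕ => Metric.ediam (T.atom ω n z)) atTop (𝓝 0)

/-- Quenched return time asymptotics, with a random threshold `n₁`. -/
def QuenchedTail (T : RandomTower p m) (C a b u v : ℝ) : Prop :=
  ∃ n₁ : Noise A → ℕ, Measurable n₁ ∧
    (∀ᵐ ω ∂(noiseMeasure p), ∀ n : ℕ, 1 ≤ n → n₁ ω ≤ n →
      m {x | x ∈ T.base ∧ n < T.R ω x} ≤
        ENNReal.ofReal (C * (Real.log n ^ b / (n : ℝ) ^ a))) ∧
    ∀ n : ℕ, 1 ≤ n →
      noiseMeasure p {ω | n < n₁ ω} ≤ ENNReal.ofReal (C * Real.exp (-(u * (n : ℝ) ^ v)))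

/-- Aperiodicity. -/
def Aperiodic (T : RandomTower p m) : Prop :=
  ∃ (N : ℕ) (t : Fin N → ℕ) (ε : Fin N → ℝ), Finset.univ.gcd t = 1 ∧ (∀ i, 0 < ε i) ∧
    ∀ᵐ ω ∂(noiseMeasure p), ∀ i,
      ENNReal.ofReal (ε i) < m {x | x ∈ T.base ∧ T.R ω x = t i}

/-- Finiteness: the total masses of the towers are uniformly bounded. -/
def FiniteMass (T : RandomTower p m) : Prop :=
  ∃ M : ℝ, 0 < M ∧ ∀ᵐ ω ∂(noiseMeasure p), T.refMeasure ω Set.univ ≤ ENNReal.ofReal M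

/-- Annealed return time asymptotics. -/
def AnnealedTail (T : RandomTower p m) : Prop :=
  ∃ C a b : ℝ, 0 < C ∧ 1 < a ∧ 0 ≤ b ∧ ∀ n : ℕ, 2 ≤ n →
    ((noiseMeasure p).prod (m.restrict T.base)) {q | T.R q.1 q.2 = n} ≤
      ENNReal.ofReal (C * (Real.log n ^ b / (n : ℝ) ^ (a + 1)))

/-! ### Function spaces on the tower -/

/-- The cone `𝓕_γ^+` of random functions `φ_ω : Δ_ω → ℝ`; the constant does not depend on `ω`. -/
def MemFPlus (T : RandomTower p m) (γ : ℝ) (φ : Noise A → X × ℕ → ℝ) : Prop :=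
  ∃ C : ℝ, 0 < C ∧ ∀ᵐ ω ∂(noiseMeasure p), ∀ I ∈ T.towerPart ω,
    (∀ x ∈ I, φ ω x = 0) ∨
    ((∀ x ∈ I, 0 < φ ω x) ∧
      ∀ x ∈ I, ∀ y ∈ I,
        |Real.log (φ ω x / φ ω y)| ≤ C * powTop γ (T.sep (ω, x) (ω, y)))

/-- The space `𝓛_∞^K` of random bounded functions. -/
def MemLInfty (T : RandomTower p m) (K : Noise A → ℝ) (φ : Noise A → X × ℕ → ℝ) : Prop :=
  ∃ C : ℝ, 0 < C ∧ ∀ᵐ ω ∂(noiseMeasure p), ∀ x ∈ T.fiber ω, |φ ω x| ≤ C * K ω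

/-- The space `𝓕_γ^K` of random Lipschitz functions; the constants do not depend on `ω`. -/
def MemFLip (T : RandomTower p m) (γ : ℝ) (K : Noise A → ℝ) (φ : Noise A → X × ℕ → ℝ) : Prop :=
  T.MemLInfty K φ ∧
  ∃ C : ℝ, 0 < C ∧ ∀ᵐ ω ∂(noiseMeasure p), ∀ x ∈ T.fiber ω, ∀ y ∈ T.fiber ω,
    |φ ω x - φ ω y| ≤ C * K ω * powTop γ (T.sep (ω, x) (ω, y))

/-! ### Equivariance, exactness and mixing -/

/-- Equivariance: `(F_ω)_* ν_ω = ν_{σ ω}` for almost every `ω`. -/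
def Equivariant (T : RandomTower p m) (ν : Kernel (Noise A) (X × ℕ)) : Prop :=
  ∀ᵐ ω ∂(noiseMeasure p), (ν ω).map (T.towerMap ω) = ν (shift 1 ω)

/-- Exactness of the fibred system `(F_ω, ν_ω)`: for almost every `ω` the tail `σ`-algebra
`⋂_n (F_ω^n)^{-1} 𝓑_{σ^n ω}` on `Δ_ω` is trivial for `ν_ω`. -/
def Exact (T : RandomTower p m) (ν : Kernel (Noise A) (X × ℕ)) : Prop :=
  ∀ᵐ ω ∂(noiseMeasure p), ∀ B : Set (X × ℕ),
    (∀ n : ℕ, ∃ B' : Set (X × ℕ), MeasurableSet B' ∧ B' ⊆ T.fiber (shift (n : ℤ) ω) ∧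
      B = T.fiber ω ∩ T.towerIter ω n ⁻¹' B') →
    ν ω B = 0 ∨ ν ω B = 1

/-- Mixing of the random skew product `(F, ν)`. -/
def Mixing (T : RandomTower p m) (ν : Kernel (Noise A) (X × ℕ)) : Prop :=
  ∀ φ ψ : Noise A × (X × ℕ) → ℝ,
    MemLp φ 2 (noiseMeasure p ⊗ₘ ν) → MemLp ψ 2 (noiseMeasure p ⊗ₘ ν) →
    Tendsto (fun n : ℕ =>
      |(∫ ω, ∫ z, φ (shift (n : ℤ) ω, T.towerIter ω n z) * ψ (ω, z) ∂(ν ω) ∂(noiseMeasure p)) -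
        (∫ ω, ∫ z, φ (ω, z) ∂(ν ω) ∂(noiseMeasure p)) *
          ∫ ω, ∫ z, ψ (ω, z) ∂(ν ω) ∂(noiseMeasure p)|) atTop (𝓝 0)

end RandomTower

/-- A random variable `K` on the noise space, bounded away from zero, with
`P {K > n} ≤ exp (-u n^v)` for every `n ∈ ℕ`. -/
def IsTailWeight {A : Type*} [MeasurableSpace A] (p : Measure A) [IsProbabilityMeasure p]
    (u v : ℝ) (K : Noise A → ℝ) : Prop :=
  Measurable K ∧ (∃ κ : ℝ, 0 < κ ∧ ∀ ω, κ ≤ K ω) ∧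
  ∀ n : ℕ, noiseMeasure p {ω | (n : ℝ) < K ω} ≤ ENNReal.ofReal (Real.exp (-(u * (n : ℝ) ^ v)))

end RandomTowers

end

/-!
Put `c = D / (1 - γ)`, so that `c γ + D = c`. Call a density on the tower over `ω` regular if it is
at most `e ^ c` and its logarithm oscillates by at most `c γ ^ s` on partition elements and on the
base. A return to the base contracts the oscillation from `c` to `c γ`, and the Jacobian adds `D`;
hence the tower maps preserve regular densities (`Good.regular_map`). Moreover a regular measure
dominates `e ^ (-c)` times its mass on the base (`Regular.smul_baseLevelMeasure_le`).

**Existence.** The images of `m` on the base under the skew product have densities with respect to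
the reference measure of the whole tower, and these are regular on almost every fibre. Their Cesàro
averages are almost invariant. The almost invariant regular densities form a decreasing sequence of
nonempty, closed, bounded, convex sets in `L²`, and an element of the intersection is invariant
(`exists_invariant_density`). A disintegration argument, for which the generating property provides
the separability of the base, turns this into equivariance on the fibres. The extension of McShane
yields a version of the density that is regular everywhere (`Good.exists_regular_version`). The
bounds are uniform in the noise, because they only involve `c`; therefore the weight `K` of the
function spaces can be taken constant.

**Exactness.** Let `B` be a tail set in a generic fibre such that both `B` and its complement have
positive mass. By the density argument for cylinders (`Good.exists_cyl_diff_lt`) and bounded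
distortion, at some time `B` fills the base up to a small proportion, and likewise for the
complement (`Generic.exists_time_nearly_full`). By aperiodicity, the mass of the base at time `0`
has a definite part on the base at every large time (`exists_minorizes`), with a constant that
depends on the time. To make the constant uniform along infinitely many times, times are used at
which the fibre has little mass above a fixed level; they exist by Poincaré recurrence
(`ae_frequently_lowTop`, `exists_minorization_of_lowTop`). At such a time both `B` and its
complement fill more than half of the base, a contradiction (`Generic.tail_trivial`).

**Mixing.** A square integrable function `ψ` splits into its projection to the intersection of the
spaces of functions of the noise and the position at time `n`, and a remainder. The remainder
decorrelates from `φ ∘ F ^ n` (`tendsto_inner_of_mem_orthogonal_iInf`). By exactness the projection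
depends on the noise only (`ae_eq_integral_of_mem_futureSpace`), so that mixing follows from the
mixing of the Bernoulli shift (`tendsto_integral_shift_mul`).
-/

noncomputable section

namespace RandomTowers

/-! ### The shift and the weights `γ ^ s` -/

section Shift

variable {A : Type*}

@[simp] lemma shift_zero (ω : Noise A) : shift 0 ω = ω := by
  funext k; simp [shift]

@[simp] lemma shift_shift (a b : ℤ) (ω : Noise A) : shift a (shift b ω) = shift (a + b) ω := by
  funext k; simp [shift, add_assoc]

lemma shift_iterate (n : ℕ) (ω : Noise A) : (shift 1)^[n] ω = shift n ω := by
  induction n generalizing ω with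
  | zero => simp
  | succ n ih => simp [Function.iterate_succ_apply, ih]

variable [MeasurableSpace A]

@[fun_prop]
lemma measurable_shift (n : ℤ) : Measurable (shift n : Noise A → Noise A) :=
  measurable_pi_lambda _ fun k => measurable_pi_apply (k + n)

instance (p : Measure A) [IsProbabilityMeasure p] : IsProbabilityMeasure (noiseMeasure p) := by
  unfold noiseMeasure; infer_instance

lemma measurePreserving_shift (p : Measure A) [IsProbabilityMeasure p] (n : ℤ) :
    MeasurePreserving (shift n) (noiseMeasure p) (noiseMeasure p) :=
  ⟨measurable_shift n, Measure.map_infinitePi_infinitePi_of_inj (f := fun k : ℤ => k + n)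
    (P := fun _ => p) (add_left_injective n)⟩

lemma ae_forall_shift {p : Measure A} [IsProbabilityMeasure p] {q : Noise A → Prop}
    (h : ∀ᵐ ω ∂(noiseMeasure p), q ω) : ∀ᵐ ω ∂(noiseMeasure p), ∀ k : ℤ, q (shift k ω) :=
  ae_all_iff.2 fun k => (measurePreserving_shift p k).quasiMeasurePreserving.ae h

end Shift

section PowTop

variable {γ : ℝ}

lemma powTop_nonneg (h : 0 ≤ γ) (s : ℕ∞) : 0 ≤ powTop γ s := by
  unfold powTop; split_ifs <;> positivity

lemma powTop_le_one (h : 0 ≤ γ) (h1 : γ ≤ 1) (s : ℕ∞) : powTop γ s ≤ 1 := by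
  unfold powTop; split_ifs
  · exact zero_le_one
  · exact pow_le_one₀ h h1

@[simp] lemma powTop_top : powTop γ ⊤ = 0 := by simp [powTop]

@[simp] lemma powTop_zero : powTop γ 0 = 1 := by simp [powTop]

lemma powTop_natCast (n : ℕ) : powTop γ n = γ ^ n := by simp [powTop]

lemma powTop_add_one (s : ℕ∞) : powTop γ (s + 1) = γ * powTop γ s := by
  cases s with
  | top => simp
  | coe n =>
    have : ((n : ℕ∞) + 1) = ((n + 1 : ℕ) : ℕ∞) := by push_cast; rfl
    rw [this, powTop_natCast, powTop_natCast, pow_succ, mul_comm]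

lemma powTop_anti (h : 0 ≤ γ) (h1 : γ ≤ 1) {s t : ℕ∞} (hst : s ≤ t) :
    powTop γ t ≤ powTop γ s := by
  cases t with
  | top => simpa using powTop_nonneg h s
  | coe n =>
    lift s to ℕ using ne_top_of_le_ne_top (by simp) hst
    rw [powTop_natCast, powTop_natCast]
    exact pow_le_pow_of_le_one h h1 (by exact_mod_cast hst)

end PowTop

namespace RandomTower

variable {A X : Type*} [MeasurableSpace A] [MeasurableSpace X]
  {p : Measure A} [IsProbabilityMeasure p] {m : Measure X} {T : RandomTower p m}

/-! ### Separation times -/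

lemma samePiece_comm {q q' : Noise A × (X × ℕ)} : T.SamePiece q q' ↔ T.SamePiece q' q := by
  unfold SamePiece
  constructor <;>
  · rintro ⟨h, I, hI, h1, h2⟩
    exact ⟨h.symm, I, h ▸ hI, h2, h1⟩

lemma natCast_le_sep {k : ℕ} {q q' : Noise A × (X × ℕ)} :
    (k : ℕ∞) ≤ T.sep q q' ↔ ∀ n < k, T.SamePiece (T.returnMap^[n] q) (T.returnMap^[n] q') := by
  unfold sep
  rw [le_iInf₂_iff]
  constructor
  · intro h n hn
    by_contra hc
    exact absurd (h n hc) (by simpa using hn)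
  · intro h n hc
    by_contra hn
    exact hc (h n (by simpa using hn))

lemma sep_comm (q q' : Noise A × (X × ℕ)) : T.sep q q' = T.sep q' q := by
  unfold sep
  simp_rw [samePiece_comm (T := T) (q := T.returnMap^[_] q)]

lemma enat_eq_of_forall {s t : ℕ∞} (h : ∀ k : ℕ, (k : ℕ∞) ≤ s ↔ (k : ℕ∞) ≤ t) : s = t :=
  le_antisymm (ENat.forall_natCast_le_iff_le.1 fun k hk => (h k).1 hk)
    (ENat.forall_natCast_le_iff_le.1 fun k hk => (h k).2 hk)

lemma sep_eq_zero {q q' : Noise A × (X × ℕ)} (h : ¬ T.SamePiece q q') : T.sep q q' = 0 := by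
  by_contra hc
  have : ((1 : ℕ) : ℕ∞) ≤ T.sep q q' := by simpa using Order.one_le_iff_ne_zero.2 hc
  exact h (natCast_le_sep.1 this 0 one_pos)

lemma sep_eq_add_one {q q' : Noise A × (X × ℕ)} (h : T.SamePiece q q') :
    T.sep q q' = T.sep (T.returnMap q) (T.returnMap q') + 1 := by
  refine enat_eq_of_forall fun k => ?_
  cases k with
  | zero => simp
  | succ k =>
    have : ((k + 1 : ℕ) : ℕ∞) ≤ T.sep (T.returnMap q) (T.returnMap q') + 1 ↔
        (k : ℕ∞) ≤ T.sep (T.returnMap q) (T.returnMap q') := by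
      push_cast
      exact ENat.add_le_add_iff_right (by simp)
    rw [this, natCast_le_sep, natCast_le_sep]
    constructor
    · intro H n hn
      exact H (n + 1) (by omega)
    · intro H n hn
      cases n with
      | zero => exact h
      | succ n => exact H n (by omega)

lemma one_le_sep_iff {q q' : Noise A × (X × ℕ)} : 1 ≤ T.sep q q' ↔ T.SamePiece q q' := by
  constructor
  · intro h; by_contra hc; simp [sep_eq_zero hc] at h
  · intro h; rw [sep_eq_add_one h]; simp

/-! ### Iterates of the tower map -/

lemma towerIter_add (ω : Noise A) (n k : ℕ) (z : X × ℕ) :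
    T.towerIter ω (n + k) z = T.towerIter (shift n ω) k (T.towerIter ω n z) := by
  induction k with
  | zero => rfl
  | succ k ih =>
    rw [← add_assoc]
    simp only [towerIter, ih, shift_shift]
    push_cast
    rw [add_comm (k : ℤ)]

lemma towerIter_one (ω : Noise A) (z : X × ℕ) : T.towerIter ω 1 z = T.towerMap ω z := by
  simp [towerIter]

lemma towerMap_up {ω : Noise A} {x : X} {ℓ : ℕ} (h : ℓ + 1 < T.R (shift (-(ℓ : ℤ)) ω) x) :
    T.towerMap ω (x, ℓ) = (x, ℓ + 1) := by
  simp [towerMap, h]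

lemma towerMap_return {ω : Noise A} {x : X} {ℓ : ℕ}
    (h : T.R (shift (-(ℓ : ℤ)) ω) x = ℓ + 1) :
    T.towerMap ω (x, ℓ) = (T.baseReturn (shift (-(ℓ : ℤ)) ω) x, 0) := by
  simp [towerMap, h, baseReturn]

lemma towerIter_lt {ω : Noise A} {x : X} {ℓ k : ℕ}
    (h : ℓ + k < T.R (shift (-(ℓ : ℤ)) ω) x) : T.towerIter ω k (x, ℓ) = (x, ℓ + k) := by
  induction k with
  | zero => rfl
  | succ k ih =>
    rw [towerIter, ih (by omega)]
    refine towerMap_up ?_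
    have : shift (-((ℓ + k : ℕ) : ℤ)) (shift (k : ℤ) ω) = shift (-(ℓ : ℤ)) ω := by
      simp
    rw [this]; omega

/-- A point of level `ℓ` reaches the base at time `R - ℓ`. -/
lemma towerIter_hatR {ω : Noise A} {x : X} {ℓ : ℕ}
    (h : ℓ < T.R (shift (-(ℓ : ℤ)) ω) x) :
    T.towerIter ω (T.R (shift (-(ℓ : ℤ)) ω) x - ℓ) (x, ℓ) =
      (T.baseReturn (shift (-(ℓ : ℤ)) ω) x, 0) := by
  obtain ⟨r, hr⟩ : ∃ r, T.R (shift (-(ℓ : ℤ)) ω) x = ℓ + r + 1 := ⟨_, by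
    rw [← Nat.sub_add_cancel (Nat.succ_le_of_lt h)]
    rw [show ∀ a : ℕ, a + Nat.succ ℓ = ℓ + a + 1 by intro a; omega]⟩
  rw [show T.R (shift (-(ℓ : ℤ)) ω) x - ℓ = r + 1 by omega, towerIter,
    towerIter_lt (by omega)]
  have hs : shift (-((ℓ + r : ℕ) : ℤ)) (shift (r : ℤ) ω) = shift (-(ℓ : ℤ)) ω := by simp
  rw [towerMap_return (by rw [hs, hr]), hs]

lemma towerIter_base {ω : Noise A} {x : X} (h : 0 < T.R ω x) :
    T.towerIter ω (T.R ω x) (x, 0) = (T.baseReturn ω x, 0) := by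
  simpa using towerIter_hatR (T := T) (ω := ω) (x := x) (ℓ := 0) (by simpa using h)

lemma returnMap_of_lt {ω : Noise A} {x : X} {ℓ : ℕ}
    (h : ℓ < T.R (shift (-(ℓ : ℤ)) ω) x) :
    T.returnMap (ω, (x, ℓ)) = (shift (T.R (shift (-(ℓ : ℤ)) ω) x : ℤ) (shift (-(ℓ : ℤ)) ω),
      (T.baseReturn (shift (-(ℓ : ℤ)) ω) x, 0)) := by
  simp only [returnMap, hatR, towerIter_hatR h, shift_shift]
  rw [Nat.cast_sub h.le, sub_eq_add_neg]

lemma returnMap_base {ω : Noise A} {x : X} (h : 0 < T.R ω x) :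
    T.returnMap (ω, (x, 0)) = (shift (T.R ω x : ℤ) ω, (T.baseReturn ω x, 0)) := by
  simpa using returnMap_of_lt (T := T) (ω := ω) (x := x) (ℓ := 0) (by simpa using h)

/-- A level of at least `k` can only be reached in `k` steps if none of these steps is a return. -/
lemma le_level_towerIter {ω : Noise A} {z : X × ℕ} {k : ℕ} (h : k ≤ (T.towerIter ω k z).2) :
    (T.towerIter ω k z).2 = z.2 + k := by
  induction k with
  | zero => rfl
  | succ k ih =>
    rw [towerIter] at h ⊢
    unfold towerMap at h ⊢
    split_ifs at h ⊢ with h1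
    · simp only at h ⊢
      rw [ih (by omega)]; omega
    · simp at h

/-! ### Measurability -/

@[fun_prop]
lemma measurable_shift_natLevel :
    Measurable (fun q : Noise A × ℕ => shift (-(q.2 : ℤ)) q.1) :=
  measurable_from_prod_countable_left fun n => measurable_shift (-(n : ℤ))

lemma measurable_R_comp {Y : Type*} [MeasurableSpace Y] {a : Y → Noise A} {x : Y → X}
    (ha : Measurable a) (hx : Measurable x) : Measurable (fun y => T.R (a y) (x y)) :=
  T.measurable_R.comp (ha.prodMk hx)

lemma measurable_randIter (n : ℕ) :
    Measurable (fun q : Noise A × X => randIter T.f q.1 n q.2) := by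
  induction n with
  | zero => exact measurable_snd
  | succ n ih =>
    exact T.measurable_f.comp
      (((measurable_pi_apply (n : ℤ)).comp measurable_fst).prodMk ih)

lemma measurable_baseReturn_uncurry :
    Measurable (fun q : Noise A × X => T.baseReturn q.1 q.2) := by
  have h : Measurable (fun q : ℕ × (Noise A × X) => randIter T.f q.2.1 q.1 q.2.2) :=
    measurable_from_prod_countable_right fun n => measurable_randIter n
  exact h.comp (T.measurable_R.prodMk measurable_id)

lemma measurable_baseReturn (ω : Noise A) : Measurable (T.baseReturn ω) :=
  measurable_baseReturn_uncurry.comp measurable_prodMk_left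

lemma measurable_levelR :
    Measurable (fun q : Noise A × (X × ℕ) => T.R (shift (-(q.2.2 : ℤ)) q.1) q.2.1) :=
  measurable_R_comp (measurable_shift_natLevel.comp
    (measurable_fst.prodMk (measurable_snd.comp measurable_snd)))
    (measurable_fst.comp measurable_snd)

lemma measurable_towerMap_uncurry :
    Measurable (fun q : Noise A × (X × ℕ) => T.towerMap q.1 q.2) := by
  unfold towerMap
  refine Measurable.ite ?_ ?_ ?_
  · exact measurableSet_lt
      ((measurable_snd.comp measurable_snd).add_const 1) measurable_levelR
  · fun_prop
  · have h : Measurable (fun q : ℕ × (Noise A × X) => randIter T.f q.2.1 q.1 q.2.2) :=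
      measurable_from_prod_countable_right fun n => measurable_randIter n
    have h2 : Measurable (fun q : Noise A × (X × ℕ) =>
        (q.2.2 + 1, (shift (-(q.2.2 : ℤ)) q.1, q.2.1))) :=
      ((measurable_snd.comp measurable_snd).add_const 1).prodMk
        ((measurable_shift_natLevel.comp (measurable_fst.prodMk
          (measurable_snd.comp measurable_snd))).prodMk (measurable_fst.comp measurable_snd))
    exact (h.comp h2).prodMk measurable_const

lemma measurable_towerMap (ω : Noise A) : Measurable (T.towerMap ω) :=
  measurable_towerMap_uncurry.comp measurable_prodMk_left

lemma measurable_towerIter_uncurry (n : ℕ) :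
    Measurable (fun q : Noise A × (X × ℕ) => T.towerIter q.1 n q.2) := by
  induction n with
  | zero => exact measurable_snd
  | succ n ih =>
    exact measurable_towerMap_uncurry.comp
      (((measurable_shift _).comp measurable_fst).prodMk ih)

lemma measurable_towerIter (ω : Noise A) (n : ℕ) : Measurable (T.towerIter ω n) :=
  (measurable_towerIter_uncurry n).comp measurable_prodMk_left

lemma measurableSet_fiberTotal : MeasurableSet {q : Noise A × (X × ℕ) | q.2 ∈ T.fiber q.1} := by
  refine MeasurableSet.inter (s₁ := {q : Noise A × (X × ℕ) | q.2.1 ∈ T.base}) ?_ ?_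
  · exact T.measurableSet_base.preimage (by fun_prop)
  · exact measurableSet_lt (by fun_prop) measurable_levelR

lemma measurableSet_fiber (ω : Noise A) : MeasurableSet (T.fiber ω) :=
  measurableSet_fiberTotal.preimage measurable_prodMk_left

/-! ### Generic noise sequences -/

/-- All fibrewise hypotheses on partition and return map hold at `ω`. -/
structure GoodAt (T : RandomTower p m) (D γ : ℝ) (ω : Noise A) : Prop where
  R_pos : ∀ x ∈ T.base, 1 ≤ T.R ω x
  countable : (T.part ω).Countable
  measurable : ∀ E ∈ T.part ω, MeasurableSet E
  disjoint : (T.part ω).PairwiseDisjoint id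
  cover : ⋃₀ T.part ω = T.base
  R_const : ∀ E ∈ T.part ω, ∀ x ∈ E, ∀ y ∈ E, T.R ω x = T.R ω y
  bijOn : ∀ E ∈ T.part ω, Set.BijOn (T.baseReturn ω) E T.base
  jacobian : ∀ E ∈ T.part ω, ∃ J : X → ℝ, Measurable J ∧
    (∀ x ∈ E, 0 < J x) ∧
    (∀ B ⊆ E, MeasurableSet B → MeasurableSet (T.baseReturn ω '' B) ∧
      m (T.baseReturn ω '' B) = ∫⁻ x in B, ENNReal.ofReal (J x) ∂m) ∧
    ∀ x ∈ E, ∀ y ∈ E, |J x / J y - 1| ≤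
      D * powTop γ (T.sep (T.returnMap (ω, (x, 0))) (T.returnMap (ω, (y, 0))))

/-- All fibrewise hypotheses hold along the whole orbit of `ω` under the shift. -/
def Good (T : RandomTower p m) (D γ : ℝ) (ω : Noise A) : Prop :=
  ∀ k : ℤ, T.GoodAt D γ (shift k ω)

lemma ae_good {D γ : ℝ} (hMarkov : T.Markov) (hDist : T.BoundedDistortion D γ) :
    ∀ᵐ ω ∂(noiseMeasure p), T.Good D γ ω := by
  refine ae_forall_shift ?_
  filter_upwards [T.R_pos, T.part_countable, T.part_measurable, T.part_disjoint, T.part_cover,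
    T.R_const, hMarkov, hDist] with ω h1 h2 h3 h4 h5 h6 h7 h8
  exact ⟨h1, h2, h3, h4, h5, h6, h7, h8⟩

variable {D γ : ℝ} {ω : Noise A}

lemma Good.along (h : T.Good D γ ω) (k : ℤ) : T.Good D γ (shift k ω) := fun j => by
  rw [shift_shift]; exact h _

lemma Good.at_zero (h : T.Good D γ ω) : T.GoodAt D γ ω := by simpa using h 0

lemma GoodAt.subset_base (h : T.GoodAt D γ ω) {E : Set X} (hE : E ∈ T.part ω) : E ⊆ T.base := by
  rw [← h.cover]; exact Set.subset_sUnion_of_mem hE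

lemma GoodAt.exists_mem (h : T.GoodAt D γ ω) {x : X} (hx : x ∈ T.base) : ∃ E ∈ T.part ω, x ∈ E := by
  rw [← h.cover] at hx; exact hx

lemma GoodAt.eq_of_mem (h : T.GoodAt D γ ω) {E E' : Set X} (hE : E ∈ T.part ω)
    (hE' : E' ∈ T.part ω) {x : X} (hx : x ∈ E) (hx' : x ∈ E') : E = E' :=
  h.disjoint.elim_set hE hE' x hx hx'

lemma base_nonempty (T : RandomTower p m) : T.base.Nonempty := by
  by_contra h
  have := T.measure_base
  rw [Set.not_nonempty_iff_eq_empty.1 h] at this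
  simp at this

lemma GoodAt.nonempty (h : T.GoodAt D γ ω) {E : Set X} (hE : E ∈ T.part ω) : E.Nonempty := by
  obtain ⟨y, hy⟩ := T.base_nonempty
  obtain ⟨x, hx, -⟩ := (h.bijOn E hE).surjOn hy
  exact ⟨x, hx⟩

lemma Good.samePiece_iff (h : T.Good D γ ω) {z w : X × ℕ} :
    T.SamePiece (ω, z) (ω, w) ↔ z.2 = w.2 ∧ ∃ E ∈ T.part (shift (-(z.2 : ℤ)) ω),
      z.1 ∈ E ∧ w.1 ∈ E ∧ z.2 < T.R (shift (-(z.2 : ℤ)) ω) z.1 := by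
  constructor
  · rintro ⟨-, I, ⟨ℓ, E, hE, hR, rfl⟩, hz, hw⟩
    obtain ⟨hz1, hz2⟩ := hz
    obtain ⟨hw1, hw2⟩ := hw
    simp only [Set.mem_singleton_iff] at hz1 hz2 hw1 hw2
    refine ⟨by rw [hz2, hw2], E, ?_, hz1, hw1, ?_⟩
    · simpa only [hz2] using hE
    · simpa only [hz2] using Nat.lt_of_succ_le (hR _ hz1)
  · rintro ⟨hl, E, hE, hz, hw, hR⟩
    refine ⟨rfl, E ×ˢ {z.2}, ⟨z.2, E, hE, fun x hx => ?_, rfl⟩, ⟨hz, rfl⟩, ⟨hw, hl.symm⟩⟩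
    rw [(h _).R_const E hE x hx z.1 hz]; exact hR

lemma Good.samePiece_self (h : T.Good D γ ω) {z : X × ℕ} (hz : z ∈ T.fiber ω) :
    T.SamePiece (ω, z) (ω, z) := by
  obtain ⟨E, hE, hx⟩ := (h (-(z.2 : ℤ))).exists_mem hz.1
  exact h.samePiece_iff.2 ⟨rfl, E, hE, hx, hx, hz.2⟩

lemma Good.samePiece_trans (h : T.Good D γ ω) {z w y : X × ℕ}
    (h1 : T.SamePiece (ω, z) (ω, w)) (h2 : T.SamePiece (ω, w) (ω, y)) :
    T.SamePiece (ω, z) (ω, y) := by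
  rw [h.samePiece_iff] at h1 h2 ⊢
  obtain ⟨hl, E, hE, hz, hw, hR⟩ := h1
  obtain ⟨hl', E', hE', hw', hy, hR'⟩ := h2
  rw [← hl] at hE'
  rw [(h _).eq_of_mem hE' hE hw' hw] at hy
  exact ⟨hl.trans hl', E, hE, hz, hy, hR⟩

lemma SamePiece.mem_fiber_left (h : T.Good D γ ω) {z w : X × ℕ}
    (hs : T.SamePiece (ω, z) (ω, w)) : z ∈ T.fiber ω := by
  obtain ⟨-, E, hE, hz, -, hR⟩ := h.samePiece_iff.1 hs
  exact ⟨(h _).subset_base hE hz, hR⟩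

/-- Points of a common piece return at the same time. -/
lemma Good.returnMap_of_samePiece (h : T.Good D γ ω) {z w : X × ℕ}
    (hs : T.SamePiece (ω, z) (ω, w)) : ∃ k : ℤ, ∃ x ∈ T.base, ∃ y ∈ T.base,
      T.returnMap (ω, z) = (shift k ω, (x, 0)) ∧
      T.returnMap (ω, w) = (shift k ω, (y, 0)) := by
  obtain ⟨hl, E, hE, hz, hw, hR⟩ := h.samePiece_iff.1 hs
  obtain ⟨x, ℓ⟩ := z
  obtain ⟨y, ℓ'⟩ := w
  simp only at hl hE hz hw hR
  subst hl
  have hRy := (h (-(ℓ : ℤ))).R_const E hE x hz y hw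
  rw [returnMap_of_lt hR, returnMap_of_lt (hRy ▸ hR), ← hRy, shift_shift]
  exact ⟨_, _, ((h _).bijOn E hE).mapsTo hz, _, ((h _).bijOn E hE).mapsTo hw, rfl, rfl⟩

lemma Good.base_mem_fiber (h : T.Good D γ ω) {x : X} (hx : x ∈ T.base) : (x, 0) ∈ T.fiber ω :=
  ⟨hx, by simpa using Nat.lt_of_succ_le (h.at_zero.R_pos x hx)⟩

lemma Good.natCast_le_sep_trans (k : ℕ) : ∀ {ω : Noise A}, T.Good D γ ω → ∀ {z w y : X × ℕ},
    (k : ℕ∞) ≤ T.sep (ω, z) (ω, w) → (k : ℕ∞) ≤ T.sep (ω, w) (ω, y) →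
    (k : ℕ∞) ≤ T.sep (ω, z) (ω, y) := by
  induction k with
  | zero => simp
  | succ k ih =>
    intro ω h z w y h1 h2
    have s1 : T.SamePiece (ω, z) (ω, w) := one_le_sep_iff.1 (le_trans (by simp) h1)
    have s2 : T.SamePiece (ω, w) (ω, y) := one_le_sep_iff.1 (le_trans (by simp) h2)
    have s3 := h.samePiece_trans s1 s2
    rw [sep_eq_add_one s1] at h1
    rw [sep_eq_add_one s2] at h2
    rw [sep_eq_add_one s3]
    obtain ⟨j, x₁, -, x₂, -, e1, e2⟩ := h.returnMap_of_samePiece s1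
    obtain ⟨j', y₁, -, y₂, -, e3, e4⟩ := h.returnMap_of_samePiece s3
    obtain ⟨-, hj⟩ := Prod.ext_iff.1 (e1.symm.trans e3)
    have hj' : shift j ω = shift j' ω :=
      (Prod.ext_iff.1 (e1.symm.trans e3)).1
    rw [← hj'] at e4
    rw [e1, e2] at h1
    rw [e2, e4] at h2
    rw [e1, e4]
    push_cast at h1 h2 ⊢
    rw [ENat.add_le_add_iff_right (by simp)] at h1 h2 ⊢
    exact ih (h.along j) h1 h2

/-- The separation time is an ultrametric. -/
lemma Good.min_sep_le (h : T.Good D γ ω) (z w y : X × ℕ) :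
    min (T.sep (ω, z) (ω, w)) (T.sep (ω, w) (ω, y)) ≤ T.sep (ω, z) (ω, y) := by
  refine ENat.forall_natCast_le_iff_le.1 fun k hk => ?_
  rw [le_min_iff] at hk
  exact h.natCast_le_sep_trans k hk.1 hk.2

lemma Good.sep_self_aux (k : ℕ) : ∀ {ω : Noise A}, T.Good D γ ω → ∀ {z : X × ℕ}, z ∈ T.fiber ω →
    (k : ℕ∞) ≤ T.sep (ω, z) (ω, z) := by
  induction k with
  | zero => simp
  | succ k ih =>
    intro ω h z hz
    have s := h.samePiece_self hz
    rw [sep_eq_add_one s]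
    obtain ⟨j, x, hx, y, hy, e1, -⟩ := h.returnMap_of_samePiece s
    rw [e1]
    push_cast
    gcongr
    exact ih (h.along j) ((h.along j).base_mem_fiber hx)

lemma Good.sep_self (h : T.Good D γ ω) {z : X × ℕ} (hz : z ∈ T.fiber ω) :
    T.sep (ω, z) (ω, z) = ⊤ :=
  ENat.eq_top_iff_forall_ge.2 fun k => Good.sep_self_aux k h hz

/-- Two points of one piece have the separation time of their projections to the base. -/
lemma Good.sep_level (h : T.Good D γ ω) {ℓ : ℕ} {E : Set X}
    (hE : E ∈ T.part (shift (-(ℓ : ℤ)) ω)) {x y : X} (hx : x ∈ E) (hy : y ∈ E)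
    (hR : ℓ < T.R (shift (-(ℓ : ℤ)) ω) x) :
    T.sep (ω, (x, ℓ)) (ω, (y, ℓ)) =
      T.sep (shift (-(ℓ : ℤ)) ω, (x, 0)) (shift (-(ℓ : ℤ)) ω, (y, 0)) := by
  have hRy := (h (-(ℓ : ℤ))).R_const E hE x hx y hy
  have h0 : T.Good D γ (shift (-(ℓ : ℤ)) ω) := h.along _
  have s1 : T.SamePiece (ω, (x, ℓ)) (ω, (y, ℓ)) := h.samePiece_iff.2 ⟨rfl, E, hE, hx, hy, hR⟩
  have s2 : T.SamePiece (shift (-(ℓ : ℤ)) ω, (x, 0)) (shift (-(ℓ : ℤ)) ω, (y, 0)) :=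
    h0.samePiece_iff.2 ⟨rfl, E, by simpa using hE, hx, hy, by
      simpa using (Nat.zero_le ℓ).trans_lt hR⟩
  rw [sep_eq_add_one s1, sep_eq_add_one s2,
    returnMap_of_lt hR, returnMap_of_lt (hRy ▸ hR), returnMap_base (by omega),
    returnMap_base (by omega)]

lemma Good.towerMap_mem_fiber (h : T.Good D γ ω) {z : X × ℕ} (hz : z ∈ T.fiber ω) :
    T.towerMap ω z ∈ T.fiber (shift 1 ω) := by
  obtain ⟨x, ℓ⟩ := z
  obtain ⟨hx, hR⟩ := hz
  simp only at hx hR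
  by_cases h1 : ℓ + 1 < T.R (shift (-(ℓ : ℤ)) ω) x
  · rw [towerMap_up h1]
    refine ⟨hx, ?_⟩
    simpa using h1
  · rw [towerMap_return (by omega)]
    obtain ⟨E, hE, hxE⟩ := (h (-(ℓ : ℤ))).exists_mem hx
    exact (h.along 1).base_mem_fiber (((h _).bijOn E hE).mapsTo hxE)

lemma Good.towerIter_mem_fiber (h : T.Good D γ ω) {z : X × ℕ} (hz : z ∈ T.fiber ω) (n : ℕ) :
    T.towerIter ω n z ∈ T.fiber (shift n ω) := by
  induction n with
  | zero => simpa [towerIter] using hz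
  | succ n ih =>
    have := (h.along n).towerMap_mem_fiber ih
    rw [shift_shift] at this
    push_cast
    rwa [add_comm (n : ℤ)]

end RandomTower

end RandomTowers

namespace RandomTowers
namespace RandomTower

variable {A X : Type*} [MeasurableSpace A] [MeasurableSpace X]
  {p : Measure A} [IsProbabilityMeasure p] {m : Measure X} {T : RandomTower p m}
  {D γ c : ℝ} {ω : Noise A}

/-! ### Regular densities and the return map -/

/-- The probability measure `m` restricted to the base. -/
def baseMeasure (T : RandomTower p m) : Measure X := m.restrict T.base

instance : IsProbabilityMeasure T.baseMeasure :=
  ⟨by rw [baseMeasure, Measure.restrict_apply_univ, T.measure_base]⟩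

/-- The factor `exp (c γ ^ s(q, q'))` that bounds the oscillation of regular densities. -/
def wt (T : RandomTower p m) (γ c : ℝ) (q q' : Noise A × (X × ℕ)) : ℝ≥0∞ :=
  ENNReal.ofReal (Real.exp (c * powTop γ (T.sep q q')))

lemma wt_le (h0 : 0 ≤ γ) (h1 : γ ≤ 1) (hc : 0 ≤ c) (q q' : Noise A × (X × ℕ)) :
    T.wt γ c q q' ≤ ENNReal.ofReal (Real.exp c) := by
  unfold wt
  gcongr
  exact mul_le_of_le_one_right hc (powTop_le_one h0 h1 _)

/-- The function `g` is a regular density on the base of the tower over `ω`: its logarithm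
oscillates by at most `c γ ^ s`. The density may vanish identically. -/
def BaseRegular (T : RandomTower p m) (γ c : ℝ) (ω : Noise A) (g : X → ℝ≥0∞) : Prop :=
  Measurable g ∧ ∀ x ∈ T.base, ∀ y ∈ T.base, g x ≤ T.wt γ c (ω, (x, 0)) (ω, (y, 0)) * g y

/-- The return map sends a regular density on one partition element to a regular density on the
base: the oscillation `c` contracts to `c γ`, and the Jacobian contributes `D`. -/
lemma Good.exists_return_density (h : T.Good D γ ω) {E : Set X} (hE : E ∈ T.part ω) {r : ℕ}
    (hr : ∀ x ∈ E, T.R ω x = r) {g : X → ℝ≥0∞} (hg : Measurable g)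
    (hreg : ∀ x ∈ E, ∀ y ∈ E, g x ≤ T.wt γ c (ω, (x, 0)) (ω, (y, 0)) * g y) :
    ∃ k, T.BaseRegular γ (c * γ + D) (shift r ω) k ∧
      ((m.restrict E).withDensity g).map (T.baseReturn ω) = T.baseMeasure.withDensity k := by
  have h0 := h.at_zero
  obtain ⟨J, hJm, hJpos, hJ, hJd⟩ := h0.jacobian E hE
  have hEm := h0.measurable E hE
  have hb := h0.bijOn E hE
  obtain ⟨x₀, hx₀⟩ := h0.nonempty hE
  have : Nonempty X := ⟨x₀⟩
  set G := T.baseReturn ω with hGdef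
  have hGm : Measurable G := measurable_baseReturn ω
  classical
  set ι : X → X := T.base.piecewise (Function.invFunOn G E) (fun _ => x₀) with hι
  have hinv := hb.invOn_invFunOn
  have hmaps := hb.surjOn.mapsTo_invFunOn
  have hιE : ∀ x ∈ T.base, ι x ∈ E := fun x hx => by
    rw [hι, Set.piecewise_eq_of_mem _ _ _ hx]; exact hmaps hx
  have hGι : ∀ x ∈ T.base, G (ι x) = x := fun x hx => by
    rw [hι, Set.piecewise_eq_of_mem _ _ _ hx]; exact hinv.2 hx
  have hιG : ∀ x ∈ E, ι (G x) = x := fun x hx => by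
    rw [hι, Set.piecewise_eq_of_mem _ _ _ (hb.mapsTo hx)]; exact hinv.1 hx
  have hιm : Measurable ι := by
    intro S hS
    have : ι ⁻¹' S = (G '' (E ∩ S)) ∪ (T.baseᶜ ∩ {_x | x₀ ∈ S}) := by
      ext x
      by_cases hx : x ∈ T.base
      · simp only [Set.mem_preimage, Set.mem_union, Set.mem_image, Set.mem_inter_iff,
          Set.mem_compl_iff, hx, not_true_eq_false, false_and, or_false]
        constructor
        · exact fun hs => ⟨ι x, ⟨hιE x hx, hs⟩, hGι x hx⟩
        · rintro ⟨y, ⟨hy, hyS⟩, rfl⟩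
          rwa [hιG y hy]
      · have h1 : ι x = x₀ := by rw [hι, Set.piecewise_eq_of_notMem _ _ _ hx]
        have h2 : x ∉ G '' (E ∩ S) := by
          rintro ⟨y, ⟨hy, -⟩, rfl⟩
          exact hx (hb.mapsTo hy)
        simp [h1, h2, hx]
    rw [this]
    exact ((hJ _ Set.inter_subset_left (hEm.inter hS)).1).union
      (T.measurableSet_base.compl.inter (MeasurableSet.const _))
  set k : X → ℝ≥0∞ := fun x => g (ι x) / ENNReal.ofReal (J (ι x)) with hk
  have hkm : Measurable k := (hg.comp hιm).div (hJm.comp hιm).ennreal_ofReal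
  have hJM : ((m.restrict E).withDensity fun x => ENNReal.ofReal (J x)).map G = T.baseMeasure := by
    ext S hS
    rw [Measure.map_apply hGm hS, withDensity_apply _ (hGm hS),
      Measure.restrict_restrict (hGm hS), ← (hJ _ Set.inter_subset_right ((hGm hS).inter hEm)).2,
      baseMeasure, Measure.restrict_apply hS]
    congr 1
    ext x
    constructor
    · rintro ⟨y, ⟨hyS, hy⟩, rfl⟩
      exact ⟨hyS, hb.mapsTo hy⟩
    · rintro ⟨hxS, hx⟩
      refine ⟨ι x, ⟨?_, hιE x hx⟩, hGι x hx⟩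
      rwa [Set.mem_preimage, hGι x hx]
  refine ⟨k, ⟨hkm, ?_⟩, ?_⟩
  · intro x hx y hy
    have hJd' := hJd _ (hιE y hy) _ (hιE x hx)
    have hrx := hr _ (hιE x hx)
    have hry := hr _ (hιE y hy)
    have hRx := h0.R_pos _ (h0.subset_base hE (hιE x hx))
    have e1 : T.returnMap (ω, (ι x, 0)) = (shift r ω, (x, 0)) := by
      rw [returnMap_base (by omega), hrx, ← hGdef, hGι x hx]
    have e2 : T.returnMap (ω, (ι y, 0)) = (shift r ω, (y, 0)) := by
      rw [returnMap_base (by omega), hry, ← hGdef, hGι y hy]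
    have hs : T.SamePiece (ω, (ι x, 0)) (ω, (ι y, 0)) :=
      h.samePiece_iff.2 ⟨rfl, E, by simpa using hE, hιE x hx, hιE y hy, by
        simpa using Nat.lt_of_succ_le hRx⟩
    have hsep := sep_eq_add_one hs
    rw [e1, e2] at hsep
    rw [e1, e2, sep_comm] at hJd'
    set s := T.sep (shift r ω, (x, 0)) (shift r ω, (y, 0)) with hsdef
    have hJx := hJpos _ (hιE x hx)
    have hJy := hJpos _ (hιE y hy)
    have hJJ : J (ι y) ≤ Real.exp (D * powTop γ s) * J (ι x) := by
      rw [← div_le_iff₀ hJx]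
      have := (abs_le.1 hJd').2
      linarith [Real.add_one_le_exp (D * powTop γ s)]
    have hJJ' : ENNReal.ofReal (J (ι y)) ≤
        ENNReal.ofReal (Real.exp (D * powTop γ s)) * ENNReal.ofReal (J (ι x)) := by
      rw [← ENNReal.ofReal_mul (Real.exp_pos _).le]
      exact ENNReal.ofReal_le_ofReal hJJ
    have hinvJ : (ENNReal.ofReal (J (ι x)))⁻¹ ≤
        ENNReal.ofReal (Real.exp (D * powTop γ s)) * (ENNReal.ofReal (J (ι y)))⁻¹ := by
      rw [← div_eq_mul_inv, ENNReal.le_div_iff_mul_le (by left; simpa using hJy) (by left; simp),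
        mul_comm, ← div_eq_mul_inv]
      exact ENNReal.div_le_of_le_mul hJJ'
    have hgx := hreg _ (hιE x hx) _ (hιE y hy)
    unfold wt at hgx ⊢
    rw [hsep, powTop_add_one] at hgx
    rw [← hsdef]
    simp only [hk, div_eq_mul_inv]
    calc g (ι x) * (ENNReal.ofReal (J (ι x)))⁻¹
        ≤ (ENNReal.ofReal (Real.exp (c * (γ * powTop γ s))) * g (ι y)) *
          (ENNReal.ofReal (Real.exp (D * powTop γ s)) * (ENNReal.ofReal (J (ι y)))⁻¹) := by
          gcongr
      _ = _ := by
          rw [show (c * γ + D) * powTop γ s = c * (γ * powTop γ s) + D * powTop γ s by ring,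
            Real.exp_add, ENNReal.ofReal_mul (Real.exp_pos _).le]
          ring
  · ext S hS
    rw [Measure.map_apply hGm hS, withDensity_apply _ (hGm hS), withDensity_apply _ hS, ← hJM,
      setLIntegral_map hS hkm hGm, setLIntegral_withDensity_eq_setLIntegral_mul _
        hJm.ennreal_ofReal (g := fun x => k (G x)) (hkm.comp hGm) (hGm hS),
      Measure.restrict_restrict (hGm hS)]
    refine setLIntegral_congr_fun ((hGm hS).inter hEm) fun x hx => ?_
    simp only [Pi.mul_apply, hk, hιG x hx.2]
    exact (ENNReal.mul_div_cancel (by simpa using hJpos x hx.2) (by simp)).symm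

lemma BaseRegular.tsum {ι : Type*} [Countable ι] {k : ι → X → ℝ≥0∞}
    (hk : ∀ i, T.BaseRegular γ c ω (k i)) : T.BaseRegular γ c ω (∑' i, k i) := by
  refine ⟨Measurable.tsum' fun i => (hk i).1, fun x hx y hy => ?_⟩
  rw [ENNReal.tsum_apply, ENNReal.tsum_apply, ← ENNReal.tsum_mul_left]
  exact ENNReal.tsum_le_tsum fun i => (hk i).2 x hx y hy

/-- The points of the base that return at time `r`, carrying a density that is regular on each
partition element, are sent to a regular density on the base. -/
lemma Good.exists_return_density_level (h : T.Good D γ ω) (r : ℕ) {g : X → ℝ≥0∞}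
    (hg : Measurable g) (hreg : ∀ E ∈ T.part ω, (∀ x ∈ E, T.R ω x = r) → ∀ x ∈ E, ∀ y ∈ E,
      g x ≤ T.wt γ c (ω, (x, 0)) (ω, (y, 0)) * g y) :
    ∃ k, T.BaseRegular γ (c * γ + D) (shift r ω) k ∧
      ((m.restrict {x | x ∈ T.base ∧ T.R ω x = r}).withDensity g).map (T.baseReturn ω) =
        T.baseMeasure.withDensity k := by
  have h0 := h.at_zero
  set ι := {E : Set X // E ∈ T.part ω ∧ ∀ x ∈ E, T.R ω x = r}
  have : Countable ι := (h0.countable.mono (s₁ := {E | E ∈ T.part ω ∧ ∀ x ∈ E, T.R ω x = r})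
    fun E hE => hE.1).to_subtype
  choose k hk hkE using fun i : ι => h.exists_return_density i.2.1 i.2.2 hg (hreg _ i.2.1 i.2.2)
  refine ⟨∑' i, k i, .tsum hk, ?_⟩
  have hU : {x | x ∈ T.base ∧ T.R ω x = r} = ⋃ i : ι, (i : Set X) := by
    ext x
    simp only [Set.mem_ofPred_eq, Set.mem_iUnion]
    constructor
    · rintro ⟨hx, hr⟩
      obtain ⟨E, hE, hxE⟩ := h0.exists_mem hx
      exact ⟨⟨E, hE, fun y hy => by rw [← hr]; exact h0.R_const E hE y hy x hxE⟩, hxE⟩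
    · rintro ⟨i, hi⟩
      exact ⟨h0.subset_base i.2.1 hi, i.2.2 x hi⟩
  have hdisj : Pairwise (Function.onFun Disjoint fun i : ι => (i : Set X)) := fun i j hij =>
    h0.disjoint i.2.1 j.2.1 fun hc => hij (Subtype.ext hc)
  rw [hU, Measure.restrict_iUnion hdisj fun i => h0.measurable _ i.2.1, withDensity_sum,
    Measure.map_sum (measurable_baseReturn ω).aemeasurable, withDensity_tsum fun i => (hk i).1]
  congr 1
  funext i
  exact hkE i

/-! ### The reference measure, level by level -/

/-- The points of the base over which the tower over `ω` reaches level `ℓ`. -/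
def level (T : RandomTower p m) (ω : Noise A) (ℓ : ℕ) : Set X :=
  {x | x ∈ T.base ∧ ℓ < T.R (shift (-(ℓ : ℤ)) ω) x}

lemma measurableSet_level (ω : Noise A) (ℓ : ℕ) : MeasurableSet (T.level ω ℓ) :=
  (measurableSet_fiber (T := T) ω).preimage (measurable_prodMk_right (y := ℓ))

lemma level_succ (ω : Noise A) (ℓ : ℕ) : T.level (shift 1 ω) (ℓ + 1) =
    {x | x ∈ T.base ∧ ℓ + 1 < T.R (shift (-(ℓ : ℤ)) ω) x} := by
  simp [level]

lemma Good.level_zero (h : T.Good D γ ω) : T.level ω 0 = T.base := by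
  ext x
  simp only [level, Set.mem_ofPred_eq, and_iff_left_iff_imp]
  intro hx
  simpa using Nat.lt_of_succ_le (h.at_zero.R_pos x hx)

lemma lintegral_refMeasure {f : X × ℕ → ℝ≥0∞} (hf : Measurable f) (ω : Noise A) :
    ∫⁻ z, f z ∂(T.refMeasure ω) = ∑' ℓ, ∫⁻ x in T.level ω ℓ, f (x, ℓ) ∂m := by
  have : IsFiniteMeasure (m.restrict T.base) := inferInstanceAs (IsFiniteMeasure T.baseMeasure)
  rw [refMeasure, ← lintegral_indicator (measurableSet_fiber ω), lintegral_prod_symm _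
    (hf.indicator (measurableSet_fiber ω)).aemeasurable, lintegral_count]
  congr 1
  funext ℓ
  have : ∀ x, (T.fiber ω).indicator f (x, ℓ) =
      (T.level ω ℓ).indicator (fun x => f (x, ℓ)) x := fun x => rfl
  simp_rw [this]
  rw [lintegral_indicator (measurableSet_level ω ℓ),
    Measure.restrict_restrict (measurableSet_level ω ℓ),
    Set.inter_eq_left.2 (fun x hx => hx.1)]

lemma refMeasure_compl_fiber (ω : Noise A) : T.refMeasure ω (T.fiber ω)ᶜ = 0 := by
  rw [refMeasure, Measure.restrict_apply (measurableSet_fiber ω).compl]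
  simp

/-! ### Regular measures on the tower -/

/-- The measure `ν` on the tower over `ω` is a probability measure with a density that is bounded
by `e ^ c` and whose logarithm oscillates by at most `c γ ^ s` on partition elements and on the
whole of the base. -/
def Regular (T : RandomTower p m) (γ c : ℝ) (ω : Noise A) (ν : Measure (X × ℕ)) : Prop :=
  ν Set.univ = 1 ∧ ∃ g : X × ℕ → ℝ≥0∞, Measurable g ∧ ν = (T.refMeasure ω).withDensity g ∧
    (∀ z ∈ T.fiber ω, g z ≤ ENNReal.ofReal (Real.exp c)) ∧
    (∀ z w, T.SamePiece (ω, z) (ω, w) → g z ≤ T.wt γ c (ω, z) (ω, w) * g w) ∧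
    T.BaseRegular γ c ω fun x => g (x, 0)

/-- The tower map preserves regular measures, provided that `c γ + D = c`. -/
lemma Good.regular_map (h : T.Good D γ ω) (h0 : 0 ≤ γ) (h1 : γ ≤ 1) (hc : 0 ≤ c)
    (hcD : c * γ + D = c) {ν : Measure (X × ℕ)} (hν : T.Regular γ c ω ν) :
    T.Regular γ c (shift 1 ω) (ν.map (T.towerMap ω)) := by
  obtain ⟨hν1, g, hg, rfl, hgb, hgp, -⟩ := hν
  have hgl : ∀ ℓ, Measurable fun x => g (x, ℓ) := fun ℓ => hg.comp measurable_prodMk_right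
  have hret : ∀ ℓ : ℕ, ∃ k, T.BaseRegular γ c (shift 1 ω) k ∧
      ((m.restrict {x | x ∈ T.base ∧ T.R (shift (-(ℓ : ℤ)) ω) x = ℓ + 1}).withDensity
        fun x => g (x, ℓ)).map (T.baseReturn (shift (-(ℓ : ℤ)) ω)) =
        T.baseMeasure.withDensity k := by
    intro ℓ
    have := (h.along (-(ℓ : ℤ))).exists_return_density_level (c := c) (ℓ + 1) (hgl ℓ) ?_
    · simpa [hcD] using this
    · intro E hE hr x hx y hy
      have hR : ℓ < T.R (shift (-(ℓ : ℤ)) ω) x := by rw [hr x hx]; omega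
      have := hgp (x, ℓ) (y, ℓ) (h.samePiece_iff.2 ⟨rfl, E, hE, hx, hy, hR⟩)
      unfold wt at this ⊢
      rwa [h.sep_level hE hx hy hR] at this
  choose k hk hkm using hret
  have hksum := BaseRegular.tsum hk
  set K : X → ℝ≥0∞ := ∑' ℓ, k ℓ with hK
  set g' : X × ℕ → ℝ≥0∞ := fun z => if z.2 = 0 then K z.1 else g (z.1, z.2 - 1) with hg'
  have hg'm : Measurable g' := by
    refine Measurable.ite (measurableSet_eq_fun measurable_snd measurable_const)
      (hksum.1.comp measurable_fst) (hg.comp (measurable_fst.prodMk ?_))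
    exact (measurable_of_countable fun n : ℕ => n - 1).comp measurable_snd
  have hmap : ((T.refMeasure ω).withDensity g).map (T.towerMap ω) =
      (T.refMeasure (shift 1 ω)).withDensity g' := by
    ext S hS
    have hF := measurable_towerMap (T := T) ω
    rw [Measure.map_apply hF hS, withDensity_apply _ (hF hS), withDensity_apply _ hS,
      ← lintegral_indicator (hF hS), ← lintegral_indicator hS,
      lintegral_refMeasure (hg.indicator (hF hS)), lintegral_refMeasure (hg'm.indicator hS),
      tsum_eq_zero_add' (f := fun ℓ => ∫⁻ x in T.level (shift 1 ω) ℓ, S.indicator g' (x, ℓ) ∂m)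
        ENNReal.summable, (h.along 1).level_zero]
    -- the base receives the returning points of all levels
    have hbase : ∫⁻ x in T.base, S.indicator g' (x, 0) ∂m =
        ∑' ℓ : ℕ, ∫⁻ x in {x | x ∈ T.base ∧ T.R (shift (-(ℓ : ℤ)) ω) x = ℓ + 1},
          (T.towerMap ω ⁻¹' S).indicator g (x, ℓ) ∂m := by
      have hS0 : MeasurableSet {x : X | (x, 0) ∈ S} := hS.preimage measurable_prodMk_right
      have e1 : ∀ x, S.indicator g' (x, 0) = {x : X | (x, 0) ∈ S}.indicator K x := by
        intro x
        by_cases hx : (x, 0) ∈ S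
        · rw [Set.indicator_of_mem hx, Set.indicator_of_mem (by exact hx)]; simp [hg']
        · rw [Set.indicator_of_notMem hx, Set.indicator_of_notMem (by exact hx)]
      simp_rw [e1]
      change ∫⁻ x, _ ∂T.baseMeasure = _
      rw [lintegral_indicator hS0, ← withDensity_apply _ hS0, hK,
        withDensity_tsum fun i => (hk i).1, Measure.sum_apply _ hS0]
      congr 1
      funext ℓ
      have hG := measurable_baseReturn (T := T) (shift (-(ℓ : ℤ)) ω)
      rw [← hkm ℓ, Measure.map_apply hG hS0, withDensity_apply _ (hG hS0),
        ← lintegral_indicator (hG hS0)]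
      refine setLIntegral_congr_fun ?_ fun x hx => ?_
      · exact T.measurableSet_base.inter (measurableSet_eq_fun
          (measurable_R_comp measurable_const measurable_id) measurable_const)
      · by_cases hx' : (T.baseReturn (shift (-(ℓ : ℤ)) ω) x, 0) ∈ S
        · rw [Set.indicator_of_mem (by exact hx'), Set.indicator_of_mem]
          rw [Set.mem_preimage, towerMap_return hx.2]; exact hx'
        · rw [Set.indicator_of_notMem (by exact hx'), Set.indicator_of_notMem]
          rw [Set.mem_preimage, towerMap_return hx.2]; exact hx'
    rw [hbase, ← ENNReal.tsum_add]
    congr 1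
    funext ℓ
    have hsplit : T.level ω ℓ =
        {x | x ∈ T.base ∧ T.R (shift (-(ℓ : ℤ)) ω) x = ℓ + 1} ∪ T.level (shift 1 ω) (ℓ + 1) := by
      rw [level_succ]
      ext x
      simp only [level, Set.mem_ofPred_eq, Set.mem_union, ← and_or_left]
      exact and_congr_right fun _ => by omega
    have hd : Disjoint {x | x ∈ T.base ∧ T.R (shift (-(ℓ : ℤ)) ω) x = ℓ + 1}
        (T.level (shift 1 ω) (ℓ + 1)) := by
      rw [level_succ, Set.disjoint_left]
      rintro x ⟨-, hx⟩ ⟨-, hx'⟩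
      omega
    rw [hsplit, lintegral_union (measurableSet_level _ _) hd]
    congr 1
    refine setLIntegral_congr_fun (measurableSet_level _ _) fun x hx => ?_
    rw [level_succ] at hx
    by_cases hx' : (x, ℓ + 1) ∈ S
    · rw [Set.indicator_of_mem, Set.indicator_of_mem hx']
      · simp [hg']
      · rw [Set.mem_preimage, towerMap_up hx.2]; exact hx'
    · rw [Set.indicator_of_notMem, Set.indicator_of_notMem hx']
      rw [Set.mem_preimage, towerMap_up hx.2]; exact hx'
  have htot : ((T.refMeasure ω).withDensity g).map (T.towerMap ω) Set.univ = 1 := by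
    rw [Measure.map_apply (measurable_towerMap ω) MeasurableSet.univ, Set.preimage_univ, hν1]
  have hKreg : T.BaseRegular γ c (shift 1 ω) fun x => g' (x, 0) := by simpa [hg'] using hksum
  refine ⟨htot, g', hg'm, hmap, ?_, ?_, hKreg⟩
  · -- on the base, compare with the mean value
    rintro ⟨x, ℓ⟩ hz
    cases ℓ with
    | zero =>
      have hint : ∫⁻ y, g' (y, 0) ∂T.baseMeasure ≤ 1 := by
        rw [hmap, withDensity_apply _ MeasurableSet.univ, setLIntegral_univ,
          lintegral_refMeasure hg'm] at htot
        rw [← htot, baseMeasure, ← (h.along 1).level_zero]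
        exact ENNReal.le_tsum 0
      calc g' (x, 0) = ∫⁻ y, g' (x, 0) ∂T.baseMeasure := by simp
        _ ≤ ∫⁻ y, ENNReal.ofReal (Real.exp c) * g' (y, 0) ∂T.baseMeasure := by
          refine lintegral_mono_ae ?_
          filter_upwards [ae_restrict_mem T.measurableSet_base] with y hy
          exact (hKreg.2 x hz.1 y hy).trans (by gcongr; exact wt_le h0 h1 hc _ _)
        _ ≤ ENNReal.ofReal (Real.exp c) := by
          rw [lintegral_const_mul _ hKreg.1]
          exact mul_le_of_le_one_right zero_le hint
    | succ ℓ =>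
      have hz' : x ∈ T.level (shift 1 ω) (ℓ + 1) := hz
      rw [level_succ] at hz'
      simpa [hg'] using hgb (x, ℓ) ⟨hz'.1, by simpa using (Nat.lt_succ_self ℓ).trans hz'.2⟩
  · rintro ⟨x, ℓ⟩ ⟨y, ℓ'⟩ hs
    obtain ⟨hl, E, hE, hx, hy, hR⟩ := (h.along 1).samePiece_iff.1 hs
    simp only at hl hx hy hE hR
    subst hl
    cases ℓ with
    | zero =>
      exact hKreg.2 x (((h.along 1) _).subset_base hE hx) y (((h.along 1) _).subset_base hE hy)
    | succ ℓ =>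
      have hsh : shift (-((ℓ + 1 : ℕ) : ℤ)) (shift 1 ω) = shift (-(ℓ : ℤ)) ω := by simp
      have e2 := (h.along 1).sep_level hE hx hy hR
      rw [hsh] at hE hR e2
      have hR' : ℓ < T.R (shift (-(ℓ : ℤ)) ω) x := by omega
      have e1 := h.sep_level hE hx hy hR'
      have := hgp (x, ℓ) (y, ℓ) (h.samePiece_iff.2 ⟨rfl, E, hE, hx, hy, hR'⟩)
      simp only [hg', wt] at this ⊢
      rw [e2, ← e1]
      simpa using this

/-- The measure `m` on the base level of the tower. -/
def baseLevelMeasure (T : RandomTower p m) : Measure (X × ℕ) := T.baseMeasure.map fun x => (x, 0)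

instance : IsProbabilityMeasure T.baseLevelMeasure :=
  Measure.isProbabilityMeasure_map measurable_prodMk_right.aemeasurable

lemma baseLevelMeasure_apply {S : Set (X × ℕ)} (hS : MeasurableSet S) :
    T.baseLevelMeasure S = T.baseMeasure {x | (x, 0) ∈ S} := by
  rw [baseLevelMeasure, Measure.map_apply measurable_prodMk_right hS]; rfl

lemma one_le_wt (h0 : 0 ≤ γ) (hc : 0 ≤ c) (q q' : Noise A × (X × ℕ)) : 1 ≤ T.wt γ c q q' := by
  rw [wt, ENNReal.one_le_ofReal]
  exact Real.one_le_exp (mul_nonneg hc (powTop_nonneg h0 _))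

lemma Good.regular_baseLevelMeasure (h : T.Good D γ ω) (h0 : 0 ≤ γ) (hc : 0 ≤ c) :
    T.Regular γ c ω T.baseLevelMeasure := by
  have hm : Measurable fun z : X × ℕ => if z.2 = 0 then (1 : ℝ≥0∞) else 0 :=
    Measurable.ite (measurableSet_eq_fun measurable_snd measurable_const) measurable_const
      measurable_const
  refine ⟨measure_univ, fun z => if z.2 = 0 then 1 else 0, hm, ?_, ?_, ?_,
    by simp [measurable_const], ?_⟩
  · ext S hS
    rw [withDensity_apply _ hS, ← lintegral_indicator hS,
      lintegral_refMeasure (hm.indicator hS), tsum_eq_single 0, h.level_zero,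
      baseLevelMeasure_apply hS, ← lintegral_indicator_one (s := {x : X | (x, 0) ∈ S})
        (hS.preimage measurable_prodMk_right)]
    · change _ = ∫⁻ x, _ ∂T.baseMeasure
      congr 1
    · intro ℓ hℓ
      simp [Set.indicator, hℓ]
  · intro z _
    dsimp only
    split_ifs
    · rw [ENNReal.one_le_ofReal]; exact Real.one_le_exp hc
    · exact zero_le
  · intro z w hs
    dsimp only
    rw [(h.samePiece_iff.1 hs).1]
    split_ifs
    · simpa using one_le_wt h0 hc _ _
    · simp
  · intro x _ y _
    simpa using one_le_wt h0 hc _ _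

lemma Good.regular_iter (h : T.Good D γ ω) (h0 : 0 ≤ γ) (h1 : γ ≤ 1) (hc : 0 ≤ c)
    (hcD : c * γ + D = c) (n : ℕ) :
    T.Regular γ c (shift n ω) (T.baseLevelMeasure.map (T.towerIter ω n)) := by
  induction n with
  | zero =>
    have : T.towerIter ω 0 = id := rfl
    simpa [this] using h.regular_baseLevelMeasure h0 hc
  | succ n ih =>
    have := (h.along n).regular_map h0 h1 hc hcD ih
    rw [Measure.map_map (measurable_towerMap _) (measurable_towerIter _ _), shift_shift] at this
    push_cast
    rwa [add_comm (n : ℤ)]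

/-- A regular density dominates `e ^ (-c)` times its integral. -/
lemma BaseRegular.smul_le_withDensity (h0 : 0 ≤ γ) (h1 : γ ≤ 1) (hc : 0 ≤ c) {g : X → ℝ≥0∞}
    (hg : T.BaseRegular γ c ω g) :
    (ENNReal.ofReal (Real.exp (-c)) * ∫⁻ y, g y ∂T.baseMeasure) • T.baseMeasure ≤
      T.baseMeasure.withDensity g := by
  refine Measure.le_iff.2 fun S hS => ?_
  rw [Measure.smul_apply, withDensity_apply _ hS, smul_eq_mul, ← setLIntegral_const]
  refine lintegral_mono_ae (ae_restrict_of_ae ?_)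
  filter_upwards [ae_restrict_mem T.measurableSet_base] with x hx
  rw [← lintegral_const_mul _ hg.1]
  calc ∫⁻ y, ENNReal.ofReal (Real.exp (-c)) * g y ∂T.baseMeasure
      ≤ ∫⁻ y, g x ∂T.baseMeasure := by
        refine lintegral_mono_ae ?_
        filter_upwards [ae_restrict_mem T.measurableSet_base] with y hy
        calc ENNReal.ofReal (Real.exp (-c)) * g y
            ≤ ENNReal.ofReal (Real.exp (-c)) * (ENNReal.ofReal (Real.exp c) * g x) := by
              gcongr
              exact (hg.2 y hy x hx).trans (by gcongr; exact wt_le h0 h1 hc _ _)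
          _ = g x := by
              rw [← mul_assoc, ← ENNReal.ofReal_mul (Real.exp_pos _).le, ← Real.exp_add]
              simp
    _ = g x := by simp

lemma map_towerIter_add (ω : Noise A) (k l : ℕ) (ν : Measure (X × ℕ)) :
    ν.map (T.towerIter ω (k + l)) =
      (ν.map (T.towerIter ω k)).map (T.towerIter (shift k ω) l) := by
  rw [Measure.map_map (measurable_towerIter _ _) (measurable_towerIter _ _)]
  congr 1
  funext z
  exact towerIter_add ω k l z

lemma measurableSet_snd_eq (ℓ : ℕ) : MeasurableSet {z : X × ℕ | z.2 = ℓ} :=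
  measurableSet_eq_fun measurable_snd measurable_const

lemma Regular.apply_le {ν : Measure (X × ℕ)} (hν : T.Regular γ c ω ν)
    {S : Set (X × ℕ)} (hS : MeasurableSet S) :
    ν S ≤ ENNReal.ofReal (Real.exp c) * T.refMeasure ω S := by
  obtain ⟨-, g, hg, rfl, hb, -⟩ := hν
  rw [withDensity_apply _ hS, ← setLIntegral_const]
  refine lintegral_mono_ae (ae_restrict_of_ae ?_)
  filter_upwards [compl_mem_ae_iff.2 (refMeasure_compl_fiber (T := T) ω)] with z hz
  exact hb z (by simpa using hz)

lemma measurable_refMeasure_apply {S : Set (Noise A × (X × ℕ))} (hS : MeasurableSet S) :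
    Measurable fun ω => T.refMeasure ω (Prod.mk ω ⁻¹' S) := by
  have : IsFiniteMeasure (m.restrict T.base) := inferInstanceAs (IsFiniteMeasure T.baseMeasure)
  have e : ∀ ω, T.refMeasure ω (Prod.mk ω ⁻¹' S) = ((m.restrict T.base).prod Measure.count)
      (Prod.mk ω ⁻¹' (S ∩ {q : Noise A × (X × ℕ) | q.2 ∈ T.fiber q.1})) := fun ω => by
    rw [refMeasure, Measure.restrict_apply (hS.preimage measurable_prodMk_left)]
    rfl
  simp_rw [e]
  exact measurable_measure_prodMk_left (hS.inter measurableSet_fiberTotal)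

lemma withDensity_baseMeasure_le (h : T.Good D γ ω) {g : X × ℕ → ℝ≥0∞} (hg : Measurable g)
    {S : Set (X × ℕ)} (hS : MeasurableSet S) :
    T.baseMeasure.withDensity (fun x => g (x, 0)) {x | (x, 0) ∈ S} ≤
      (T.refMeasure ω).withDensity g S := by
  have hS0 : MeasurableSet {x : X | (x, 0) ∈ S} := hS.preimage measurable_prodMk_right
  rw [withDensity_apply _ hS, withDensity_apply _ hS0, ← lintegral_indicator hS,
    lintegral_refMeasure (hg.indicator hS), ← lintegral_indicator hS0]
  refine le_trans ?_ (ENNReal.le_tsum 0)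
  rw [h.level_zero]
  exact le_rfl

/-- A regular measure dominates `e ^ (-c)` times its mass on the base. -/
lemma Regular.smul_baseLevelMeasure_le (h0 : 0 ≤ γ) (h1 : γ ≤ 1) (hc : 0 ≤ c)
    (h : T.Good D γ ω) {ν : Measure (X × ℕ)} (hν : T.Regular γ c ω ν) :
    (ENNReal.ofReal (Real.exp (-c)) * ν {z | z.2 = 0}) • T.baseLevelMeasure ≤ ν := by
  obtain ⟨-, g, hg, rfl, -, -, hgr⟩ := hν
  have hz : MeasurableSet {z : X × ℕ | z.2 = 0} :=
    measurableSet_eq_fun measurable_snd measurable_const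
  have hmass : (T.refMeasure ω).withDensity g {z | z.2 = 0} = ∫⁻ y, g (y, 0) ∂T.baseMeasure := by
    rw [withDensity_apply _ hz, ← lintegral_indicator hz, lintegral_refMeasure (hg.indicator hz),
      tsum_eq_single 0, h.level_zero, baseMeasure]
    · simp [Set.indicator]
    · intro ℓ hℓ; simp [Set.indicator, hℓ]
  refine Measure.le_iff.2 fun S hS => ?_
  rw [Measure.smul_apply, baseLevelMeasure_apply hS, hmass]
  exact (Measure.le_iff'.1 (hgr.smul_le_withDensity h0 h1 hc) _).trans
    (withDensity_baseMeasure_le h hg hS)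

/-! ### Recurrence to noises with little mass high up in the tower -/

/-- The noises over which the part of the tower from level `L` on has mass at most `e ^ (-c) / 2`,
so that it carries at most half of every regular probability measure. -/
def LowTop (T : RandomTower p m) (c : ℝ) (L : ℕ) : Set (Noise A) :=
  {ω | T.refMeasure ω {z | L ≤ z.2} ≤ ENNReal.ofReal (Real.exp (-c)) * 2⁻¹}

/-- Almost every orbit returns infinitely often to noises with little mass high up in the tower. -/
lemma ae_frequently_lowTop (hFin : T.FiniteMass) (c : ℝ) :
    ∀ᵐ ω ∂(noiseMeasure p), ∃ L, ∃ᶠ n : ℕ in atTop, shift n ω ∈ T.LowTop c L := by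
  obtain ⟨M, -, hM⟩ := hFin
  have hmeas : ∀ L, MeasurableSet (T.LowTop c L) := fun L => by
    have hS : MeasurableSet {q : Noise A × (X × ℕ) | L ≤ q.2.2} :=
      measurableSet_le measurable_const (measurable_snd.comp measurable_snd)
    exact measurableSet_le (measurable_refMeasure_apply hS) measurable_const
  have hrec : ∀ᵐ ω ∂(noiseMeasure p), ∀ L, ω ∈ T.LowTop c L →
      ∃ᶠ n : ℕ in atTop, shift n ω ∈ T.LowTop c L := by
    refine ae_all_iff.2 fun L => ?_
    filter_upwards [(measurePreserving_shift p 1).conservative.ae_mem_imp_frequently_image_mem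
      (hmeas L).nullMeasurableSet] with ω hω h
    simpa only [shift_iterate] using hω h
  filter_upwards [hM, hrec] with ω hω hr
  have hlim : Tendsto (fun L : ℕ => T.refMeasure ω {z | L ≤ z.2}) atTop (𝓝 0) := by
    have := tendsto_measure_iInter_atTop (μ := T.refMeasure ω) (s := fun L : ℕ => {z | L ≤ z.2})
      (fun L => (measurableSet_le measurable_const measurable_snd).nullMeasurableSet)
      (fun L L' hLL z hz => hLL.trans hz)
      ⟨0, ne_top_of_le_ne_top (by simp) ((measure_mono (Set.subset_univ _)).trans hω)⟩
    have hempty : (⋂ L : ℕ, {z : X × ℕ | L ≤ z.2}) = ∅ := by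
      ext z
      simp only [Set.mem_iInter, Set.mem_empty_iff_false, iff_false, not_forall]
      exact ⟨z.2 + 1, by simp⟩
    rwa [hempty, measure_empty] at this
  have hpos : 0 < ENNReal.ofReal (Real.exp (-c)) * 2⁻¹ :=
    ENNReal.mul_pos (ENNReal.ofReal_pos.2 (Real.exp_pos (-c))).ne' (by simp)
  obtain ⟨L, hL⟩ := (hlim.eventually (ge_mem_nhds hpos)).exists
  exact ⟨L, hr L hL⟩

end RandomTower
end RandomTowers

namespace RandomTowers
namespace RandomTower

variable {A X : Type*} [MeasurableSpace A] [MeasurableSpace X]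
  {p : Measure A} [IsProbabilityMeasure p] {m : Measure X} {T : RandomTower p m}
  {D γ c : ℝ} {ω : Noise A}

/-! ### Cylinders -/

/-- The `k`-cylinders of the base over `ω`: the sets of points whose returns number `0, …, k` lie in
prescribed partition elements. -/
def cyl (T : RandomTower p m) : ℕ → Noise A → Set (Set X)
  | 0, ω => T.part ω
  | k + 1, ω => {Z | ∃ E ∈ T.part ω, ∃ x ∈ E, ∃ W ∈ cyl T k (shift (T.R ω x) ω),
      Z = E ∩ T.baseReturn ω ⁻¹' W}

lemma Good.countable_cyl (k : ℕ) : ∀ {ω : Noise A}, T.Good D γ ω → (T.cyl k ω).Countable := by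
  induction k with
  | zero => exact fun h => h.at_zero.countable
  | succ k ih =>
    intro ω h
    refine ((h.at_zero.countable.biUnion fun E _ => Set.countable_iUnion fun r : ℕ =>
      (ih (h.along r)).image fun W => E ∩ T.baseReturn ω ⁻¹' W)).mono ?_
    rintro Z ⟨E, hE, x, hx, W, hW, rfl⟩
    exact Set.mem_biUnion hE (Set.mem_iUnion.2 ⟨T.R ω x, W, hW, rfl⟩)

lemma Good.measurableSet_cyl {k : ℕ} : ∀ {ω : Noise A}, T.Good D γ ω → ∀ Z ∈ T.cyl k ω,
    MeasurableSet Z := by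
  induction k with
  | zero => exact fun h => h.at_zero.measurable
  | succ k ih =>
    rintro ω h Z ⟨E, hE, x, hx, W, hW, rfl⟩
    exact (h.at_zero.measurable E hE).inter (measurable_baseReturn ω (ih (h.along _) W hW))

lemma Good.cyl_subset_base {k : ℕ} (h : T.Good D γ ω) {Z : Set X} (hZ : Z ∈ T.cyl k ω) :
    Z ⊆ T.base := by
  cases k with
  | zero => exact h.at_zero.subset_base hZ
  | succ k =>
    obtain ⟨E, hE, x, hx, W, hW, rfl⟩ := hZ
    exact Set.inter_subset_left.trans (h.at_zero.subset_base hE)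

lemma Good.exists_cyl (k : ℕ) : ∀ {ω : Noise A}, T.Good D γ ω → ∀ x ∈ T.base,
    ∃ Z ∈ T.cyl k ω, x ∈ Z := by
  induction k with
  | zero => exact fun h x hx => h.at_zero.exists_mem hx
  | succ k ih =>
    intro ω h x hx
    obtain ⟨E, hE, hxE⟩ := h.at_zero.exists_mem hx
    obtain ⟨W, hW, hxW⟩ := ih (h.along (T.R ω x)) _ ((h.at_zero.bijOn E hE).mapsTo hxE)
    exact ⟨_, ⟨E, hE, x, hxE, W, hW, rfl⟩, hxE, hxW⟩

lemma Good.samePiece_base_iff (h : T.Good D γ ω) {E : Set X} (hE : E ∈ T.part ω) {x y : X}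
    (hx : x ∈ E) : T.SamePiece (ω, (x, 0)) (ω, (y, 0)) ↔ y ∈ E := by
  rw [h.samePiece_iff]
  constructor
  · rintro ⟨-, E', hE', hx', hy, -⟩
    have : E' = E := h.at_zero.eq_of_mem (by simpa using hE') hE hx' hx
    exact this ▸ hy
  · intro hy
    exact ⟨rfl, E, by simpa using hE, hx, hy, by
      simpa using Nat.lt_of_succ_le (h.at_zero.R_pos x (h.at_zero.subset_base hE hx))⟩

/-- A `k`-cylinder is a ball for the separation time. -/
lemma Good.mem_cyl_iff {k : ℕ} : ∀ {ω : Noise A}, T.Good D γ ω → ∀ {Z : Set X}, Z ∈ T.cyl k ω →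
    ∀ {x y : X}, x ∈ Z → (y ∈ Z ↔ ((k + 1 : ℕ) : ℕ∞) ≤ T.sep (ω, (x, 0)) (ω, (y, 0))) := by
  induction k with
  | zero =>
    intro ω h Z hZ x y hx
    rw [← h.samePiece_base_iff hZ hx, ← one_le_sep_iff]; simp
  | succ k ih =>
    rintro ω h Z ⟨E, hE, x₀, hx₀, W, hW, rfl⟩ x y ⟨hx, hxW⟩
    rw [h.at_zero.R_const E hE x₀ hx₀ x hx] at hW
    by_cases hs : T.SamePiece (ω, (x, 0)) (ω, (y, 0))
    · have hy := (h.samePiece_base_iff hE hx).1 hs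
      have hRy := h.at_zero.R_const E hE x hx y hy
      have hR := h.at_zero.R_pos x (h.at_zero.subset_base hE hx)
      rw [sep_eq_add_one hs, returnMap_base (by omega), returnMap_base (by omega), ← hRy]
      push_cast
      rw [ENat.add_le_add_iff_right (by simp)]
      have := ih (h.along (T.R ω x)) hW (x := T.baseReturn ω x) (y := T.baseReturn ω y) hxW
      push_cast at this
      rw [← this]
      simp [hy]
    · rw [sep_eq_zero hs]
      rw [h.samePiece_base_iff hE hx] at hs
      simp [hs]

lemma Good.cyl_eq_of_mem (h : T.Good D γ ω) {k : ℕ} {Z Z' : Set X} (hZ : Z ∈ T.cyl k ω)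
    (hZ' : Z' ∈ T.cyl k ω) {x : X} (hx : x ∈ Z) (hx' : x ∈ Z') : Z = Z' := by
  ext y
  rw [h.mem_cyl_iff hZ hx, h.mem_cyl_iff hZ' hx']

lemma Good.cyl_subset_of_le (h : T.Good D γ ω) {k l : ℕ} (hkl : k ≤ l) {Z Z' : Set X}
    (hZ : Z ∈ T.cyl k ω) (hZ' : Z' ∈ T.cyl l ω) {x : X} (hx : x ∈ Z) (hx' : x ∈ Z') : Z' ⊆ Z := by
  intro y hy
  rw [h.mem_cyl_iff hZ' hx'] at hy
  rw [h.mem_cyl_iff hZ hx]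
  exact le_trans (by exact_mod_cast Nat.succ_le_succ hkl) hy

/-- A cylinder is eventually mapped onto the whole base, and regular densities on it are sent to
regular densities. -/
lemma Good.exists_cyl_density (hcD : c * γ + D = c) {k : ℕ} : ∀ {ω : Noise A}, T.Good D γ ω →
    ∀ {Z : Set X}, Z ∈ T.cyl k ω → ∀ {g : X → ℝ≥0∞}, T.BaseRegular γ c ω g →
    ∃ (n : ℕ) (Ψ : X → X), Measurable Ψ ∧ (∀ x ∈ Z, T.towerIter ω n (x, 0) = (Ψ x, 0)) ∧
      Set.SurjOn Ψ Z T.base ∧ (∀ x ∈ Z, T.R ω x ≤ n) ∧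
      ∃ g', T.BaseRegular γ c (shift n ω) g' ∧
        ((m.restrict Z).withDensity g).map Ψ = T.baseMeasure.withDensity g' := by
  induction k with
  | zero =>
    intro ω h Z hZ g hg
    obtain ⟨x₀, hx₀⟩ := h.at_zero.nonempty hZ
    have hb := h.at_zero.subset_base hZ
    have hR : ∀ x ∈ Z, T.R ω x = T.R ω x₀ := fun x hx => h.at_zero.R_const Z hZ x hx x₀ hx₀
    obtain ⟨g', hg', hmap⟩ := h.exists_return_density hZ hR hg.1
      fun x hx y hy => hg.2 x (hb hx) y (hb hy)
    rw [hcD] at hg'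
    refine ⟨T.R ω x₀, T.baseReturn ω, measurable_baseReturn ω, fun x hx => ?_,
      (h.at_zero.bijOn Z hZ).surjOn, fun x hx => (hR x hx).le, g', hg', hmap⟩
    rw [← hR x hx, towerIter_base (h.at_zero.R_pos x (hb hx))]
  | succ k ih =>
    rintro ω h Z ⟨E, hE, x₀, hx₀, W, hW, rfl⟩ g hg
    have hb := h.at_zero.subset_base hE
    have hR : ∀ x ∈ E, T.R ω x = T.R ω x₀ := fun x hx => h.at_zero.R_const E hE x hx x₀ hx₀
    obtain ⟨g₁, hg₁, hmap₁⟩ := h.exists_return_density hE hR hg.1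
      fun x hx y hy => hg.2 x (hb hx) y (hb hy)
    rw [hcD] at hg₁
    have hG := measurable_baseReturn (T := T) ω
    have h' := h.along (T.R ω x₀)
    have hWm := h'.measurableSet_cyl W hW
    obtain ⟨n, Ψ, hΨ, hit, hsurj, -, g₂, hg₂, hmap₂⟩ := ih h' hW hg₁
    refine ⟨T.R ω x₀ + n, Ψ ∘ T.baseReturn ω, hΨ.comp hG, ?_, ?_, ?_, g₂, ?_, ?_⟩
    · rintro x ⟨hx, hxW⟩
      rw [towerIter_add, ← hR x hx, towerIter_base (h.at_zero.R_pos x (hb hx)), hR x hx, hit _ hxW]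
      rfl
    · intro y hy
      obtain ⟨w, hw, rfl⟩ := hsurj hy
      obtain ⟨x, hx, rfl⟩ := (h.at_zero.bijOn E hE).surjOn (h'.cyl_subset_base hW hw)
      exact ⟨x, ⟨hx, hw⟩, rfl⟩
    · rintro x ⟨hx, -⟩
      rw [hR x hx]; omega
    · rw [shift_shift] at hg₂
      push_cast
      rwa [add_comm (T.R ω x₀ : ℤ)]
    · rw [← hmap₂, ← Measure.map_map hΨ hG]
      congr 1
      rw [Set.inter_comm, ← Measure.restrict_restrict (hG hWm),
        ← restrict_withDensity (hG hWm), ← Measure.restrict_map hG hWm, hmap₁,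
        restrict_withDensity hWm, baseMeasure, Measure.restrict_restrict hWm,
        Set.inter_eq_left.2 (h'.cyl_subset_base hW)]

/-! ### The generating property and density points -/

lemma Good.le_sep_towerMap (h : T.Good D γ ω) {k : ℕ} {z w : X × ℕ}
    (hs : ((k + 1 : ℕ) : ℕ∞) ≤ T.sep (ω, z) (ω, w)) :
    (k : ℕ∞) ≤ T.sep (shift 1 ω, T.towerMap ω z) (shift 1 ω, T.towerMap ω w) := by
  have s1 : T.SamePiece (ω, z) (ω, w) := one_le_sep_iff.1 (le_trans (by simp) hs)
  obtain ⟨hl, E, hE, hz, hw, hR⟩ := h.samePiece_iff.1 s1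
  obtain ⟨x, ℓ⟩ := z
  obtain ⟨y, ℓ'⟩ := w
  simp only at hl hE hz hw hR
  subst hl
  have hRy := (h (-(ℓ : ℤ))).R_const E hE x hz y hw
  by_cases h1 : ℓ + 1 < T.R (shift (-(ℓ : ℤ)) ω) x
  · rw [towerMap_up h1, towerMap_up (hRy ▸ h1)]
    have hsh : shift (-((ℓ + 1 : ℕ) : ℤ)) (shift 1 ω) = shift (-(ℓ : ℤ)) ω := by simp
    rw [(h.along 1).sep_level (ℓ := ℓ + 1) (E := E) (by rwa [hsh]) hz hw (by rwa [hsh]), hsh,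
      ← h.sep_level hE hz hw hR]
    exact le_trans (by simp) hs
  · have hx : T.R (shift (-(ℓ : ℤ)) ω) x = ℓ + 1 := by omega
    have hy : T.R (shift (-(ℓ : ℤ)) ω) y = ℓ + 1 := by omega
    rw [sep_eq_add_one s1, returnMap_of_lt hR, returnMap_of_lt (hRy ▸ hR), hx, hy] at hs
    rw [towerMap_return hx, towerMap_return hy]
    push_cast at hs
    rw [ENat.add_le_add_iff_right (by simp)] at hs
    simpa using hs

lemma Good.le_sep_towerIter (h : T.Good D γ ω) {j k : ℕ} {z w : X × ℕ}
    (hs : ((k + j : ℕ) : ℕ∞) ≤ T.sep (ω, z) (ω, w)) :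
    (k : ℕ∞) ≤ T.sep (shift j ω, T.towerIter ω j z) (shift j ω, T.towerIter ω j w) := by
  induction j generalizing k with
  | zero => simpa [towerIter] using hs
  | succ j ih =>
    have := (h.along j).le_sep_towerMap (ih (k := k + 1) (by rwa [add_assoc, add_comm 1 j]))
    rw [shift_shift] at this
    push_cast
    rw [add_comm (j : ℤ)]
    exact this

lemma Good.mem_atom (h : T.Good D γ ω) {k : ℕ} {x y : X} (hy : y ∈ T.base)
    (hs : ((k + 1 : ℕ) : ℕ∞) ≤ T.sep (ω, (x, 0)) (ω, (y, 0))) : (y, 0) ∈ T.atom ω k (x, 0) := by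
  refine ⟨h.base_mem_fiber hy, fun j hj => ?_⟩
  have : ((1 + j : ℕ) : ℕ∞) ≤ T.sep (ω, (x, 0)) (ω, (y, 0)) :=
    le_trans (by exact_mod_cast (by omega : 1 + j ≤ k + 1)) hs
  exact (one_le_sep_iff.1 (by simpa using h.le_sep_towerIter this)).2

end RandomTower

namespace RandomTower

variable {A X : Type*} [MeasurableSpace A] [MetricSpace X] [MeasurableSpace X]
  {p : Measure A} [IsProbabilityMeasure p] {m : Measure X} {T : RandomTower p m}
  {D γ c : ℝ} {ω : Noise A}

/-- The diameters of the partition atoms around each point of the tower over `ω` tend to zero. -/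
def Generating (T : RandomTower p m) (ω : Noise A) : Prop :=
  ∀ z ∈ T.fiber ω, Tendsto (fun n : ℕ => Metric.ediam (T.atom ω n z)) atTop (𝓝 0)

/-- The cylinders around a point of the base shrink to that point. -/
lemma Good.exists_cyl_subset (h : T.Good D γ ω) (hgen : T.Generating ω) {V : Set X}
    (hV : IsOpen V) {x : X} (hx : x ∈ T.base) (hxV : x ∈ V) :
    ∃ k, ∀ Z ∈ T.cyl k ω, x ∈ Z → Z ⊆ V := by
  obtain ⟨ε, hε, hball⟩ := EMetric.isOpen_iff.1 hV x hxV
  obtain ⟨k, hk⟩ := ((hgen _ (h.base_mem_fiber hx)).eventually (gt_mem_nhds hε)).exists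
  refine ⟨k, fun Z hZ hxZ y hy => hball ?_⟩
  have key : ∀ w ∈ Z, (w, 0) ∈ T.atom ω k (x, 0) := fun w hw =>
    h.mem_atom (h.cyl_subset_base hZ hw) ((h.mem_cyl_iff hZ hxZ).1 hw)
  have := (Metric.edist_le_ediam_of_mem (key y hy) (key x hxZ)).trans_lt hk
  simpa [Prod.edist_eq] using this

variable [BorelSpace X]

/-- Density points: a set of positive measure nearly fills some cylinder. -/
lemma Good.exists_cyl_diff_lt (h : T.Good D γ ω) (hgen : T.Generating ω) {B : Set X}
    (hB : MeasurableSet B) (hpos : T.baseMeasure B ≠ 0) {δ : ℝ≥0∞} (hδ : δ ≠ 0) :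
    ∃ k, ∃ Z ∈ T.cyl k ω, T.baseMeasure (Z \ B) < δ * T.baseMeasure Z := by
  by_contra! hcon
  obtain ⟨V, hBV, hV, hVB⟩ := hB.exists_isOpen_sdiff_lt (μ := T.baseMeasure) (by simp)
    (mul_ne_zero hδ hpos)
  -- the union of the `k`-cylinders inside an open neighbourhood `V` of `B` exhausts `B`
  set U : ℕ → Set X := fun k => ⋃ Z ∈ {Z | Z ∈ T.cyl k ω ∧ Z ⊆ V}, Z with hU
  have hcnt : ∀ k, {Z | Z ∈ T.cyl k ω ∧ Z ⊆ V}.Countable := fun k =>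
    (h.countable_cyl k).mono fun Z hZ => hZ.1
  have hdisj : ∀ k, {Z | Z ∈ T.cyl k ω ∧ Z ⊆ V}.PairwiseDisjoint id := by
    intro k Z hZ Z' hZ' hne
    refine Set.disjoint_left.2 fun x hx hx' => hne (h.cyl_eq_of_mem hZ.1 hZ'.1 hx hx')
  have hUle : ∀ k, δ * T.baseMeasure (U k) ≤ T.baseMeasure (V \ B) := by
    intro k
    have hsub : (⋃ Z ∈ {Z | Z ∈ T.cyl k ω ∧ Z ⊆ V}, Z \ B) ⊆ V \ B :=
      Set.iUnion₂_subset fun Z hZ => Set.sdiff_subset_sdiff_left hZ.2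
    refine le_trans ?_ (measure_mono hsub)
    rw [measure_biUnion (f := fun Z => Z \ B) (hcnt k) (fun Z hZ Z' hZ' hne =>
        ((hdisj k) hZ hZ' hne).mono Set.sdiff_subset Set.sdiff_subset)
        fun Z hZ => (h.measurableSet_cyl Z hZ.1).diff hB,
      show U k = ⋃ Z ∈ {Z | Z ∈ T.cyl k ω ∧ Z ⊆ V}, id Z from rfl,
      measure_biUnion (f := id) (hcnt k) (hdisj k) fun Z hZ => h.measurableSet_cyl Z hZ.1,
      ← ENNReal.tsum_mul_left]
    exact ENNReal.tsum_le_tsum fun Z => hcon k Z Z.2.1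
  have hmono : Monotone U := by
    intro k l hkl x hx
    obtain ⟨Z, hZ, hxZ⟩ := Set.mem_iUnion₂.1 hx
    obtain ⟨Z', hZ', hxZ'⟩ := h.exists_cyl l x (h.cyl_subset_base hZ.1 hxZ)
    exact Set.mem_iUnion₂.2 ⟨Z', ⟨hZ', (h.cyl_subset_of_le hkl hZ.1 hZ' hxZ hxZ').trans hZ.2⟩, hxZ'⟩
  have hcov : B ∩ T.base ⊆ ⋃ k, U k := by
    rintro x ⟨hx, hxb⟩
    obtain ⟨k, hk⟩ := h.exists_cyl_subset hgen hV hxb (hBV hx)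
    obtain ⟨Z, hZ, hxZ⟩ := h.exists_cyl k x hxb
    exact Set.mem_iUnion.2 ⟨k, Set.mem_iUnion₂.2 ⟨Z, ⟨hZ, hk Z hZ hxZ⟩, hxZ⟩⟩
  have hBb : T.baseMeasure B = T.baseMeasure (B ∩ T.base) := by
    rw [baseMeasure, Measure.restrict_apply hB,
      Measure.restrict_apply (hB.inter T.measurableSet_base), Set.inter_assoc, Set.inter_self]
  have : δ * T.baseMeasure B ≤ T.baseMeasure (V \ B) := by
    rw [hBb]
    calc δ * T.baseMeasure (B ∩ T.base) ≤ δ * T.baseMeasure (⋃ k, U k) := by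
          gcongr
      _ = ⨆ k, δ * T.baseMeasure (U k) := by
          rw [hmono.measure_iUnion, ENNReal.mul_iSup]
      _ ≤ _ := iSup_le hUle
  exact absurd hVB.2 (not_lt.2 this)

end RandomTower
end RandomTowers

namespace RandomTowers
namespace RandomTower

variable {A X : Type*} [MeasurableSpace A] [MetricSpace X] [MeasurableSpace X]
  {p : Measure A} [IsProbabilityMeasure p] {m : Measure X} {T : RandomTower p m}
  {D γ c : ℝ} {ω : Noise A} {N : ℕ} {t : Fin N → ℕ} {ε : Fin N → ℝ}

/-! ### Minorization -/

/-- Every fibrewise hypothesis, including the generating property and aperiodicity, holds along the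
orbit of `ω`. -/
structure Generic (T : RandomTower p m) (D γ : ℝ) {N : ℕ} (t : Fin N → ℕ) (ε : Fin N → ℝ)
    (ω : Noise A) : Prop where
  good : T.Good D γ ω
  generating : ∀ k : ℤ, T.Generating (shift k ω)
  aperiodic : ∀ k : ℤ, ∀ i,
    ENNReal.ofReal (ε i) < m {x | x ∈ T.base ∧ T.R (shift k ω) x = t i}

lemma Generic.along (h : T.Generic D γ t ε ω) (k : ℤ) : T.Generic D γ t ε (shift k ω) where
  good := h.good.along k
  generating j := by rw [shift_shift]; exact h.generating _
  aperiodic j := by rw [shift_shift]; exact h.aperiodic _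

/-- The image of `m` on the base after `k` steps dominates `κ` times `m` on the base, with `κ`
independent of the noise. -/
def Minorizes (T : RandomTower p m) (D γ : ℝ) {N : ℕ} (t : Fin N → ℕ) (ε : Fin N → ℝ)
    (k : ℕ) (κ : ℝ≥0∞) : Prop :=
  ∀ ω, T.Generic D γ t ε ω →
    κ • T.baseLevelMeasure ≤ T.baseLevelMeasure.map (T.towerIter ω k)

lemma Minorizes.map_le {l : ℕ} {κ κ' : ℝ≥0∞} (h : T.Generic D γ t ε ω)
    {k : ℕ} (hk : κ • T.baseLevelMeasure ≤ T.baseLevelMeasure.map (T.towerIter ω k))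
    (hl : T.Minorizes D γ t ε l κ') :
    (κ * κ') • T.baseLevelMeasure ≤ T.baseLevelMeasure.map (T.towerIter ω (k + l)) := by
  rw [map_towerIter_add]
  refine le_trans ?_ (Measure.map_mono hk (measurable_towerIter _ _))
  rw [Measure.map_smul, mul_smul]
  gcongr
  exact hl _ (h.along k)

/-- The points with return time `t i` bring mass back to the base at that time. -/
lemma minorizes_returnTime (h0 : 0 ≤ γ) (h1 : γ ≤ 1) (hc : 0 ≤ c) (hcD : c * γ + D = c)
    (i : Fin N) : T.Minorizes D γ t ε (t i)
      (ENNReal.ofReal (Real.exp (-c)) * ENNReal.ofReal (ε i)) := by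
  intro ω h
  refine le_trans ?_ ((h.good.regular_iter h0 h1 hc hcD (t i)).smul_baseLevelMeasure_le h0 h1 hc
    (h.good.along _))
  gcongr
  refine (h.aperiodic 0 i).le.trans ?_
  rw [Measure.map_apply (measurable_towerIter _ _) (measurableSet_snd_eq 0),
    baseLevelMeasure_apply ((measurable_towerIter _ _) (measurableSet_snd_eq 0)), shift_zero]
  have hm : MeasurableSet {x | x ∈ T.base ∧ T.R ω x = t i} := T.measurableSet_base.inter
    (measurableSet_eq_fun (measurable_R_comp measurable_const measurable_id) measurable_const)
  calc m {x | x ∈ T.base ∧ T.R ω x = t i} = T.baseMeasure {x | x ∈ T.base ∧ T.R ω x = t i} := by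
        rw [baseMeasure, Measure.restrict_apply hm, Set.inter_eq_left.2 fun x hx => hx.1]
    _ ≤ _ := measure_mono fun x hx => by
        have hR := h.good.at_zero.R_pos x hx.1
        change (T.towerIter ω (t i) (x, 0)).2 = 0
        rw [← hx.2, towerIter_base (by omega)]

/-- Since the return times `t i` have no common divisor, minorization holds at all large times. -/
lemma exists_minorizes (h0 : 0 ≤ γ) (h1 : γ ≤ 1) (hc : 0 ≤ c) (hcD : c * γ + D = c)
    (ht : Finset.univ.gcd t = 1) (hε : ∀ i, 0 < ε i) :
    ∃ N₀, ∀ k ≥ N₀, ∃ κ ≠ 0, T.Minorizes D γ t ε k κ := by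
  let S : AddSubmonoid ℕ :=
    { carrier := {k | ∃ κ ≠ 0, T.Minorizes D γ t ε k κ}
      zero_mem' := ⟨1, one_ne_zero, fun ω _ => by
        have : T.towerIter ω 0 = id := rfl
        simp [this]⟩
      add_mem' := by
        rintro k l ⟨κ, hκ, hk⟩ ⟨κ', hκ', hl⟩
        exact ⟨κ * κ', mul_ne_zero hκ hκ', fun ω h => hl.map_le h (hk ω h)⟩ }
  have hS : AddSubmonoid.closure (Set.range t) ≤ S := by
    rw [AddSubmonoid.closure_le]
    rintro _ ⟨i, rfl⟩
    exact ⟨_, mul_ne_zero (by simpa using Real.exp_pos _) (by simpa using hε i),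
      minorizes_returnTime h0 h1 hc hcD i⟩
  have hgcd : Nat.setGcd (Set.range t) = 1 := by
    rw [← Nat.dvd_one, ← ht]
    exact Finset.dvd_gcd fun i _ => Nat.setGcd_dvd_of_mem ⟨i, rfl⟩
  obtain ⟨N₀, hN₀⟩ := Nat.exists_mem_closure_of_ge (Set.range t)
  exact ⟨N₀, fun k hk => hS (hN₀ k hk (by simp [hgcd]))⟩

/-- When the fibre at time `n` has little mass above level `L`, a definite part of the mass that
started on the base at time `0` is on the base at time `n + N₀`; the proportion depends on `L`, but
not on `n`. -/
lemma exists_minorization_of_lowTop (h0 : 0 ≤ γ) (h1 : γ ≤ 1) (hc : 0 ≤ c)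
    (hcD : c * γ + D = c) {N₀ : ℕ}
    (hN₀ : ∀ k ≥ N₀, ∃ κ ≠ 0, T.Minorizes D γ t ε k κ) (L : ℕ) :
    ∃ κ : ℝ≥0∞, κ ≠ 0 ∧ ∀ ω, T.Generic D γ t ε ω → ∀ n : ℕ, L ≤ n →
      shift n ω ∈ T.LowTop c L →
      κ • T.baseLevelMeasure ≤ T.baseLevelMeasure.map (T.towerIter ω (n + N₀)) := by
  choose! κ hκ hm using fun ℓ : ℕ => hN₀ (N₀ + ℓ) (Nat.le_add_right _ _)
  refine ⟨(ENNReal.ofReal (Real.exp (-c)) * (4 * L : ℝ≥0∞)⁻¹) * (Finset.range L).inf κ, ?_, ?_⟩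
  · refine mul_ne_zero (mul_ne_zero (by simpa using Real.exp_pos _) ?_) ?_
    · exact ENNReal.inv_ne_zero.2 (ENNReal.mul_ne_top (by simp) (by simp))
    · rw [← pos_iff_ne_zero, Finset.lt_inf_iff (by simp)]
      exact fun ℓ _ => pos_iff_ne_zero.2 (hκ ℓ)
  · intro ω h n hn hlow
    set ν := T.baseLevelMeasure.map (T.towerIter ω n) with hν
    have hreg := h.good.regular_iter h0 h1 hc hcD n
    have htop : ν {z | L ≤ z.2} ≤ 2⁻¹ := by
      refine (hreg.apply_le
        (measurableSet_le measurable_const measurable_snd)).trans ?_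
      calc ENNReal.ofReal (Real.exp c) * T.refMeasure (shift n ω) {z | L ≤ z.2}
          ≤ ENNReal.ofReal (Real.exp c) * (ENNReal.ofReal (Real.exp (-c)) * 2⁻¹) := by
            gcongr; exact hlow
        _ = 2⁻¹ := by
            rw [← mul_assoc, ← ENNReal.ofReal_mul (Real.exp_pos _).le, ← Real.exp_add]
            simp
    -- at least half of the mass lies on the first `L` levels, so one of them carries `1 / (4 L)`
    have hlevel : ∃ ℓ ∈ Finset.range L, (4 * L : ℝ≥0∞)⁻¹ ≤ ν {z | z.2 = ℓ} := by
      by_contra! hcon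
      have hcov : (Set.univ : Set (X × ℕ)) ⊆
          {z | L ≤ z.2} ∪ ⋃ ℓ ∈ Finset.range L, {z | z.2 = ℓ} := by
        intro z _
        rcases le_or_gt L z.2 with hz | hz
        · exact Or.inl hz
        · exact Or.inr (Set.mem_iUnion₂.2 ⟨z.2, by simpa using hz, rfl⟩)
      have h4 : ∑ ℓ ∈ Finset.range L, ν {z | z.2 = ℓ} ≤ 4⁻¹ := by
        refine (Finset.sum_le_card_nsmul _ _ _ fun ℓ hℓ => (hcon ℓ hℓ).le).trans ?_
        rw [Finset.card_range, nsmul_eq_mul,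
          ENNReal.mul_inv (by left; simp) (by left; simp), mul_left_comm]
        exact mul_le_of_le_one_right zero_le (ENNReal.mul_inv_le_one _)
      have : (1 : ℝ≥0∞) ≤ 2⁻¹ + 4⁻¹ := by
        calc (1 : ℝ≥0∞) = ν Set.univ := hreg.1.symm
          _ ≤ _ := measure_mono hcov
          _ ≤ _ := measure_union_le _ _
          _ ≤ _ := add_le_add htop ((measure_biUnion_finset_le _ _).trans h4)
      have h34 : ((2 : ℝ≥0∞)⁻¹ + 4⁻¹).toReal = 3 / 4 := by
        rw [ENNReal.toReal_add (by simp) (by simp)]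
        simp; norm_num
      have := ENNReal.toReal_mono (by simp) this
      rw [h34] at this
      norm_num at this
    obtain ⟨ℓ, hℓ, hmass⟩ := hlevel
    have hℓL : ℓ < L := by simpa using hℓ
    -- mass at level `ℓ` comes from the base at time `n - ℓ`
    have hbase : ν {z | z.2 = ℓ} ≤
        T.baseLevelMeasure.map (T.towerIter ω (n - ℓ)) {z | z.2 = 0} := by
      rw [hν, Measure.map_apply (measurable_towerIter _ _) (measurableSet_snd_eq _),
        Measure.map_apply (measurable_towerIter _ _) (measurableSet_snd_eq _)]
      refine measure_mono fun z hz => ?_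
      have e : T.towerIter ω n z =
          T.towerIter (shift ((n - ℓ : ℕ) : ℤ) ω) ℓ (T.towerIter ω (n - ℓ) z) := by
        rw [← towerIter_add, Nat.sub_add_cancel (hℓL.le.trans hn)]
      have hz' : (T.towerIter ω n z).2 = ℓ := hz
      rw [e] at hz'
      have := le_level_towerIter (T := T) (ω := shift ((n - ℓ : ℕ) : ℤ) ω)
        (z := T.towerIter ω (n - ℓ) z) (k := ℓ) hz'.ge
      change (T.towerIter ω (n - ℓ) z).2 = 0
      omega
    have hlow' : (ENNReal.ofReal (Real.exp (-c)) * (4 * L : ℝ≥0∞)⁻¹) • T.baseLevelMeasure ≤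
        T.baseLevelMeasure.map (T.towerIter ω (n - ℓ)) := by
      refine le_trans ?_ ((h.good.regular_iter h0 h1 hc hcD (n - ℓ)).smul_baseLevelMeasure_le
        h0 h1 hc (h.good.along _))
      gcongr
      exact hmass.trans hbase
    have := (hm ℓ).map_le h hlow'
    rw [show n - ℓ + (N₀ + ℓ) = n + N₀ by omega] at this
    refine le_trans ?_ this
    gcongr
    exact Finset.inf_le hℓ

/-! ### Triviality of the tail -/

variable [BorelSpace X]

/-- A tail set of positive mass nearly fills the base at some time, at which moreover every point of
the base is the image of a point of the fibre. -/
lemma Generic.exists_time_nearly_full (h : T.Generic D γ t ε ω) (h0 : 0 ≤ γ) (h1 : γ ≤ 1)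
    (hc : 0 ≤ c) (hcD : c * γ + D = c) {B : Set (X × ℕ)} {B' : ℕ → Set (X × ℕ)}
    (hB' : ∀ n, MeasurableSet (B' n)) (hB : ∀ n, B = T.fiber ω ∩ T.towerIter ω n ⁻¹' B' n)
    (hpos : T.refMeasure ω B ≠ 0) {δ : ℝ≥0∞} (hδ : δ ≠ 0) :
    ∃ n, T.baseLevelMeasure (B' n)ᶜ ≤ δ ∧
      ∀ x ∈ T.base, ∃ z ∈ T.fiber ω, T.towerIter ω n z = (x, 0) := by
  have hBm : MeasurableSet B := by
    rw [hB 0]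
    exact (measurableSet_fiber ω).inter (measurable_towerIter ω 0 (hB' 0))
  -- some level of the set has positive measure
  obtain ⟨ℓ, hℓ⟩ : ∃ ℓ, m (T.level ω ℓ ∩ {x | (x, ℓ) ∈ B}) ≠ 0 := by
    by_contra! hcon
    apply hpos
    rw [← lintegral_indicator_one hBm, lintegral_refMeasure (measurable_one.indicator hBm)]
    refine ENNReal.tsum_eq_zero.2 fun ℓ => ?_
    have hS : MeasurableSet {x : X | (x, ℓ) ∈ B} := hBm.preimage measurable_prodMk_right
    have : ∀ x, B.indicator (1 : X × ℕ → ℝ≥0∞) (x, ℓ) =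
        {x : X | (x, ℓ) ∈ B}.indicator 1 x := fun x => rfl
    simp_rw [this]
    rw [lintegral_indicator_one hS, Measure.restrict_apply hS, Set.inter_comm, hcon]
  set Bℓ : Set X := T.level ω ℓ ∩ {x | (x, ℓ) ∈ B} with hBℓ
  have hBℓm : MeasurableSet Bℓ :=
    (measurableSet_level ω ℓ).inter (hBm.preimage measurable_prodMk_right)
  set ω' := shift (-(ℓ : ℤ)) ω with hω'
  have h' : T.Generic D γ t ε ω' := h.along _
  have hback : shift (ℓ : ℤ) ω' = ω := by simp [hω']
  -- the bound by `1` ensures that the cylinder below meets the set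
  set δ' : ℝ≥0∞ := min (ENNReal.ofReal (Real.exp (-c)) * δ) 1 with hδ'
  have hBpos : T.baseMeasure Bℓ ≠ 0 := by
    rwa [baseMeasure, Measure.restrict_apply hBℓm, Set.inter_eq_left.2 fun x hx => hx.1.1]
  obtain ⟨k, Z, hZ, hdiff⟩ := h'.good.exists_cyl_diff_lt (h.generating _) hBℓm hBpos
    (δ := δ') (by
      rw [hδ', ← pos_iff_ne_zero]
      refine lt_min (pos_iff_ne_zero.2 (mul_ne_zero (by simpa using Real.exp_pos _) hδ)) one_pos)
  have hZb := h'.good.cyl_subset_base hZ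
  have hZm := h'.good.measurableSet_cyl Z hZ
  have hmZ : m.restrict Z = T.baseMeasure.restrict Z := by
    rw [baseMeasure, Measure.restrict_restrict hZm, Set.inter_eq_left.2 hZb]
  obtain ⟨n', Ψ, hΨ, hit, hsurj, hRn, g, hg, hmap⟩ := h'.good.exists_cyl_density hcD hZ
    (g := fun _ => 1) ⟨measurable_const, fun x _ y _ => by simpa using one_le_wt h0 hc _ _⟩
  -- the cylinder lies in the base of level `ℓ`
  have hZR : ∀ x ∈ Z, ℓ < T.R ω' x := by
    obtain ⟨x₁, hx₁, hx₁B⟩ : ∃ x ∈ Z, x ∈ Bℓ := by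
      by_contra! hcon
      have : Z \ Bℓ = Z := by
        ext x; exact ⟨fun hx => hx.1, fun hx => ⟨hx, hcon x hx⟩⟩
      rw [this] at hdiff
      exact absurd hdiff (not_lt.2 (mul_le_of_le_one_left zero_le (min_le_right _ _)))
    intro x hx
    have hs := one_le_sep_iff.1 (le_trans (by simp) ((h'.good.mem_cyl_iff hZ hx₁).1 hx))
    obtain ⟨E, hE, hx₁E⟩ := h'.good.at_zero.exists_mem (hZb hx₁)
    rw [h'.good.at_zero.R_const E hE x ((h'.good.samePiece_base_iff hE hx₁E).1 hs) x₁ hx₁E]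
    exact hx₁B.1.2
  have hZne : Z.Nonempty := by
    by_contra hcon
    rw [Set.not_nonempty_iff_eq_empty.1 hcon] at hdiff
    simp at hdiff
  have hn' : ℓ ≤ n' := by
    obtain ⟨x, hx⟩ := hZne
    exact (hZR x hx).le.trans (hRn x hx)
  have hiter : ∀ x ∈ Z, T.towerIter ω (n' - ℓ) (x, ℓ) = (Ψ x, 0) := by
    intro x hx
    rw [← hit x hx]
    conv_rhs => rw [← Nat.add_sub_of_le hn', towerIter_add, towerIter_lt (ℓ := 0) (k := ℓ) (by
      simpa using hZR x hx), hback, zero_add]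
  have hfib : ∀ x ∈ Z, (x, ℓ) ∈ T.fiber ω := fun x hx => ⟨hZb hx, hZR x hx⟩
  refine ⟨n' - ℓ, ?_, fun y hy => ?_⟩
  · have hBn := hB (n' - ℓ)
    rw [baseLevelMeasure_apply (hB' _).compl]
    set Q : Set X := {x | (x, 0) ∈ (B' (n' - ℓ))ᶜ} with hQ
    have hQm : MeasurableSet Q := (hB' _).compl.preimage measurable_prodMk_right
    rw [show (fun _ : X => (1 : ℝ≥0∞)) = 1 from rfl, withDensity_one, hmZ] at hmap
    have hgtot : ∫⁻ y, g y ∂T.baseMeasure = T.baseMeasure Z := by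
      have := congrArg (fun ν => ν Set.univ) hmap
      simpa [Measure.map_apply hΨ MeasurableSet.univ] using this.symm
    have hQle : T.baseMeasure.withDensity g Q ≤ δ' * T.baseMeasure Z := by
      rw [← hmap, Measure.map_apply hΨ hQm, Measure.restrict_apply (hΨ hQm)]
      refine le_trans (measure_mono ?_) hdiff.le
      rintro x ⟨hxQ, hxZ⟩
      refine ⟨hxZ, fun hxB => hxQ ?_⟩
      have hx2 : (x, ℓ) ∈ B := hxB.2
      rw [hBn] at hx2
      rw [← hiter x hxZ]
      exact hx2.2
    have hlow := (Measure.le_iff'.1 (hg.smul_le_withDensity h0 h1 hc) Q).trans hQle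
    rw [hgtot, Measure.smul_apply, smul_eq_mul] at hlow
    have hZ0 : T.baseMeasure Z ≠ 0 := fun h0 => by simp [h0] at hdiff
    have hexp : ENNReal.ofReal (Real.exp (-c)) ≠ 0 := by simpa using Real.exp_pos _
    have : ENNReal.ofReal (Real.exp (-c)) * T.baseMeasure Z * T.baseMeasure Q ≤
        ENNReal.ofReal (Real.exp (-c)) * T.baseMeasure Z * δ := by
      refine hlow.trans ?_
      calc δ' * T.baseMeasure Z ≤ (ENNReal.ofReal (Real.exp (-c)) * δ) * T.baseMeasure Z := by
            gcongr; exact min_le_left _ _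
        _ = _ := by ring
    exact (ENNReal.mul_le_mul_iff_right (mul_ne_zero hexp hZ0)
      (ENNReal.mul_ne_top (by simp) (by simp))).1 this
  · obtain ⟨x, hx, rfl⟩ := hsurj hy
    exact ⟨(x, ℓ), hfib x hx, hiter x hx⟩

/-- The tail `σ`-algebra of a generic fibre is trivial: a tail set and its complement cannot both
have positive mass, because each would nearly fill the base at all times of minorization. -/
lemma Generic.tail_trivial (h : T.Generic D γ t ε ω) (h0 : 0 ≤ γ) (h1 : γ ≤ 1)
    (hc : 0 ≤ c) (hcD : c * γ + D = c) (ht : Finset.univ.gcd t = 1) (hε : ∀ i, 0 < ε i)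
    {L : ℕ} (hL : ∃ᶠ n : ℕ in atTop, shift n ω ∈ T.LowTop c L)
    {B : Set (X × ℕ)} {B' : ℕ → Set (X × ℕ)}
    (hB' : ∀ n, MeasurableSet (B' n)) (hB : ∀ n, B = T.fiber ω ∩ T.towerIter ω n ⁻¹' B' n) :
    T.refMeasure ω B = 0 ∨ T.refMeasure ω (T.fiber ω \ B) = 0 := by
  by_contra! hcon
  obtain ⟨hpos, hpos'⟩ := hcon
  obtain ⟨N₀, hN₀⟩ := exists_minorizes (T := T) (t := t) (ε := ε) h0 h1 hc hcD ht hε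
  obtain ⟨κ, hκ, hmin⟩ := exists_minorization_of_lowTop h0 h1 hc hcD hN₀ L
  -- after minorization, a set and its complement would each miss at most a quarter of the base
  set δ : ℝ≥0∞ := min κ 1 * 4⁻¹ with hδ
  have hκ1 : min κ 1 ≠ 0 := by
    rw [← pos_iff_ne_zero]; exact lt_min (pos_iff_ne_zero.2 hκ) one_pos
  have hδ0 : δ ≠ 0 := mul_ne_zero hκ1 (by simp)
  have hBc : ∀ n, T.fiber ω \ B = T.fiber ω ∩ T.towerIter ω n ⁻¹' (B' n)ᶜ := fun n => by
    rw [hB n]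
    ext z
    simp only [Set.mem_sdiff, Set.mem_inter_iff, Set.mem_preimage, Set.mem_compl_iff]
    tauto
  -- transport of a small set on the base at time `n` to a time of minorization
  have key : ∀ (C : Set (X × ℕ)) (C' : ℕ → Set (X × ℕ)), (∀ n, MeasurableSet (C' n)) →
      (∀ n, C = T.fiber ω ∩ T.towerIter ω n ⁻¹' C' n) → ∀ n,
      T.baseLevelMeasure (C' n)ᶜ ≤ δ → (∀ x ∈ T.base, ∃ z ∈ T.fiber ω, T.towerIter ω n z = (x, 0)) →
      ∀ j, n + L ≤ j → shift j ω ∈ T.LowTop c L →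
        min κ 1 * T.baseLevelMeasure (C' (j + N₀))ᶜ ≤ δ := by
    intro C C' hC' hC n hn hsurj j hj hjL
    have hm := hmin (shift n ω) (h.along n) (j - n) (by omega)
      (by rw [shift_shift, Nat.cast_sub (by omega)]; simpa using hjL)
    have hm' := Measure.le_iff'.1 hm (C' (j + N₀))ᶜ
    rw [Measure.smul_apply, smul_eq_mul,
      Measure.map_apply (measurable_towerIter _ _) (hC' _).compl] at hm'
    refine le_trans (by gcongr; exact min_le_left _ _) (hm'.trans (le_trans ?_ hn))
    rw [baseLevelMeasure_apply (measurable_towerIter _ _ (hC' _).compl),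
      baseLevelMeasure_apply (hC' _).compl]
    refine measure_mono_ae ?_
    filter_upwards [ae_restrict_mem T.measurableSet_base] with x hx hx'
    obtain ⟨z, hz, hzx⟩ := hsurj x hx
    have hx'' : T.towerIter (shift n ω) (j - n + N₀) (x, 0) ∉ C' (j + N₀) := hx'
    rw [← hzx, ← towerIter_add, show n + (j - n + N₀) = j + N₀ by omega] at hx''
    change (x, 0) ∉ C' n
    rw [← hzx]
    intro hmem
    have hzC : z ∈ C := by rw [hC n]; exact ⟨hz, hmem⟩
    rw [hC (j + N₀)] at hzC
    exact hx'' hzC.2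
  obtain ⟨n₁, hn₁, hs₁⟩ := h.exists_time_nearly_full h0 h1 hc hcD hB' hB hpos hδ0
  obtain ⟨n₂, hn₂, hs₂⟩ := h.exists_time_nearly_full h0 h1 hc hcD (fun n => (hB' n).compl) hBc
    hpos' hδ0
  obtain ⟨j, hjL, hj⟩ := (hL.and_eventually (eventually_ge_atTop (n₁ + n₂ + L))).exists
  have k₁ := key B B' hB' hB n₁ hn₁ hs₁ j (by omega) hjL
  have k₂ := key _ _ (fun n => (hB' n).compl) hBc n₂ hn₂ hs₂ j (by omega) hjL
  rw [compl_compl] at k₂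
  have hsum : min κ 1 ≤ δ + δ := by
    calc min κ 1 = min κ 1 * (T.baseLevelMeasure (B' (j + N₀)) +
          T.baseLevelMeasure (B' (j + N₀))ᶜ) := by
          rw [prob_add_prob_compl (hB' _), mul_one]
      _ ≤ δ + δ := by rw [mul_add]; exact add_le_add k₂ k₁
  have hfin : min κ 1 ≠ ∞ := ne_top_of_le_ne_top (by simp) (min_le_right _ _)
  rw [hδ, ← mul_add] at hsum
  have h2 : min κ 1 * 1 ≤ min κ 1 * (4⁻¹ + 4⁻¹) := by simpa using hsum
  rw [ENNReal.mul_le_mul_iff_right hκ1 hfin] at h2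
  have h34 : ((4 : ℝ≥0∞)⁻¹ + 4⁻¹).toReal = 1 / 2 := by
    rw [ENNReal.toReal_add (by simp) (by simp)]
    simp; norm_num
  have := ENNReal.toReal_mono (by simp) h2
  rw [h34] at this
  norm_num at this

end RandomTower
end RandomTowers

namespace RandomTowers

/-! ### Decreasing sequences of closed convex sets in a Hilbert space -/

/-- A decreasing sequence of nonempty closed convex subsets of a Hilbert space, the first of which
is bounded, has nonempty intersection: the elements of minimal norm form a Cauchy sequence, by the
parallelogram identity. -/
lemma nonempty_iInter_of_convex {H : Type*} [NormedAddCommGroup H] [InnerProductSpace ℝ H]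
    [CompleteSpace H] {C : ℕ → Set H} (hanti : Antitone C) (hne : ∀ n, (C n).Nonempty)
    (hcl : ∀ n, IsClosed (C n)) (hconv : ∀ n, Convex ℝ (C n)) {M : ℝ}
    (hM : ∀ x ∈ C 0, ‖x‖ ≤ M) : (⋂ n, C n).Nonempty := by
  choose x hx hmin using fun n =>
    exists_norm_eq_iInf_of_complete_convex (hne n) (hcl n).isComplete (hconv n) 0
  have hle : ∀ n, ∀ y ∈ C n, ‖x n‖ ≤ ‖y‖ := by
    intro n y hy
    have h1 : ‖x n‖ = ⨅ w : C n, ‖(0 : H) - w‖ := by rw [← hmin n]; simp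
    rw [h1]
    refine (ciInf_le ⟨0, by rintro _ ⟨w, rfl⟩; positivity⟩ ⟨y, hy⟩).trans ?_
    simp
  have hmono : Monotone fun n => ‖x n‖ := fun n k hnk => hle n _ (hanti hnk (hx k))
  have hbdd : BddAbove (Set.range fun n => ‖x n‖) :=
    ⟨M, by rintro _ ⟨n, rfl⟩; exact hM _ (hanti (Nat.zero_le n) (hx n))⟩
  have hlim := tendsto_atTop_ciSup hmono hbdd
  set a := ⨆ n, ‖x n‖ with ha
  have hxa : ∀ n, ‖x n‖ ≤ a := fun n => le_ciSup hbdd n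
  have ha0 : 0 ≤ a := (norm_nonneg _).trans (hxa 0)
  have hdist : ∀ n k, n ≤ k → dist (x n) (x k) ^ 2 ≤ 4 * (a ^ 2 - ‖x n‖ ^ 2) := by
    intro n k hnk
    have hmid : ‖x n‖ ≤ ‖(1 / 2 : ℝ) • x n + (1 / 2 : ℝ) • x k‖ :=
      hle n _ (hconv n (hx n) (hanti hnk (hx k)) (by norm_num) (by norm_num) (by norm_num))
    rw [← smul_add, norm_smul, Real.norm_of_nonneg (by norm_num)] at hmid
    have hpar := parallelogram_law_with_norm ℝ (x n) (x k)
    have h1 : ‖x n‖ * 2 ≤ ‖x n + x k‖ := by linarith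
    have h2 : (‖x n‖ * 2) ^ 2 ≤ ‖x n + x k‖ ^ 2 := by gcongr
    have h3 : ‖x k‖ ^ 2 ≤ a ^ 2 := by gcongr; exact hxa k
    have h4 : ‖x n‖ ^ 2 ≤ a ^ 2 := by gcongr; exact hxa n
    rw [dist_eq_norm]
    nlinarith
  have hcau : CauchySeq x := by
    refine cauchySeq_of_le_tendsto_0 (fun n => 2 * Real.sqrt (4 * (a ^ 2 - ‖x n‖ ^ 2))) ?_ ?_
    · intro n k N hn hk
      have key : ∀ j, N ≤ j → dist (x N) (x j) ≤ Real.sqrt (4 * (a ^ 2 - ‖x N‖ ^ 2)) :=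
        fun j hj => Real.le_sqrt_of_sq_le (hdist N j hj)
      calc dist (x n) (x k) ≤ dist (x N) (x n) + dist (x N) (x k) := dist_triangle_left _ _ _
        _ ≤ _ := by linarith [key n hn, key k hk]
    · have : Tendsto (fun n => 2 * Real.sqrt (4 * (a ^ 2 - ‖x n‖ ^ 2))) atTop
          (𝓝 (2 * Real.sqrt (4 * (a ^ 2 - a ^ 2)))) :=
        ((((hlim.pow 2).const_sub _).const_mul _).sqrt).const_mul _
      simpa using this
  obtain ⟨y, hy⟩ := cauchySeq_tendsto_of_complete hcau
  refine ⟨y, Set.mem_iInter.2 fun n => (hcl n).mem_of_tendsto hy ?_⟩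
  filter_upwards [eventually_ge_atTop n] with k hk using hanti hk (hx k)

/-! ### Families of measures that agree on every set -/

/-- If two families of measures on a space with countably generated `σ`-algebra agree on every set
almost everywhere, then they agree almost everywhere. -/
lemma ae_eq_of_forall_measurableSet {Ω Y : Type*} [MeasurableSpace Ω] {P : Measure Ω}
    [mY : MeasurableSpace Y] [MeasurableSpace.CountablyGenerated Y] {κ η : Ω → Measure Y}
    (hfin : ∀ᵐ ω ∂P, κ ω Set.univ < ∞)
    (h : ∀ B, MeasurableSet B → ∀ᵐ ω ∂P, κ ω B = η ω B) : ∀ᵐ ω ∂P, κ ω = η ω := by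
  obtain ⟨b, hb, hgen⟩ := MeasurableSpace.CountablyGenerated.isCountablyGenerated (α := Y)
  have hcnt := countable_generateSetAlgebra hb
  have hgen' : mY = MeasurableSpace.generateFrom (generateSetAlgebra b) := by
    rw [generateFrom_generateSetAlgebra_eq]; exact hgen
  have hpi : IsPiSystem (generateSetAlgebra b) :=
    isSetAlgebra_generateSetAlgebra.isSetRing.isSetSemiring.isPiSystem
  have hall : ∀ᵐ ω ∂P, ∀ B ∈ generateSetAlgebra b, κ ω B = η ω B := by
    rw [ae_ball_iff hcnt]
    intro B hB
    exact h B (by rw [hgen']; exact MeasurableSpace.measurableSet_generateFrom hB)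
  filter_upwards [hfin, hall, h Set.univ MeasurableSet.univ] with ω h1 h2 h3
  have : IsFiniteMeasure (κ ω) := ⟨h1⟩
  exact ext_of_generate_finite _ hgen' hpi h2 h3

namespace RandomTower

section Separable

variable {A X : Type*} [MeasurableSpace A] [MetricSpace X] [MeasurableSpace X]
  {p : Measure A} [IsProbabilityMeasure p] {m : Measure X} {T : RandomTower p m}
  {D γ c : ℝ} {ω : Noise A}

/-- The generating property makes the base separable. -/
lemma Good.isSeparable_base (h : T.Good D γ ω) (hgen : T.Generating ω) :
    TopologicalSpace.IsSeparable T.base := by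
  classical
  obtain ⟨x₀, -⟩ := T.base_nonempty
  let pt : Set X → X := fun Z => if hZ : Z.Nonempty then hZ.choose else x₀
  refine ⟨⋃ k, pt '' T.cyl k ω,
    Set.countable_iUnion fun k => (h.countable_cyl k).image _, fun x hx => ?_⟩
  rw [mem_closure_iff]
  intro V hV hxV
  obtain ⟨k, hk⟩ := h.exists_cyl_subset hgen hV hx hxV
  obtain ⟨Z, hZ, hxZ⟩ := h.exists_cyl k x hx
  have hne : Z.Nonempty := ⟨x, hxZ⟩
  refine ⟨pt Z, hk Z hZ hxZ ?_, Set.mem_iUnion.2 ⟨k, Z, hZ, rfl⟩⟩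
  simp only [pt, dif_pos hne]
  exact hne.choose_spec

/-- Two families of measures on the tower that agree on every set almost everywhere agree almost
everywhere, because the base is separable. -/
lemma ae_eq_of_forall_tower [BorelSpace X] (hsep : TopologicalSpace.IsSeparable T.base)
    {Ω : Type*} [MeasurableSpace Ω] {P : Measure Ω} {κ η : Ω → Measure (X × ℕ)}
    (hfin : ∀ᵐ ω ∂P, κ ω Set.univ < ∞)
    (hκ : ∀ᵐ ω ∂P, κ ω (T.base ×ˢ Set.univ)ᶜ = 0) (hη : ∀ᵐ ω ∂P, η ω (T.base ×ˢ Set.univ)ᶜ = 0)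
    (h : ∀ B, MeasurableSet B → ∀ᵐ ω ∂P, κ ω B = η ω B) : ∀ᵐ ω ∂P, κ ω = η ω := by
  set S : Set (X × ℕ) := T.base ×ˢ Set.univ with hS
  have hSm : MeasurableSet S := T.measurableSet_base.prod MeasurableSet.univ
  have hSsep : TopologicalSpace.IsSeparable S :=
    hsep.prod (TopologicalSpace.IsSeparable.of_separableSpace _)
  have : SecondCountableTopology S := hSsep.secondCountableTopology
  have hemb : MeasurableEmbedding (Subtype.val : S → X × ℕ) := MeasurableEmbedding.subtype_coe hSm
  have hcomap : ∀ (ν : Measure (X × ℕ)) (B : Set S),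
      ν.comap Subtype.val B = ν (Subtype.val '' B) := fun ν B => hemb.comap_apply ν B
  have key : ∀ᵐ ω ∂P, (κ ω).comap (Subtype.val : S → X × ℕ) =
      (η ω).comap (Subtype.val : S → X × ℕ) := by
    refine ae_eq_of_forall_measurableSet ?_ fun B hB => ?_
    · filter_upwards [hfin] with ω hω
      rw [hcomap]
      exact (measure_mono (Set.subset_univ _)).trans_lt hω
    · filter_upwards [h _ (hemb.measurableSet_image.2 hB)] with ω hω
      rw [hcomap, hcomap, hω]
  filter_upwards [key, hκ, hη] with ω h1 h2 h3
  have hres : ∀ ν : Measure (X × ℕ), ν Sᶜ = 0 →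
      ν = (ν.comap (Subtype.val : S → X × ℕ)).map Subtype.val := by
    intro ν hν
    rw [hemb.map_comap, Subtype.range_coe, Measure.restrict_eq_self_of_ae_mem]
    exact hν
  rw [hres _ h2, hres _ h3, h1]

end Separable

section Total

variable {A X : Type*} [MeasurableSpace A] [MeasurableSpace X]
  {p : Measure A} [IsProbabilityMeasure p] {m : Measure X} {T : RandomTower p m}
  {D γ c : ℝ} {ω : Noise A}

/-! ### The reference measure on the fibred tower -/

/-- The reference measure on the total space of the tower. -/
def totalMeasure (T : RandomTower p m) : Measure (Noise A × (X × ℕ)) :=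
  ((noiseMeasure p).prod (T.baseMeasure.prod Measure.count)).restrict
    {q | q.2 ∈ T.fiber q.1}

lemma refMeasure_eq (ω : Noise A) :
    T.refMeasure ω = (T.baseMeasure.prod Measure.count).restrict (T.fiber ω) := rfl

lemma measurable_lintegral_refMeasure {f : Noise A × (X × ℕ) → ℝ≥0∞} (hf : Measurable f) :
    Measurable fun ω => ∫⁻ z, f (ω, z) ∂(T.refMeasure ω) := by
  have e : ∀ ω, ∫⁻ z, f (ω, z) ∂(T.refMeasure ω) = ∫⁻ z,
      {q : Noise A × (X × ℕ) | q.2 ∈ T.fiber q.1}.indicator f (ω, z)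
        ∂(T.baseMeasure.prod Measure.count) := fun ω => by
    rw [refMeasure_eq, ← lintegral_indicator (measurableSet_fiber ω)]
    rfl
  simp_rw [e]
  exact (hf.indicator measurableSet_fiberTotal).lintegral_prod_right'

lemma lintegral_totalMeasure {f : Noise A × (X × ℕ) → ℝ≥0∞} (hf : Measurable f) :
    ∫⁻ q, f q ∂T.totalMeasure =
      ∫⁻ ω, ∫⁻ z, f (ω, z) ∂(T.refMeasure ω) ∂(noiseMeasure p) := by
  rw [totalMeasure, ← lintegral_indicator measurableSet_fiberTotal,
    lintegral_prod _ (hf.indicator measurableSet_fiberTotal).aemeasurable]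
  congr 1
  funext ω
  rw [refMeasure_eq, ← lintegral_indicator (measurableSet_fiber ω)]
  rfl

lemma totalMeasure_apply {S : Set (Noise A × (X × ℕ))} (hS : MeasurableSet S) :
    T.totalMeasure S = ∫⁻ ω, T.refMeasure ω (Prod.mk ω ⁻¹' S) ∂(noiseMeasure p) := by
  rw [← lintegral_indicator_one hS, lintegral_totalMeasure (measurable_one.indicator hS)]
  congr 1
  funext ω
  rw [← lintegral_indicator_one (hS.preimage measurable_prodMk_left)]
  rfl

lemma isFiniteMeasure_totalMeasure (hFin : T.FiniteMass) : IsFiniteMeasure T.totalMeasure := by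
  obtain ⟨M, -, hM⟩ := hFin
  refine ⟨?_⟩
  rw [totalMeasure_apply MeasurableSet.univ]
  calc ∫⁻ ω, T.refMeasure ω (Prod.mk ω ⁻¹' Set.univ) ∂(noiseMeasure p)
      ≤ ∫⁻ _, ENNReal.ofReal M ∂(noiseMeasure p) := lintegral_mono_ae (by simpa using hM)
    _ < ∞ := by simp

lemma ae_ae_of_ae_totalMeasure {q : Noise A × (X × ℕ) → Prop} (h : ∀ᵐ y ∂T.totalMeasure, q y) :
    ∀ᵐ ω ∂(noiseMeasure p), ∀ᵐ z ∂(T.refMeasure ω), q (ω, z) := by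
  rw [totalMeasure, ae_restrict_iff' measurableSet_fiberTotal] at h
  filter_upwards [Measure.ae_ae_of_ae_prod h] with ω hω
  rw [refMeasure_eq, ae_restrict_iff' (measurableSet_fiber ω)]
  exact hω

lemma ae_totalMeasure_of_ae_ae {q : Noise A × (X × ℕ) → Prop} (hq : MeasurableSet {y | q y})
    (h : ∀ᵐ ω ∂(noiseMeasure p), ∀ᵐ z ∂(T.refMeasure ω), q (ω, z)) :
    ∀ᵐ y ∂T.totalMeasure, q y := by
  rw [ae_iff, show {a | ¬ q a} = {y | q y}ᶜ from rfl, totalMeasure_apply hq.compl]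
  exact (lintegral_eq_zero_iff (measurable_refMeasure_apply hq.compl)).2 h

/-! ### Transport of the base measure by the skew product -/

/-- The `n`-th iterate of the skew product on the fibred tower. -/
def skew (T : RandomTower p m) (n : ℕ) (q : Noise A × (X × ℕ)) : Noise A × (X × ℕ) :=
  (shift n q.1, T.towerIter q.1 n q.2)

lemma measurable_skew (n : ℕ) : Measurable (T.skew n) :=
  ((measurable_shift _).comp measurable_fst).prodMk (measurable_towerIter_uncurry n)

lemma skew_add (k n : ℕ) (q : Noise A × (X × ℕ)) : T.skew k (T.skew n q) = T.skew (n + k) q := by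
  simp only [skew, towerIter_add, shift_shift]
  push_cast
  rw [add_comm (n : ℤ)]

/-- The measure on the tower over `ω` obtained from `m` on the base over `σ^{-n} ω` after `n`
steps. -/
def pulledMeasure (T : RandomTower p m) (n : ℕ) (ω : Noise A) : Measure (X × ℕ) :=
  T.baseLevelMeasure.map (T.towerIter (shift (-(n : ℤ)) ω) n)

/-- The image of the base measure under the `n`-th iterate of the skew product. -/
def pushedMeasure (T : RandomTower p m) (n : ℕ) : Measure (Noise A × (X × ℕ)) :=
  ((noiseMeasure p).prod T.baseLevelMeasure).map (T.skew n)

instance (n : ℕ) : IsProbabilityMeasure (T.pushedMeasure n) :=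
  Measure.isProbabilityMeasure_map (measurable_skew n).aemeasurable

lemma measurable_pulledMeasure (n : ℕ) {S : Set (Noise A × (X × ℕ))} (hS : MeasurableSet S) :
    Measurable fun ω => T.pulledMeasure n ω (Prod.mk ω ⁻¹' S) := by
  have hm : Measurable fun q : Noise A × (X × ℕ) =>
      (q.1, T.towerIter (shift (-(n : ℤ)) q.1) n q.2) :=
    measurable_fst.prodMk ((measurable_towerIter_uncurry n).comp
      (((measurable_shift _).comp measurable_fst).prodMk measurable_snd))
  have e : ∀ ω, T.pulledMeasure n ω (Prod.mk ω ⁻¹' S) = T.baseLevelMeasure (Prod.mk ω ⁻¹'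
      ((fun q : Noise A × (X × ℕ) => (q.1, T.towerIter (shift (-(n : ℤ)) q.1) n q.2)) ⁻¹' S)) :=
    fun ω => by
      rw [pulledMeasure, Measure.map_apply (measurable_towerIter _ _)
        (hS.preimage measurable_prodMk_left)]
      rfl
  simp_rw [e]
  exact measurable_measure_prodMk_left (hm hS)

lemma pushedMeasure_apply (n : ℕ) {S : Set (Noise A × (X × ℕ))} (hS : MeasurableSet S) :
    T.pushedMeasure n S = ∫⁻ ω, T.pulledMeasure n ω (Prod.mk ω ⁻¹' S) ∂(noiseMeasure p) := by
  rw [pushedMeasure, Measure.map_apply (measurable_skew n) hS,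
    Measure.prod_apply (measurable_skew n hS),
    ← (measurePreserving_shift p n).lintegral_comp (measurable_pulledMeasure n hS)]
  congr 1
  funext ω
  rw [pulledMeasure, Measure.map_apply (measurable_towerIter _ _)
    (hS.preimage measurable_prodMk_left), shift_shift]
  simp only [neg_add_cancel, shift_zero]
  rfl

lemma pushedMeasure_succ_apply (n : ℕ) {S : Set (Noise A × (X × ℕ))} (hS : MeasurableSet S) :
    T.pushedMeasure n (T.skew 1 ⁻¹' S) = T.pushedMeasure (n + 1) S := by
  rw [pushedMeasure, pushedMeasure, Measure.map_apply (measurable_skew n) (measurable_skew 1 hS),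
    Measure.map_apply (measurable_skew _) hS]
  congr 1
  ext q
  simp only [Set.mem_preimage, skew_add]

lemma Good.regular_pulledMeasure (h : T.Good D γ ω) (h0 : 0 ≤ γ) (h1 : γ ≤ 1) (hc : 0 ≤ c)
    (hcD : c * γ + D = c) (n : ℕ) : T.Regular γ c ω (T.pulledMeasure n ω) := by
  have := (h.along (-(n : ℤ))).regular_iter h0 h1 hc hcD n
  simpa [pulledMeasure] using this

end Total

end RandomTower
end RandomTowers

namespace RandomTowers
namespace RandomTower

variable {A X : Type*} [MeasurableSpace A] [MeasurableSpace X]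
  {p : Measure A} [IsProbabilityMeasure p] {m : Measure X} {T : RandomTower p m}
  {D γ c : ℝ} {ω : Noise A}

/-! ### Densities on the fibred tower -/

/-- The measure on the tower over `ω` whose density is the restriction of `G` to that fibre. -/
def fibreMeasure (T : RandomTower p m) (G : Noise A × (X × ℕ) → ℝ≥0∞) (ω : Noise A) :
    Measure (X × ℕ) :=
  (T.refMeasure ω).withDensity fun z => G (ω, z)

lemma fibreMeasure_apply {G : Noise A × (X × ℕ) → ℝ≥0∞} {S : Set (Noise A × (X × ℕ))}
    (hS : MeasurableSet S) (ω : Noise A) : T.fibreMeasure G ω (Prod.mk ω ⁻¹' S) =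
      ∫⁻ z, S.indicator G (ω, z) ∂(T.refMeasure ω) := by
  have hS' := hS.preimage (measurable_prodMk_left (x := ω))
  rw [fibreMeasure, withDensity_apply _ hS', ← lintegral_indicator hS']
  rfl

lemma measurable_fibreMeasure {G : Noise A × (X × ℕ) → ℝ≥0∞} (hG : Measurable G)
    {S : Set (Noise A × (X × ℕ))} (hS : MeasurableSet S) :
    Measurable fun ω => T.fibreMeasure G ω (Prod.mk ω ⁻¹' S) := by
  simp_rw [fibreMeasure_apply hS]
  exact measurable_lintegral_refMeasure (hG.indicator hS)

lemma withDensity_totalMeasure_apply {G : Noise A × (X × ℕ) → ℝ≥0∞} (hG : Measurable G)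
    {S : Set (Noise A × (X × ℕ))} (hS : MeasurableSet S) : T.totalMeasure.withDensity G S =
      ∫⁻ ω, T.fibreMeasure G ω (Prod.mk ω ⁻¹' S) ∂(noiseMeasure p) := by
  simp_rw [fibreMeasure_apply hS]
  rw [withDensity_apply _ hS, ← lintegral_indicator hS, lintegral_totalMeasure (hG.indicator hS)]

lemma refMeasure_compl_base (ω : Noise A) : T.refMeasure ω (T.base ×ˢ Set.univ)ᶜ = 0 :=
  measure_mono_null (Set.compl_subset_compl.2 fun _ hz => ⟨hz.1, trivial⟩)
    (refMeasure_compl_fiber ω)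

lemma fibreMeasure_compl_base (G : Noise A × (X × ℕ) → ℝ≥0∞) (ω : Noise A) :
    T.fibreMeasure G ω (T.base ×ˢ Set.univ)ᶜ = 0 :=
  withDensity_absolutelyContinuous _ _ (refMeasure_compl_base ω)

/-- Uniqueness of disintegrations: a family of measures on the tower is determined almost everywhere
by its integrals over measurable sets of noises. -/
lemma ae_eq_of_forall_lintegral {X : Type*} [MetricSpace X] [MeasurableSpace X] [BorelSpace X]
    {m : Measure X} {T : RandomTower p m} (hsep : TopologicalSpace.IsSeparable T.base)
    {κ η : Noise A → Measure (X × ℕ)} (hfin : ∀ᵐ ω ∂(noiseMeasure p), κ ω Set.univ < ∞)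
    (hκ : ∀ᵐ ω ∂(noiseMeasure p), κ ω (T.base ×ˢ Set.univ)ᶜ = 0)
    (hη : ∀ᵐ ω ∂(noiseMeasure p), η ω (T.base ×ˢ Set.univ)ᶜ = 0)
    (hκm : ∀ B, MeasurableSet B → Measurable fun ω => κ ω B)
    (hηm : ∀ B, MeasurableSet B → Measurable fun ω => η ω B)
    (h : ∀ S, MeasurableSet S → ∀ B, MeasurableSet B →
      ∫⁻ ω in S, κ ω B ∂(noiseMeasure p) = ∫⁻ ω in S, η ω B ∂(noiseMeasure p)) :
    ∀ᵐ ω ∂(noiseMeasure p), κ ω = η ω :=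
  ae_eq_of_forall_tower hsep hfin hκ hη fun B hB =>
    ae_eq_of_forall_setLIntegral_eq_of_sigmaFinite (hκm B hB) (hηm B hB) fun S hS _ => h S hS B hB

lemma setLIntegral_eq_lintegral_prod (κ : Noise A → Measure (X × ℕ)) {S : Set (Noise A)}
    (hS : MeasurableSet S) (B : Set (X × ℕ)) : ∫⁻ ω in S, κ ω B ∂(noiseMeasure p) =
      ∫⁻ ω, κ ω (Prod.mk ω ⁻¹' S ×ˢ B) ∂(noiseMeasure p) := by
  classical
  rw [← lintegral_indicator hS]
  congr 1
  funext ω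
  rw [Set.mk_preimage_prod_right_eq_if]
  by_cases hω : ω ∈ S <;> simp [hω]

/-- A random function is fibrewise regular when, over almost every noise and off a null set, it is
bounded between `0` and `e ^ c` and its logarithm oscillates by at most `c γ ^ s` on partition
elements. This is the property of regular densities that survives limits in `L²`. -/
def FibrewiseRegular (T : RandomTower p m) (γ c : ℝ) (g : Noise A × (X × ℕ) → ℝ) : Prop :=
  ∀ᵐ ω ∂(noiseMeasure p), ∃ N, T.refMeasure ω N = 0 ∧
    (∀ z ∈ T.fiber ω, z ∉ N → 0 ≤ g (ω, z) ∧ g (ω, z) ≤ Real.exp c) ∧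
    ∀ z w, z ∉ N → w ∉ N → T.SamePiece (ω, z) (ω, w) →
      g (ω, z) ≤ Real.exp (c * powTop γ (T.sep (ω, z) (ω, w))) * g (ω, w)

lemma FibrewiseRegular.of_tendsto {f : ℕ → Noise A × (X × ℕ) → ℝ} {g : Noise A × (X × ℕ) → ℝ}
    (hf : ∀ n, T.FibrewiseRegular γ c (f n))
    (hlim : ∀ᵐ q ∂T.totalMeasure, Tendsto (fun n => f n q) atTop (𝓝 (g q))) :
    T.FibrewiseRegular γ c g := by
  filter_upwards [ae_all_iff.2 hf, ae_ae_of_ae_totalMeasure hlim] with ω h1 h2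
  choose N hN hb hp using h1
  have hlim' : ∀ z, z ∉ {z | ¬ Tendsto (fun n => f n (ω, z)) atTop (𝓝 (g (ω, z)))} →
      Tendsto (fun n => f n (ω, z)) atTop (𝓝 (g (ω, z))) := fun z hz => not_not.1 hz
  refine ⟨(⋃ n, N n) ∪ {z | ¬ Tendsto (fun n => f n (ω, z)) atTop (𝓝 (g (ω, z)))}, ?_, ?_, ?_⟩
  · exact measure_union_null (measure_iUnion_null hN) h2
  · intro z hz hzN
    rw [Set.mem_union, not_or, Set.mem_iUnion, not_exists] at hzN
    exact ⟨ge_of_tendsto' (hlim' z hzN.2) fun n => (hb n z hz (hzN.1 n)).1,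
      le_of_tendsto' (hlim' z hzN.2) fun n => (hb n z hz (hzN.1 n)).2⟩
  · intro z w hzN hwN hs
    rw [Set.mem_union, not_or, Set.mem_iUnion, not_exists] at hzN hwN
    exact le_of_tendsto_of_tendsto' (hlim' z hzN.2) ((hlim' w hwN.2).const_mul _) fun n =>
      hp n z w (hzN.1 n) (hwN.1 n) hs

lemma FibrewiseRegular.congr {f g : Noise A × (X × ℕ) → ℝ} (hf : T.FibrewiseRegular γ c f)
    (hfg : f =ᵐ[T.totalMeasure] g) : T.FibrewiseRegular γ c g := by
  refine FibrewiseRegular.of_tendsto (f := fun _ => f) (fun _ => hf) ?_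
  filter_upwards [hfg] with q hq
  rw [hq]
  exact tendsto_const_nhds

lemma FibrewiseRegular.convex_comb {f g : Noise A × (X × ℕ) → ℝ} (hf : T.FibrewiseRegular γ c f)
    (hg : T.FibrewiseRegular γ c g) {a b : ℝ} (ha : 0 ≤ a) (hb : 0 ≤ b) (hab : a + b = 1) :
    T.FibrewiseRegular γ c fun q => a * f q + b * g q := by
  filter_upwards [hf, hg] with ω ⟨N, hN, hNb, hNp⟩ ⟨N', hN', hNb', hNp'⟩
  refine ⟨N ∪ N', measure_union_null hN hN', ?_, ?_⟩
  · intro z hz hzN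
    rw [Set.mem_union, not_or] at hzN
    obtain ⟨h1, h2⟩ := hNb z hz hzN.1
    obtain ⟨h3, h4⟩ := hNb' z hz hzN.2
    refine ⟨by positivity, ?_⟩
    calc a * f (ω, z) + b * g (ω, z) ≤ a * Real.exp c + b * Real.exp c := by gcongr
      _ = Real.exp c := by rw [← add_mul, hab, one_mul]
  · intro z w hz hw hs
    rw [Set.mem_union, not_or] at hz hw
    have h1 := hNp z w hz.1 hw.1 hs
    have h2 := hNp' z w hz.2 hw.2 hs
    rw [mul_add]
    nlinarith [mul_le_mul_of_nonneg_left h1 ha, mul_le_mul_of_nonneg_left h2 hb]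

lemma FibrewiseRegular.ae_mem_Icc {g : Noise A × (X × ℕ) → ℝ} (hg : T.FibrewiseRegular γ c g)
    (hm : Measurable g) : ∀ᵐ q ∂T.totalMeasure, g q ∈ Set.Icc 0 (Real.exp c) := by
  refine ae_totalMeasure_of_ae_ae (hm measurableSet_Icc) ?_
  filter_upwards [hg] with ω ⟨N, hN, hNb, _⟩
  filter_upwards [compl_mem_ae_iff.2 (refMeasure_compl_fiber (T := T) ω),
    compl_mem_ae_iff.2 hN] with z hz hzN
  exact hNb z (by simpa using hz) hzN

/-! ### Almost invariant densities -/

/-- The fibrewise regular densities of families of probability measures that are invariant up to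
`1 / (n + 1)` under the skew product. The second condition says that the fibres have mass one. -/
def almostInvariant (T : RandomTower p m) (γ c : ℝ) (n : ℕ) : Set (Lp ℝ 2 T.totalMeasure) :=
  {g | T.FibrewiseRegular γ c g ∧
    (∀ S, MeasurableSet S →
      ∫ q in Prod.fst ⁻¹' S, g q ∂T.totalMeasure = (noiseMeasure p).real S) ∧
    ∀ S, MeasurableSet S →
      |∫ q in T.skew 1 ⁻¹' S, g q ∂T.totalMeasure - ∫ q in S, g q ∂T.totalMeasure| ≤
        1 / ((n : ℝ) + 1)}

/-- Integration over a measurable set, as a continuous linear functional on `L²`. -/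
def setIntegralL2 {α : Type*} [MeasurableSpace α] (μ : Measure α) [IsFiniteMeasure μ] {S : Set α}
    (hS : MeasurableSet S) : Lp ℝ 2 μ →L[ℝ] ℝ :=
  innerSL ℝ (indicatorConstLp 2 hS (measure_ne_top μ S) (1 : ℝ))

lemma setIntegralL2_apply {α : Type*} [MeasurableSpace α] (μ : Measure α) [IsFiniteMeasure μ]
    {S : Set α} (hS : MeasurableSet S) (g : Lp ℝ 2 μ) :
    setIntegralL2 μ hS g = ∫ q in S, g q ∂μ := by
  rw [setIntegralL2, innerSL_apply_apply, L2.inner_indicatorConstLp_one]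

lemma antitone_almostInvariant : Antitone (T.almostInvariant γ c) := by
  rintro n k hnk g ⟨h1, h2, h3⟩
  refine ⟨h1, h2, fun S hS => (h3 S hS).trans ?_⟩
  gcongr

lemma convex_fibrewiseRegular :
    Convex ℝ {g : Lp ℝ 2 T.totalMeasure | T.FibrewiseRegular γ c g} := by
  intro f hf g hg a b ha hb hab
  refine (FibrewiseRegular.convex_comb hf hg ha hb hab).congr ?_
  filter_upwards [Lp.coeFn_add (a • f) (b • g), Lp.coeFn_smul a f, Lp.coeFn_smul b g]
    with q h1 h2 h3
  rw [h1, Pi.add_apply, h2, h3]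
  rfl

lemma convex_almostInvariant (hFin : T.FiniteMass) (n : ℕ) :
    Convex ℝ (T.almostInvariant γ c n) := by
  have := isFiniteMeasure_totalMeasure hFin
  intro f hf g hg a b ha hb hab
  refine ⟨convex_fibrewiseRegular hf.1 hg.1 ha hb hab, fun S hS => ?_, fun S hS => ?_⟩
  · have h1 := hf.2.1 S hS
    have h2 := hg.2.1 S hS
    rw [← setIntegralL2_apply _ (hS.preimage measurable_fst)] at h1 h2 ⊢
    rw [map_add, map_smul, map_smul, h1, h2, ← add_smul, hab, one_smul]
  · have h1 := hf.2.2 S hS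
    have h2 := hg.2.2 S hS
    rw [← setIntegralL2_apply _ (measurable_skew 1 hS), ← setIntegralL2_apply _ hS] at h1 h2 ⊢
    simp only [map_add, map_smul, smul_eq_mul]
    rw [abs_le] at h1 h2 ⊢
    constructor
    · nlinarith [mul_le_mul_of_nonneg_left h1.1 ha, mul_le_mul_of_nonneg_left h2.1 hb]
    · nlinarith [mul_le_mul_of_nonneg_left h1.2 ha, mul_le_mul_of_nonneg_left h2.2 hb]

lemma isClosed_almostInvariant (hFin : T.FiniteMass) (n : ℕ) :
    IsClosed (T.almostInvariant γ c n) := by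
  have := isFiniteMeasure_totalMeasure hFin
  refine IsSeqClosed.isClosed fun f g hf hlim => ⟨?_, fun S hS => ?_, fun S hS => ?_⟩
  · obtain ⟨ns, -, hns⟩ := (tendstoInMeasure_of_tendsto_Lp hlim).exists_seq_tendsto_ae
    exact FibrewiseRegular.of_tendsto (fun k => (hf (ns k)).1) hns
  · have h1 := fun k => (hf k).2.1 S hS
    simp_rw [← setIntegralL2_apply _ (hS.preimage measurable_fst)] at h1 ⊢
    have h2 := ((setIntegralL2 T.totalMeasure (hS.preimage measurable_fst)).continuous.tendsto
      g).comp hlim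
    refine tendsto_nhds_unique h2 (tendsto_const_nhds.congr fun k => (h1 k).symm)
  · have h1 := fun k => (hf k).2.2 S hS
    simp_rw [← setIntegralL2_apply _ (measurable_skew 1 hS), ← setIntegralL2_apply _ hS] at h1 ⊢
    have h2 := ((setIntegralL2 T.totalMeasure
      (measurable_skew (T := T) 1 hS)).continuous.tendsto g).comp hlim
    have h3 := ((setIntegralL2 T.totalMeasure hS).continuous.tendsto g).comp hlim
    exact le_of_tendsto' (h2.sub h3).abs h1

lemma norm_le_of_fibrewiseRegular (hFin : T.FiniteMass) :
    ∃ M : ℝ, ∀ g : Lp ℝ 2 T.totalMeasure, T.FibrewiseRegular γ c g → ‖g‖ ≤ M := by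
  have := isFiniteMeasure_totalMeasure hFin
  refine ⟨(measureUnivNNReal T.totalMeasure : ℝ) ^ (2 : ℝ≥0∞).toReal⁻¹ * Real.exp c,
    fun g hg => Lp.norm_le_of_ae_bound (Real.exp_pos c).le ?_⟩
  filter_upwards [hg.ae_mem_Icc (Lp.stronglyMeasurable g).measurable] with q hq
  rw [Real.norm_of_nonneg hq.1]
  exact hq.2

lemma pushedMeasure_fst (n : ℕ) {S : Set (Noise A)} (hS : MeasurableSet S) :
    T.pushedMeasure n (Prod.fst ⁻¹' S) = noiseMeasure p S := by
  rw [pushedMeasure, Measure.map_apply (measurable_skew n) (hS.preimage measurable_fst)]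
  have : T.skew n ⁻¹' (Prod.fst ⁻¹' S) = (shift n ⁻¹' S) ×ˢ Set.univ := by
    ext q; simp [skew]
  rw [this, Measure.prod_prod, measure_univ, mul_one,
    (measurePreserving_shift p n).measure_preimage hS.nullMeasurableSet]

lemma pushedMeasure_absolutelyContinuous (hgood : ∀ᵐ ω ∂(noiseMeasure p), T.Good D γ ω)
    (h0 : 0 ≤ γ) (h1 : γ ≤ 1) (hc : 0 ≤ c) (hcD : c * γ + D = c) (n : ℕ) :
    T.pushedMeasure n ≪ T.totalMeasure := by
  refine Measure.AbsolutelyContinuous.mk fun S hS h => ?_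
  rw [totalMeasure_apply hS, lintegral_eq_zero_iff (measurable_refMeasure_apply hS)] at h
  rw [pushedMeasure_apply n hS, lintegral_eq_zero_iff (measurable_pulledMeasure n hS)]
  filter_upwards [h, hgood] with ω hω hg
  obtain ⟨-, g, -, he, -⟩ := hg.regular_pulledMeasure h0 h1 hc hcD n
  rw [he]
  exact withDensity_absolutelyContinuous _ _ hω

end RandomTower

namespace RandomTower

variable {A X : Type*} [MeasurableSpace A] [MetricSpace X] [MeasurableSpace X] [BorelSpace X]
  {p : Measure A} [IsProbabilityMeasure p] {m : Measure X} {T : RandomTower p m}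
  {D γ c : ℝ} {ω : Noise A}

/-! ### Existence of an invariant density -/

/-- Over almost every noise, the Radon–Nikodym derivative on the fibred tower restricts to the
density on the fibre. -/
lemma ae_fibreMeasure_rnDeriv (hgood : ∀ᵐ ω ∂(noiseMeasure p), T.Good D γ ω)
    (hsep : TopologicalSpace.IsSeparable T.base) (hFin : T.FiniteMass)
    (h0 : 0 ≤ γ) (h1 : γ ≤ 1) (hc : 0 ≤ c) (hcD : c * γ + D = c) (n : ℕ) :
    ∀ᵐ ω ∂(noiseMeasure p), T.pulledMeasure n ω =
      T.fibreMeasure ((T.pushedMeasure n).rnDeriv T.totalMeasure) ω := by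
  have := isFiniteMeasure_totalMeasure hFin
  have hrn := Measure.measurable_rnDeriv (T.pushedMeasure n) T.totalMeasure
  have hreg : ∀ᵐ ω ∂(noiseMeasure p), T.Regular γ c ω (T.pulledMeasure n ω) :=
    hgood.mono fun ω h => h.regular_pulledMeasure h0 h1 hc hcD n
  refine ae_eq_of_forall_lintegral hsep ?_ ?_ (ae_of_all _ (fibreMeasure_compl_base _)) ?_ ?_ ?_
  · filter_upwards [hreg] with ω h
    rw [h.1]; simp
  · filter_upwards [hreg] with ω h
    obtain ⟨-, g, -, he, -⟩ := h
    rw [he]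
    exact withDensity_absolutelyContinuous _ _ (refMeasure_compl_base ω)
  · intro B hB
    exact measurable_pulledMeasure n (S := Prod.snd ⁻¹' B) (hB.preimage measurable_snd)
  · intro B hB
    exact measurable_fibreMeasure hrn (S := Prod.snd ⁻¹' B) (hB.preimage measurable_snd)
  · intro S hS B hB
    rw [setLIntegral_eq_lintegral_prod _ hS, setLIntegral_eq_lintegral_prod _ hS,
      ← pushedMeasure_apply n (hS.prod hB), ← withDensity_totalMeasure_apply hrn (hS.prod hB),
      Measure.withDensity_rnDeriv_eq _ _
        (pushedMeasure_absolutelyContinuous hgood h0 h1 hc hcD n)]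

lemma fibrewiseRegular_rnDeriv (hgood : ∀ᵐ ω ∂(noiseMeasure p), T.Good D γ ω)
    (hsep : TopologicalSpace.IsSeparable T.base) (hFin : T.FiniteMass)
    (h0 : 0 ≤ γ) (h1 : γ ≤ 1) (hc : 0 ≤ c) (hcD : c * γ + D = c) (n : ℕ) :
    T.FibrewiseRegular γ c fun q => ((T.pushedMeasure n).rnDeriv T.totalMeasure q).toReal := by
  have hrn := Measure.measurable_rnDeriv (T.pushedMeasure n) T.totalMeasure
  filter_upwards [hgood, ae_fibreMeasure_rnDeriv hgood hsep hFin h0 h1 hc hcD n] with ω hg he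
  obtain ⟨hone, g, hgm, he', hb, hp, -⟩ := hg.regular_pulledMeasure h0 h1 hc hcD n
  have hae : g =ᵐ[T.refMeasure ω]
      fun z => (T.pushedMeasure n).rnDeriv T.totalMeasure (ω, z) := by
    rw [← withDensity_eq_iff
      (g := fun z => (T.pushedMeasure n).rnDeriv T.totalMeasure (ω, z)) hgm.aemeasurable
      (hrn.comp measurable_prodMk_left).aemeasurable,
      ← he', he]
    · rfl
    · rw [← setLIntegral_univ, ← withDensity_apply _ MeasurableSet.univ, ← he', hone]
      simp
  refine ⟨{z | g z ≠ (T.pushedMeasure n).rnDeriv T.totalMeasure (ω, z)}, hae, ?_, ?_⟩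
  · intro z hz hzN
    have hzN' : g z = (T.pushedMeasure n).rnDeriv T.totalMeasure (ω, z) := not_not.1 hzN
    refine ⟨ENNReal.toReal_nonneg, ?_⟩
    rw [← hzN']
    exact ENNReal.toReal_le_of_le_ofReal (Real.exp_pos _).le (hb z hz)
  · intro z w hz hw hs
    have hz' : g z = (T.pushedMeasure n).rnDeriv T.totalMeasure (ω, z) := not_not.1 hz
    have hw' : g w = (T.pushedMeasure n).rnDeriv T.totalMeasure (ω, w) := not_not.1 hw
    rw [← hz', ← hw']
    have hwfin : g w ≠ ∞ := ne_top_of_le_ne_top (by simp)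
      (hb w (SamePiece.mem_fiber_left hg (samePiece_comm.1 hs)))
    have := ENNReal.toReal_mono (ENNReal.mul_ne_top (by simp [wt]) hwfin) (hp z w hs)
    rwa [wt, ENNReal.toReal_mul, ENNReal.toReal_ofReal (Real.exp_pos _).le] at this

/-- Cesàro averages of the transported base measure are almost invariant. -/
lemma nonempty_almostInvariant (hgood : ∀ᵐ ω ∂(noiseMeasure p), T.Good D γ ω)
    (hsep : TopologicalSpace.IsSeparable T.base) (hFin : T.FiniteMass)
    (h0 : 0 ≤ γ) (h1 : γ ≤ 1) (hc : 0 ≤ c) (hcD : c * γ + D = c) (n : ℕ) :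
    (T.almostInvariant γ c n).Nonempty := by
  have := isFiniteMeasure_totalMeasure hFin
  have hreg := fibrewiseRegular_rnDeriv hgood hsep hFin h0 h1 hc hcD
  have hmem : ∀ k, MemLp (fun q => ((T.pushedMeasure k).rnDeriv T.totalMeasure q).toReal) 2
      T.totalMeasure := fun k => by
    refine MemLp.of_bound (Measure.measurable_rnDeriv _ _).ennreal_toReal.aestronglyMeasurable
      (Real.exp c) ?_
    filter_upwards [(hreg k).ae_mem_Icc (Measure.measurable_rnDeriv _ _).ennreal_toReal] with q hq
    rw [Real.norm_of_nonneg hq.1]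
    exact hq.2
  set F : ℕ → Lp ℝ 2 T.totalMeasure := fun k => (hmem k).toLp with hF
  have hFreg : ∀ k, T.FibrewiseRegular γ c (F k) := fun k =>
    (hreg k).congr (hmem k).coeFn_toLp.symm
  have hFint : ∀ k S, ∀ hS : MeasurableSet S,
      setIntegralL2 T.totalMeasure hS (F k) = (T.pushedMeasure k).real S := by
    intro k S hS
    rw [setIntegralL2_apply, ← Measure.setIntegral_toReal_rnDeriv
      (pushedMeasure_absolutelyContinuous hgood h0 h1 hc hcD k)]
    exact integral_congr_ae (ae_restrict_of_ae (hmem k).coeFn_toLp)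
  have hn : (0 : ℝ) < (n : ℝ) + 1 := by positivity
  refine ⟨∑ k ∈ Finset.range (n + 1), (1 / ((n : ℝ) + 1)) • F k, ?_, fun S hS => ?_,
    fun S hS => ?_⟩
  · refine convex_fibrewiseRegular.sum_mem (fun _ _ => by positivity) ?_ fun k _ => hFreg k
    rw [Finset.sum_const, Finset.card_range, nsmul_eq_mul]
    push_cast
    field_simp
  · rw [← setIntegralL2_apply _ (hS.preimage measurable_fst), map_sum]
    simp only [map_smul, hFint, measureReal_def, pushedMeasure_fst _ hS, smul_eq_mul]
    rw [Finset.sum_const, Finset.card_range, nsmul_eq_mul]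
    push_cast
    field_simp
  · rw [← setIntegralL2_apply _ (measurable_skew 1 hS), ← setIntegralL2_apply _ hS, map_sum,
      map_sum, ← Finset.sum_sub_distrib]
    simp only [map_smul, hFint, measureReal_def, pushedMeasure_succ_apply _ hS, smul_eq_mul,
      ← mul_sub]
    rw [← Finset.mul_sum, Finset.sum_range_sub fun k => (T.pushedMeasure k S).toReal, abs_mul,
      abs_of_pos (by positivity)]
    refine mul_le_of_le_one_right (by positivity) ?_
    have hb : ∀ k, (T.pushedMeasure k S).toReal ≤ 1 := fun k => measureReal_le_one
    rw [abs_le]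
    constructor <;> nlinarith [hb (n + 1), hb 0,
      ENNReal.toReal_nonneg (a := T.pushedMeasure (n + 1) S),
      ENNReal.toReal_nonneg (a := T.pushedMeasure 0 S)]

/-- There is a measurable family of fibrewise regular densities of probability measures that the
tower maps permute. -/
lemma exists_invariant_density (hgood : ∀ᵐ ω ∂(noiseMeasure p), T.Good D γ ω)
    (hsep : TopologicalSpace.IsSeparable T.base) (hFin : T.FiniteMass)
    (h0 : 0 ≤ γ) (h1 : γ ≤ 1) (hc : 0 ≤ c) (hcD : c * γ + D = c) :
    ∃ g : Noise A × (X × ℕ) → ℝ, Measurable g ∧ T.FibrewiseRegular γ c g ∧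
      (∀ᵐ ω ∂(noiseMeasure p),
        T.fibreMeasure (fun q => ENNReal.ofReal (g q)) ω Set.univ = 1) ∧
      ∀ᵐ ω ∂(noiseMeasure p),
        (T.fibreMeasure (fun q => ENNReal.ofReal (g q)) ω).map (T.towerMap ω) =
          T.fibreMeasure (fun q => ENNReal.ofReal (g q)) (shift 1 ω) := by
  have := isFiniteMeasure_totalMeasure hFin
  obtain ⟨M, hM⟩ := norm_le_of_fibrewiseRegular (γ := γ) (c := c) hFin
  obtain ⟨g, hg⟩ := nonempty_iInter_of_convex (antitone_almostInvariant (T := T) (γ := γ) (c := c))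
    (nonempty_almostInvariant hgood hsep hFin h0 h1 hc hcD) (isClosed_almostInvariant hFin)
    (convex_almostInvariant hFin) (fun x hx => hM x hx.1)
  rw [Set.mem_iInter] at hg
  have hgm : Measurable g := (Lp.stronglyMeasurable g).measurable
  have hGm : Measurable fun q => ENNReal.ofReal (g q) := hgm.ennreal_ofReal
  have hgi : Integrable g T.totalMeasure := (Lp.memLp g).integrable (by norm_num)
  have hreg := (hg 0).1
  have hpos : 0 ≤ᵐ[T.totalMeasure] g := (hreg.ae_mem_Icc hgm).mono fun q hq => hq.1
  set G : Noise A × (X × ℕ) → ℝ≥0∞ := fun q => ENNReal.ofReal (g q) with hG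
  have hint : ∀ S, MeasurableSet S →
      T.totalMeasure.withDensity G S = ENNReal.ofReal (∫ q in S, g q ∂T.totalMeasure) := by
    intro S hS
    rw [withDensity_apply _ hS, ofReal_integral_eq_lintegral_ofReal hgi.integrableOn
      (ae_restrict_of_ae hpos)]
  have hinv : ∀ S, MeasurableSet S → T.totalMeasure.withDensity G (T.skew 1 ⁻¹' S) =
      T.totalMeasure.withDensity G S := by
    intro S hS
    rw [hint _ (measurable_skew 1 hS), hint S hS]
    congr 1
    have hle : |∫ q in T.skew 1 ⁻¹' S, g q ∂T.totalMeasure - ∫ q in S, g q ∂T.totalMeasure| ≤ 0 :=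
      ge_of_tendsto' tendsto_one_div_add_atTop_nhds_zero_nat fun n => (hg n).2.2 S hS
    exact sub_eq_zero.1 (abs_nonpos_iff.1 hle)
  have hfm : ∀ B, MeasurableSet B → Measurable fun ω => T.fibreMeasure G ω B := fun B hB =>
    measurable_fibreMeasure hGm (S := Prod.snd ⁻¹' B) (hB.preimage measurable_snd)
  have hmass : ∀ᵐ ω ∂(noiseMeasure p), T.fibreMeasure G ω Set.univ = 1 := by
    refine ae_eq_of_forall_setLIntegral_eq_of_sigmaFinite (hfm _ MeasurableSet.univ)
      measurable_const fun S hS _ => ?_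
    rw [setLIntegral_eq_lintegral_prod _ hS,
      ← withDensity_totalMeasure_apply hGm (hS.prod MeasurableSet.univ),
      hint _ (hS.prod MeasurableSet.univ), Set.prod_univ, (hg 0).2.1 S hS, setLIntegral_one,
      ofReal_measureReal]
  refine ⟨g, hgm, hreg, hmass, ?_⟩
  refine ae_eq_of_forall_lintegral hsep ?_ ?_ (ae_of_all _ fun ω => fibreMeasure_compl_base _ _)
    ?_ ?_ ?_
  · filter_upwards [hmass] with ω hω
    rw [Measure.map_apply (measurable_towerMap ω) MeasurableSet.univ, Set.preimage_univ, hω]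
    simp
  · filter_upwards [hgood] with ω hω
    rw [Measure.map_apply (measurable_towerMap ω)
      (T.measurableSet_base.prod MeasurableSet.univ).compl]
    have hsub : T.towerMap ω ⁻¹' (T.base ×ˢ Set.univ)ᶜ ⊆ (T.fiber ω)ᶜ := fun z hz hzf =>
      hz ⟨(hω.towerMap_mem_fiber hzf).1, trivial⟩
    exact withDensity_absolutelyContinuous _ _
      (measure_mono_null hsub (refMeasure_compl_fiber ω))
  · intro B hB
    have := measurable_fibreMeasure (T := T) hGm (measurable_towerMap_uncurry (T := T) hB)
    simp_rw [Measure.map_apply (measurable_towerMap _) hB]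
    exact this
  · intro B hB
    exact (hfm B hB).comp (measurable_shift 1)
  · intro S hS B hB
    -- compare the two families on the box `S × B`, moved by the shift
    set S' : Set (Noise A) := shift (-1) ⁻¹' S with hS'
    have hSS' : S = shift 1 ⁻¹' S' := by
      ext ω; simp [hS']
    have hS'm : MeasurableSet S' := hS.preimage (measurable_shift _)
    have e1 : ∫⁻ ω in S, (T.fibreMeasure G ω).map (T.towerMap ω) B ∂(noiseMeasure p) =
        ∫⁻ ω, T.fibreMeasure G ω (Prod.mk ω ⁻¹' (T.skew 1 ⁻¹' (S' ×ˢ B))) ∂(noiseMeasure p) := by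
      classical
      rw [← lintegral_indicator hS]
      congr 1
      funext ω
      have : Prod.mk ω ⁻¹' (T.skew 1 ⁻¹' (S' ×ˢ B)) =
          if ω ∈ S then T.towerMap ω ⁻¹' B else ∅ := by
        ext z
        by_cases hω : ω ∈ S <;> simp [skew, towerIter_one, hS', hω]
      rw [this]
      by_cases hω : ω ∈ S
      · simp [hω, Measure.map_apply (measurable_towerMap ω) hB]
      · simp [hω]
    rw [e1, ← withDensity_totalMeasure_apply hGm (measurable_skew 1 (hS'm.prod hB)),
      hinv _ (hS'm.prod hB), withDensity_totalMeasure_apply hGm (hS'm.prod hB),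
      ← setLIntegral_eq_lintegral_prod _ hS'm, hSS',
      ← (measurePreserving_shift p 1).setLIntegral_comp_preimage hS'm (hfm B hB)]

end RandomTower
end RandomTowers

namespace RandomTowers
namespace RandomTower

variable {A X : Type*} [MeasurableSpace A] [MeasurableSpace X]
  {p : Measure A} [IsProbabilityMeasure p] {m : Measure X} {T : RandomTower p m}
  {D γ c : ℝ} {ω : Noise A}

/-! ### Regular versions of almost everywhere regular functions -/

/-- A set that contains with each point a ball for the separation time is measurable, since it is a
countable union of cylinders. -/
lemma Good.measurableSet_of_sep (h : T.Good D γ ω) {S : Set (X × ℕ)}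
    (hS : ∀ z ∈ S, z ∈ T.fiber ω ∧
      ∃ n : ℕ, ∀ w, ((n + 1 : ℕ) : ℕ∞) ≤ T.sep (ω, z) (ω, w) → w ∈ S) : MeasurableSet S := by
  have hcover : S = ⋃ ℓ : ℕ, ⋃ n : ℕ,
      ⋃ Z ∈ {Z | Z ∈ T.cyl n (shift (-(ℓ : ℤ)) ω) ∧ Z ×ˢ {ℓ} ⊆ S}, Z ×ˢ {ℓ} := by
    refine Set.Subset.antisymm ?_ ?_
    · rintro ⟨x, ℓ⟩ hz
      obtain ⟨⟨hx, hR⟩, n, hn⟩ := hS _ hz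
      simp only at hx hR
      have h' := h.along (-(ℓ : ℤ))
      obtain ⟨Z, hZ, hxZ⟩ := h'.exists_cyl n x hx
      refine Set.mem_iUnion.2 ⟨ℓ, Set.mem_iUnion.2 ⟨n, Set.mem_iUnion₂.2 ⟨Z, ⟨hZ, ?_⟩, hxZ, rfl⟩⟩⟩
      rintro ⟨y, ℓ'⟩ ⟨hy, hℓ⟩
      obtain rfl : ℓ' = ℓ := hℓ
      have hs := (h'.mem_cyl_iff hZ hxZ).1 hy
      obtain ⟨E, hE, hxE⟩ := h'.at_zero.exists_mem hx
      have hyE := (h'.samePiece_base_iff hE hxE).1 (one_le_sep_iff.1 (le_trans (by simp) hs))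
      refine hn _ ?_
      rw [h.sep_level hE hxE hyE hR]
      exact hs
    · exact Set.iUnion_subset fun ℓ => Set.iUnion_subset fun n =>
        Set.iUnion₂_subset fun Z hZ => hZ.2
  rw [hcover]
  refine MeasurableSet.iUnion fun ℓ => MeasurableSet.iUnion fun n => ?_
  have h' := h.along (-(ℓ : ℤ))
  refine MeasurableSet.biUnion ((h'.countable_cyl n).mono fun Z hZ => hZ.1) fun Z hZ => ?_
  exact (h'.measurableSet_cyl Z hZ.1).prod (measurableSet_singleton ℓ)

lemma GoodAt.measure_ne_zero (h : T.GoodAt D γ ω) {E : Set X} (hE : E ∈ T.part ω) : m E ≠ 0 := by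
  intro h0
  obtain ⟨J, -, -, hJ, -⟩ := h.jacobian E hE
  have h1 := (hJ E subset_rfl (h.measurable E hE)).2
  rw [(h.bijOn E hE).image_eq, T.measure_base, setLIntegral_measure_zero _ _ h0] at h1
  exact one_ne_zero h1

lemma Good.exists_notMem_samePiece (h : T.Good D γ ω) {N : Set (X × ℕ)} (hN : T.refMeasure ω N = 0)
    {z : X × ℕ} (hz : z ∈ T.fiber ω) : ∃ w, w ∉ N ∧ T.SamePiece (ω, z) (ω, w) := by
  obtain ⟨x, ℓ⟩ := z
  obtain ⟨hx, hR⟩ := hz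
  simp only at hx hR
  have h' := h (-(ℓ : ℤ))
  obtain ⟨E, hE, hxE⟩ := h'.exists_mem hx
  have hEm := h'.measurable E hE
  by_contra! hcon
  have hsub : E ×ˢ {ℓ} ⊆ N := by
    rintro ⟨y, ℓ'⟩ ⟨hy, hℓ⟩
    obtain rfl : ℓ' = ℓ := hℓ
    by_contra hyN
    exact hcon _ hyN (h.samePiece_iff.2 ⟨rfl, E, hE, hxE, hy, hR⟩)
  have hfib : E ×ˢ {ℓ} ⊆ T.fiber ω := by
    rintro ⟨y, ℓ'⟩ ⟨hy, hℓ⟩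
    obtain rfl : ℓ' = ℓ := hℓ
    refine ⟨h'.subset_base hE hy, ?_⟩
    simp only
    rw [h'.R_const E hE y hy x hxE]
    exact hR
  have h0 := measure_mono_null hsub hN
  rw [refMeasure_eq, Measure.restrict_apply (hEm.prod (measurableSet_singleton ℓ)),
    Set.inter_eq_left.2 hfib, Measure.prod_prod, Measure.count_singleton, mul_one, baseMeasure,
    Measure.restrict_apply hEm, Set.inter_eq_left.2 (h'.subset_base hE)] at h0
  exact h'.measure_ne_zero hE h0

/-- `γ ^ s` satisfies the triangle inequality. -/
lemma Good.powTop_sep_triangle (h : T.Good D γ ω) (h0 : 0 ≤ γ) (h1 : γ ≤ 1) (z w y : X × ℕ) :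
    powTop γ (T.sep (ω, z) (ω, y)) ≤
      powTop γ (T.sep (ω, z) (ω, w)) + powTop γ (T.sep (ω, w) (ω, y)) := by
  refine (powTop_anti h0 h1 (h.min_sep_le z w y)).trans ?_
  rcases min_choice (T.sep (ω, z) (ω, w)) (T.sep (ω, w) (ω, y)) with e | e <;> rw [e]
  · exact le_add_of_nonneg_right (powTop_nonneg h0 _)
  · exact le_add_of_nonneg_left (powTop_nonneg h0 _)

/-- A function that is regular off a null set agrees almost everywhere with a measurable function
that is regular everywhere. The version is the largest regular extension,
`z ↦ inf_w exp (c γ ^ s(z, w)) f w` (McShane's formula for the logarithm). -/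
lemma Good.exists_regular_version (h : T.Good D γ ω) (h0 : 0 ≤ γ) (h1 : γ < 1) (hc : 0 ≤ c)
    {f : X × ℕ → ℝ} {N : Set (X × ℕ)} (hN : T.refMeasure ω N = 0)
    (hb : ∀ z ∈ T.fiber ω, z ∉ N → 0 ≤ f z ∧ f z ≤ Real.exp c)
    (hp : ∀ z w, z ∉ N → w ∉ N → T.SamePiece (ω, z) (ω, w) →
      f z ≤ Real.exp (c * powTop γ (T.sep (ω, z) (ω, w))) * f w) :
    ∃ k : X × ℕ → ℝ, Measurable k ∧ k =ᵐ[T.refMeasure ω] f ∧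
      (∀ z ∈ T.fiber ω, 0 ≤ k z ∧ k z ≤ Real.exp (2 * c)) ∧
      ∀ z w, T.SamePiece (ω, z) (ω, w) →
        k z ≤ Real.exp (c * powTop γ (T.sep (ω, z) (ω, w))) * k w := by
  classical
  set d : X × ℕ → X × ℕ → ℝ := fun z w => powTop γ (T.sep (ω, z) (ω, w)) with hd
  set V : X × ℕ → Set (X × ℕ) := fun z => {w | w ∉ N ∧ T.SamePiece (ω, z) (ω, w)} with hV
  have hVfib : ∀ z, ∀ w ∈ V z, w ∈ T.fiber ω := fun z w hw =>
    SamePiece.mem_fiber_left h (samePiece_comm.1 hw.2)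
  have hVne : ∀ z ∈ T.fiber ω, (V z).Nonempty := fun z hz => h.exists_notMem_samePiece hN hz
  set k : X × ℕ → ℝ := fun z =>
    if z ∈ T.fiber ω then sInf ((fun w => Real.exp (c * d z w) * f w) '' V z) else 0 with hk
  have hnn : ∀ z, ∀ w ∈ V z, 0 ≤ Real.exp (c * d z w) * f w := fun z w hw =>
    mul_nonneg (Real.exp_pos _).le (hb w (hVfib z w hw) hw.1).1
  have hkle : ∀ z ∈ T.fiber ω, ∀ w ∈ V z, k z ≤ Real.exp (c * d z w) * f w := by
    intro z hz w hw
    simp only [hk, if_pos hz]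
    exact csInf_le ⟨0, by rintro _ ⟨y, hy, rfl⟩; exact hnn z y hy⟩ ⟨w, hw, rfl⟩
  have hlek : ∀ z ∈ T.fiber ω, ∀ a, (∀ w ∈ V z, a ≤ Real.exp (c * d z w) * f w) → a ≤ k z := by
    intro z hz a ha
    simp only [hk, if_pos hz]
    exact le_csInf ((hVne z hz).image _) (by rintro _ ⟨y, hy, rfl⟩; exact ha y hy)
  have hk0 : ∀ z ∈ T.fiber ω, 0 ≤ k z := fun z hz => hlek z hz 0 (hnn z)
  have hreg : ∀ z w, T.SamePiece (ω, z) (ω, w) → k z ≤ Real.exp (c * d z w) * k w := by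
    intro z w hs
    have hz := SamePiece.mem_fiber_left h hs
    have hw := SamePiece.mem_fiber_left h (samePiece_comm.1 hs)
    have : Real.exp (-(c * d z w)) * k z ≤ k w := by
      refine hlek w hw _ fun y hy => ?_
      have hyz : y ∈ V z := ⟨hy.1, h.samePiece_trans hs hy.2⟩
      have hfy := (hb y (hVfib w y hy) hy.1).1
      calc Real.exp (-(c * d z w)) * k z
          ≤ Real.exp (-(c * d z w)) * (Real.exp (c * d z y) * f y) := by
            gcongr; exact hkle z hz y hyz
        _ ≤ Real.exp (-(c * d z w)) * (Real.exp (c * (d z w + d w y)) * f y) := by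
            gcongr; exact h.powTop_sep_triangle h0 h1.le z w y
        _ = Real.exp (c * d w y) * f y := by
            rw [← mul_assoc, ← Real.exp_add]; ring_nf
    calc k z = Real.exp (c * d z w) * (Real.exp (-(c * d z w)) * k z) := by
          rw [← mul_assoc, ← Real.exp_add]; simp
      _ ≤ _ := by gcongr
  have hd1 : ∀ z w, d z w ≤ 1 := fun z w => powTop_le_one h0 h1.le _
  refine ⟨k, ?_, ?_, fun z hz => ⟨hk0 z hz, ?_⟩, hreg⟩
  · -- superlevel sets are open for the separation time
    refine measurable_of_Ioi fun a => ?_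
    have hopen : MeasurableSet {z | z ∈ T.fiber ω ∧ a < k z} := by
      refine h.measurableSet_of_sep fun z hz => ⟨hz.1, ?_⟩
      obtain ⟨n, hn⟩ : ∃ n : ℕ, 0 ≤ a → a * Real.exp (c * γ ^ (n + 1)) < k z := by
        have hlim : Tendsto (fun n : ℕ => a * Real.exp (c * γ ^ (n + 1))) atTop
            (𝓝 (a * Real.exp (c * 0))) :=
          ((((tendsto_pow_atTop_nhds_zero_of_lt_one h0 h1).comp
            (tendsto_add_atTop_nat 1)).const_mul c).rexp).const_mul a
        obtain ⟨n, hn⟩ := (hlim.eventually (gt_mem_nhds (by simpa using hz.2))).exists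
        exact ⟨n, fun _ => hn⟩
      refine ⟨n, fun w hw => ?_⟩
      have hs : T.SamePiece (ω, z) (ω, w) := one_le_sep_iff.1 (le_trans (by simp) hw)
      have hwf := SamePiece.mem_fiber_left h (samePiece_comm.1 hs)
      refine ⟨hwf, ?_⟩
      rcases lt_or_ge a 0 with ha | ha
      · exact ha.trans_le (hk0 w hwf)
      · have hdn : d z w ≤ γ ^ (n + 1) := by
          rw [← powTop_natCast]; exact powTop_anti h0 h1.le hw
        have hlt : a * Real.exp (c * γ ^ (n + 1)) < Real.exp (c * γ ^ (n + 1)) * k w := by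
          refine (hn ha).trans_le ((hreg z w hs).trans ?_)
          have := hk0 w hwf
          gcongr
        rw [mul_comm] at hlt
        exact lt_of_mul_lt_mul_left hlt (Real.exp_pos _).le
    have : k ⁻¹' Set.Ioi a = {z | z ∈ T.fiber ω ∧ a < k z} ∪ ((T.fiber ω)ᶜ ∩ {_z | a < 0}) := by
      ext z
      by_cases hz : z ∈ T.fiber ω <;> simp [hk, hz]
    rw [this]
    exact hopen.union ((measurableSet_fiber ω).compl.inter (MeasurableSet.const _))
  · filter_upwards [compl_mem_ae_iff.2 (refMeasure_compl_fiber (T := T) ω),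
      compl_mem_ae_iff.2 hN] with z hz hzN
    have hzf : z ∈ T.fiber ω := by simpa using hz
    refine le_antisymm ?_ (hlek z hzf _ fun w hw => hp z w hzN hw.1 hw.2)
    have := hkle z hzf z ⟨hzN, h.samePiece_self hzf⟩
    simpa [hd, h.sep_self hzf] using this
  · obtain ⟨w, hw⟩ := hVne z hz
    calc k z ≤ Real.exp (c * d z w) * f w := hkle z hz w hw
      _ ≤ Real.exp c * Real.exp c := by
          gcongr
          · exact (hb w (hVfib z w hw) hw.1).1
          · exact mul_le_of_le_one_right hc (hd1 z w)
          · exact (hb w (hVfib z w hw) hw.1).2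
      _ = Real.exp (2 * c) := by rw [← Real.exp_add]; ring_nf

/-- A family of fibrewise regular functions belongs to `𝓕_γ^1`. -/
lemma memFLip_one (hgood : ∀ᵐ ω ∂(noiseMeasure p), T.Good D γ ω) (h0 : 0 ≤ γ) (h1 : γ ≤ 1)
    (hc : 0 < c) {k : Noise A → X × ℕ → ℝ}
    (hb : ∀ᵐ ω ∂(noiseMeasure p), ∀ z ∈ T.fiber ω, 0 ≤ k ω z ∧ k ω z ≤ Real.exp (2 * c))
    (hp : ∀ᵐ ω ∂(noiseMeasure p), ∀ z w, T.SamePiece (ω, z) (ω, w) →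
      k ω z ≤ Real.exp (c * powTop γ (T.sep (ω, z) (ω, w))) * k ω w) :
    T.MemFLip γ (fun _ => 1) k := by
  refine ⟨⟨Real.exp (2 * c), Real.exp_pos _, ?_⟩,
    Real.exp (2 * c) * (c * Real.exp c + 1), by positivity, ?_⟩
  · filter_upwards [hb] with ω hω z hz
    rw [abs_of_nonneg (hω z hz).1, mul_one]
    exact (hω z hz).2
  · filter_upwards [hgood, hb, hp] with ω hg hω hωp z hz w hw
    rw [mul_one]
    have hz' := hω z hz
    have hw' := hω w hw
    by_cases hs : T.SamePiece (ω, z) (ω, w)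
    · have key : ∀ {x y}, x ∈ T.fiber ω → y ∈ T.fiber ω → T.SamePiece (ω, x) (ω, y) →
          k ω x - k ω y ≤
            Real.exp (2 * c) * (c * Real.exp c + 1) * powTop γ (T.sep (ω, x) (ω, y)) := by
        intro x y hx hy hxy
        set s := powTop γ (T.sep (ω, x) (ω, y)) with hs
        have hs0 : 0 ≤ s := powTop_nonneg h0 _
        have hs1 : s ≤ 1 := powTop_le_one h0 h1 _
        have hexp : Real.exp (c * s) - 1 ≤ c * s * Real.exp c := by
          have e1 : Real.exp (c * s) * (1 - c * s) ≤ 1 := by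
            calc Real.exp (c * s) * (1 - c * s)
                ≤ Real.exp (c * s) * Real.exp (-(c * s)) := by
                  gcongr
                  linarith [Real.add_one_le_exp (-(c * s))]
              _ = 1 := by rw [← Real.exp_add]; simp
          have e2 : Real.exp (c * s) ≤ Real.exp c := by
            gcongr; exact mul_le_of_le_one_right hc.le hs1
          nlinarith [mul_nonneg hc.le hs0]
        calc k ω x - k ω y ≤ (Real.exp (c * s) - 1) * k ω y := by linarith [hωp x y hxy]
          _ ≤ (c * s * Real.exp c) * Real.exp (2 * c) := by
              refine mul_le_mul hexp (hω y hy).2 (hω y hy).1 (by positivity)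
          _ ≤ Real.exp (2 * c) * (c * Real.exp c + 1) * s := by
              nlinarith [mul_nonneg (Real.exp_pos (2 * c)).le hs0]
      rw [abs_le]
      have k1 := key hz hw hs
      have k2 := key hw hz (samePiece_comm.1 hs)
      rw [sep_comm] at k2
      constructor <;> linarith
    · rw [sep_eq_zero hs, powTop_zero, mul_one, abs_le]
      have : 0 ≤ Real.exp (2 * c) * (c * Real.exp c) := by positivity
      constructor <;> nlinarith

/-- A family of fibrewise regular functions belongs to the cone `𝓕_γ^+`. -/
lemma memFPlus_of_regular (hgood : ∀ᵐ ω ∂(noiseMeasure p), T.Good D γ ω) (hc : 0 < c)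
    {k : Noise A → X × ℕ → ℝ}
    (hb : ∀ᵐ ω ∂(noiseMeasure p), ∀ z ∈ T.fiber ω, 0 ≤ k ω z ∧ k ω z ≤ Real.exp (2 * c))
    (hp : ∀ᵐ ω ∂(noiseMeasure p), ∀ z w, T.SamePiece (ω, z) (ω, w) →
      k ω z ≤ Real.exp (c * powTop γ (T.sep (ω, z) (ω, w))) * k ω w) :
    T.MemFPlus γ k := by
  refine ⟨c, hc, ?_⟩
  filter_upwards [hgood, hb, hp] with ω hg hω hωp I hI
  have hsame : ∀ {x y}, x ∈ I → y ∈ I → T.SamePiece (ω, x) (ω, y) :=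
    fun hx hy => ⟨rfl, I, hI, hx, hy⟩
  have hfib : ∀ {x}, x ∈ I → x ∈ T.fiber ω := fun hx =>
    SamePiece.mem_fiber_left hg (hsame hx hx)
  by_cases hz : ∃ x₀ ∈ I, k ω x₀ = 0
  · obtain ⟨x₀, hx₀, h0⟩ := hz
    refine Or.inl fun x hx => le_antisymm ?_ (hω x (hfib hx)).1
    simpa [h0] using hωp x x₀ (hsame hx hx₀)
  · push Not at hz
    have hpos : ∀ x ∈ I, 0 < k ω x := fun x hx =>
      lt_of_le_of_ne (hω x (hfib hx)).1 (hz x hx).symm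
    refine Or.inr ⟨hpos, fun x hx y hy => ?_⟩
    have key : ∀ {x y}, x ∈ I → y ∈ I → Real.log (k ω x) - Real.log (k ω y) ≤
        c * powTop γ (T.sep (ω, x) (ω, y)) := by
      intro x y hx hy
      have := Real.log_le_log (hpos x hx) (hωp x y (hsame hx hy))
      rw [Real.log_mul (Real.exp_pos _).ne' (hpos y hy).ne', Real.log_exp] at this
      linarith
    rw [Real.log_div (hpos x hx).ne' (hpos y hy).ne', abs_le]
    have k1 := key hx hy
    have k2 := key hy hx
    rw [sep_comm] at k2
    constructor <;> linarith

end RandomTower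
end RandomTowers

namespace RandomTowers
namespace RandomTower

variable {A X : Type*} [MeasurableSpace A] [MeasurableSpace X]
  {p : Measure A} [IsProbabilityMeasure p] {m : Measure X} {T : RandomTower p m}
  {D γ c : ℝ} {ω : Noise A}

/-! ### The equivariant family of measures -/

open Classical in
/-- The kernel of fibre measures with density `G`; over the exceptional noises where the mass is not
one it is an arbitrary point mass. -/
def fibreKernel (T : RandomTower p m) (z₀ : X × ℕ) {G : Noise A × (X × ℕ) → ℝ≥0∞}
    (hG : Measurable G) : Kernel (Noise A) (X × ℕ) where
  toFun ω := if T.fibreMeasure G ω Set.univ = 1 then T.fibreMeasure G ω else Measure.dirac z₀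
  measurable' := by
    refine Measure.measurable_of_measurable_coe _ fun S hS => ?_
    have e : ∀ ω, (if T.fibreMeasure G ω Set.univ = 1 then T.fibreMeasure G ω
        else Measure.dirac z₀) S =
        if T.fibreMeasure G ω Set.univ = 1 then T.fibreMeasure G ω S
          else Measure.dirac z₀ S := fun ω => by split_ifs <;> rfl
    simp_rw [e]
    have h1 := measurable_fibreMeasure (T := T) hG MeasurableSet.univ
    have h2 := measurable_fibreMeasure (T := T) hG (hS.preimage measurable_snd)
    exact Measurable.ite (h1 (measurableSet_singleton 1)) h2 measurable_const

lemma fibreKernel_eq (z₀ : X × ℕ) {G : Noise A × (X × ℕ) → ℝ≥0∞} (hG : Measurable G)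
    (hω : T.fibreMeasure G ω Set.univ = 1) : T.fibreKernel z₀ hG ω = T.fibreMeasure G ω :=
  if_pos hω

instance isMarkovKernel_fibreKernel (z₀ : X × ℕ) {G : Noise A × (X × ℕ) → ℝ≥0∞}
    (hG : Measurable G) : IsMarkovKernel (T.fibreKernel z₀ hG) := by
  refine ⟨fun ω => ⟨?_⟩⟩
  by_cases hω : T.fibreMeasure G ω Set.univ = 1
  · rw [fibreKernel_eq z₀ hG hω, hω]
  · have : T.fibreKernel z₀ hG ω = Measure.dirac z₀ := if_neg hω
    rw [this, measure_univ]

/-- There is an equivariant family of probability measures with densities that are regular at every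
point of almost every fibre. -/
lemma exists_equivariant_kernel {A X : Type*} [MeasurableSpace A] [MetricSpace X]
    [MeasurableSpace X] [BorelSpace X] {p : Measure A} [IsProbabilityMeasure p] {m : Measure X}
    {T : RandomTower p m} {D γ c : ℝ} (hgood : ∀ᵐ ω ∂(noiseMeasure p), T.Good D γ ω)
    (hsep : TopologicalSpace.IsSeparable T.base) (hFin : T.FiniteMass)
    (h0 : 0 ≤ γ) (h1 : γ < 1) (hc : 0 ≤ c) (hcD : c * γ + D = c) :
    ∃ (ν : Kernel (Noise A) (X × ℕ)) (k : Noise A → X × ℕ → ℝ), IsMarkovKernel ν ∧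
      (∀ ω, Measurable (k ω)) ∧
      (∀ᵐ ω ∂(noiseMeasure p),
        ν ω = (T.refMeasure ω).withDensity (fun z => ENNReal.ofReal (k ω z))) ∧
      T.Equivariant ν ∧
      (∀ᵐ ω ∂(noiseMeasure p), ∀ z ∈ T.fiber ω, 0 ≤ k ω z ∧ k ω z ≤ Real.exp (2 * c)) ∧
      ∀ᵐ ω ∂(noiseMeasure p), ∀ z w, T.SamePiece (ω, z) (ω, w) →
        k ω z ≤ Real.exp (c * powTop γ (T.sep (ω, z) (ω, w))) * k ω w := by
  classical
  obtain ⟨g, hgm, hreg, hmass, hinv⟩ := exists_invariant_density hgood hsep hFin h0 h1.le hc hcD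
  obtain ⟨x₀, -⟩ := T.base_nonempty
  have hG : Measurable fun q => ENNReal.ofReal (g q) := hgm.ennreal_ofReal
  -- `Q ω k`: `k` is a regular version of the density over `ω`
  let Q : Noise A → (X × ℕ → ℝ) → Prop := fun ω k =>
    k =ᵐ[T.refMeasure ω] (fun z => g (ω, z)) ∧
      (∀ z ∈ T.fiber ω, 0 ≤ k z ∧ k z ≤ Real.exp (2 * c)) ∧
      ∀ z w, T.SamePiece (ω, z) (ω, w) →
        k z ≤ Real.exp (c * powTop γ (T.sep (ω, z) (ω, w))) * k w
  have hver : ∀ᵐ ω ∂(noiseMeasure p), ∃ k : X × ℕ → ℝ, Measurable k ∧ Q ω k := by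
    filter_upwards [hgood, hreg] with ω h ⟨N, hN, hb, hp⟩
    exact h.exists_regular_version h0 h1 hc hN hb hp
  have hex : ∀ ω, ∃ k : X × ℕ → ℝ, Measurable k ∧ ((∃ k, Measurable k ∧ Q ω k) → Q ω k) := by
    intro ω
    by_cases hω : ∃ k : X × ℕ → ℝ, Measurable k ∧ Q ω k
    · obtain ⟨k, hk, hk'⟩ := hω
      exact ⟨k, hk, fun _ => hk'⟩
    · exact ⟨0, measurable_zero, fun h => absurd h hω⟩
  choose k hkm hk using hex
  refine ⟨T.fibreKernel (x₀, 0) hG, k, inferInstance, hkm, ?_, ?_, ?_, ?_⟩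
  · filter_upwards [hmass, hver] with ω h1 h2
    rw [fibreKernel_eq _ hG h1, fibreMeasure]
    refine withDensity_congr_ae ?_
    filter_upwards [(hk ω h2).1] with z hz
    rw [hz]
  · filter_upwards [hinv, ae_forall_shift hmass] with ω h1 h2
    rw [fibreKernel_eq _ hG (h2 1), fibreKernel_eq _ hG (by simpa using h2 0), h1]
  · exact hver.mono fun ω h => (hk ω h).2.1
  · exact hver.mono fun ω h => (hk ω h).2.2

/-- A family of probability measures that are absolutely continuous on almost every fibre is exact,
because the tail `σ`-algebra is trivial for the reference measure. -/
lemma exact_of_absolutelyContinuous {A X : Type*} [MeasurableSpace A] [MetricSpace X]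
    [MeasurableSpace X] [BorelSpace X] {p : Measure A} [IsProbabilityMeasure p] {m : Measure X}
    {T : RandomTower p m} {D γ c : ℝ} {ν : Kernel (Noise A) (X × ℕ)} [IsMarkovKernel ν]
    (hgood : ∀ᵐ ω ∂(noiseMeasure p), T.Good D γ ω)
    (hExp : T.WeakExpansion) (hAper : T.Aperiodic) (hFin : T.FiniteMass)
    (h0 : 0 ≤ γ) (h1 : γ ≤ 1) (hc : 0 ≤ c) (hcD : c * γ + D = c)
    (hν : ∀ᵐ ω ∂(noiseMeasure p), ν ω ≪ T.refMeasure ω) : T.Exact ν := by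
  obtain ⟨N, t, ε, ht, hε, hA⟩ := hAper
  filter_upwards [hgood, ae_forall_shift hExp, ae_forall_shift hA, ae_frequently_lowTop hFin c, hν]
    with ω h2 h3 h4 ⟨L, hL⟩ hac B hB
  choose B' hB' _ hBB' using hB
  have hgen : T.Generic D γ t ε ω := ⟨h2, h3, h4⟩
  have hBm : MeasurableSet B := by
    rw [hBB' 0]
    exact (measurableSet_fiber ω).inter (measurable_towerIter ω 0 (hB' 0))
  rcases hgen.tail_trivial h0 h1 hc hcD ht hε hL hB' hBB' with h | h
  · exact Or.inl (hac h)
  · refine Or.inr ((prob_compl_eq_zero_iff hBm).1 (measure_mono_null ?_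
      (measure_union_null (hac h) (hac (refMeasure_compl_fiber (T := T) ω)))))
    intro z hz
    by_cases hzf : z ∈ T.fiber ω
    · exact Or.inl ⟨hzf, hz⟩
    · exact Or.inr hzf

end RandomTower
end RandomTowers

namespace RandomTowers

/-! ### Mixing of the Bernoulli shift -/

section DenseSets

variable {α : Type*} [MeasurableSpace α] {μ : Measure α} [IsFiniteMeasure μ]

/-- A bounded sequence of additive functionals on `L²` tends to zero pointwise as soon as it does so
on the indicator functions of a measure-dense family of sets. -/
lemma tendsto_zero_of_measureDense {𝒜 : Set (Set α)} (h𝒜 : μ.MeasureDense 𝒜)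
    {l : ℕ → Lp ℝ 2 μ → ℝ} (hadd : ∀ n f g, l n (f + g) = l n f + l n g) {C : ℝ}
    (hC : ∀ n f, |l n f| ≤ C * ‖f‖)
    (hl : ∀ S (hS : S ∈ 𝒜) (a : ℝ), Tendsto (fun n => l n
      (indicatorConstLp 2 (h𝒜.measurable S hS) (measure_ne_top μ S) a)) atTop (𝓝 0))
    (f : Lp ℝ 2 μ) : Tendsto (fun n => l n f) atTop (𝓝 0) := by
  have hclosed : IsClosed {f : Lp ℝ 2 μ | Tendsto (fun n => l n f) atTop (𝓝 0)} := by
    refine isClosed_of_closure_subset fun f hf => ?_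
    rw [Set.mem_ofPred_eq, Metric.tendsto_atTop]
    intro ε hε
    have hC1 : 0 < |C| + 1 := by positivity
    obtain ⟨g, hg, hfg⟩ := Metric.mem_closure_iff.1 hf (ε / 2 / (|C| + 1)) (by positivity)
    obtain ⟨N, hN⟩ := Metric.tendsto_atTop.1 hg (ε / 2) (by positivity)
    refine ⟨N, fun n hn => ?_⟩
    have h1 := hN n hn
    rw [Real.dist_eq, sub_zero] at h1 ⊢
    rw [dist_eq_norm] at hfg
    have h2 : |l n (f - g)| < ε / 2 := by
      calc |l n (f - g)| ≤ C * ‖f - g‖ := hC _ _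
        _ ≤ (|C| + 1) * ‖f - g‖ := by
            gcongr
            linarith [le_abs_self C]
        _ < ε / 2 := by rwa [lt_div_iff₀ hC1, mul_comm] at hfg
    calc |l n f| = |l n (f - g) + l n g| := by rw [← hadd, sub_add_cancel]
      _ ≤ |l n (f - g)| + |l n g| := abs_add_le _ _
      _ < ε := by linarith
  refine Lp.induction (by norm_num) (motive := fun f => Tendsto (fun n => l n f) atTop (𝓝 0))
    ?_ ?_ hclosed f
  · intro a S hS hμS
    have : Fact ((2 : ℝ≥0∞) ≠ ∞) := ⟨by norm_num⟩
    rw [Lp.simpleFunc.coe_indicatorConst]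
    refine hclosed.closure_subset_iff.2 ?_
      (h𝒜.indicatorConstLp_subset_closure 2 a ⟨S, hS, hμS.ne, rfl⟩)
    rintro _ ⟨U, hU, hμU, rfl⟩
    exact hl U hU a
  · intro f g hf hg _ h1 h2
    simpa only [hadd, add_zero] using h1.add h2

end DenseSets

variable {A : Type*} [MeasurableSpace A] {p : Measure A} [IsProbabilityMeasure p]

/-- Far translates of cylinders are independent. -/
lemma eventually_noiseMeasure_cylinder_inter {S U : Set (Noise A)}
    (hS : S ∈ measurableCylinders (fun _ : ℤ => A))
    (hU : U ∈ measurableCylinders (fun _ : ℤ => A)) :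
    ∀ᶠ n : ℕ in atTop, noiseMeasure p (shift (n : ℤ) ⁻¹' S ∩ U) =
      noiseMeasure p S * noiseMeasure p U := by
  classical
  obtain ⟨I, S', hS', rfl⟩ := (mem_measurableCylinders S).1 hS
  obtain ⟨J, U', hU', rfl⟩ := (mem_measurableCylinders U).1 hU
  have hdisj : ∀ᶠ n : ℕ in atTop, Disjoint (I.image fun i => i + (n : ℤ)) J := by
    have : ∀ i ∈ I, ∀ j ∈ J, ∀ᶠ n : ℕ in atTop, i + (n : ℤ) ≠ j := fun i _ j _ => by
      filter_upwards [eventually_gt_atTop (j - i).toNat] with n hn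
      omega
    have h2 : ∀ᶠ n : ℕ in atTop, ∀ i ∈ I, ∀ j ∈ J, i + (n : ℤ) ≠ j :=
      (Finset.eventually_all I).2 fun i hi => (Finset.eventually_all J).2 fun j hj => this i hi j hj
    filter_upwards [h2] with n hn
    rw [Finset.disjoint_left]
    intro k hk hkJ
    obtain ⟨i, hi, rfl⟩ := Finset.mem_image.1 hk
    exact hn i hi _ hkJ rfl
  filter_upwards [hdisj] with n hn
  have hind : iIndepFun (fun (i : ℤ) (ω : Noise A) => ω i) (noiseMeasure p) :=
    iIndepFun_infinitePi (X := fun _ a => a) (fun _ => measurable_id)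
  have h1 := hind.indepFun_finset _ _ hn fun i => measurable_pi_apply i
  let g : ((I.image fun i => i + (n : ℤ)) → A) → I → A :=
    fun y i => y ⟨i + n, Finset.mem_image_of_mem _ i.2⟩
  have hg : Measurable g := measurable_pi_lambda _ fun i => measurable_pi_apply _
  have h2 := h1.measure_inter_preimage_eq_mul _ _ (hg hS') hU'
  rw [← (measurePreserving_shift p n).measure_preimage
    (MeasurableSet.of_mem_measurableCylinders hS).nullMeasurableSet]
  exact h2

/-- The shift is mixing. -/
lemma tendsto_integral_shift_mul {α β : Noise A → ℝ} (hα : MemLp α 2 (noiseMeasure p))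
    (hβ : MemLp β 2 (noiseMeasure p)) :
    Tendsto (fun n : ℕ => ∫ ω, α (shift n ω) * β ω ∂(noiseMeasure p)) atTop
      (𝓝 ((∫ ω, α ω ∂(noiseMeasure p)) * ∫ ω, β ω ∂(noiseMeasure p))) := by
  set P := noiseMeasure p with hP
  have h𝒜 : P.MeasureDense (measurableCylinders fun _ : ℤ => A) :=
    Measure.MeasureDense.of_generateFrom_isSetAlgebra_finite P
      isSetAlgebra_measurableCylinders generateFrom_measurableCylinders.symm
  let U : ℕ → Lp ℝ 2 P →+ Lp ℝ 2 P := fun n =>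
    Lp.compMeasurePreserving (shift (n : ℤ)) (measurePreserving_shift p n)
  let e : Lp ℝ 2 P := indicatorConstLp 2 MeasurableSet.univ (measure_ne_top P _) 1
  have hU : ∀ n f, ‖U n f‖ = ‖f‖ := fun n f => Lp.norm_compMeasurePreserving f _
  have he : ‖e‖ = 1 := by
    rw [norm_indicatorConstLp (by norm_num) (by norm_num)]
    simp
  let b : ℕ → Lp ℝ 2 P → Lp ℝ 2 P → ℝ := fun n f g =>
    inner ℝ (U n f) g - inner ℝ e f * inner ℝ e g
  have hb : ∀ n f g, |b n f g| ≤ 2 * ‖f‖ * ‖g‖ := by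
    intro n f g
    have h1 := abs_real_inner_le_norm (U n f) g
    have h2 := abs_real_inner_le_norm e f
    have h3 := abs_real_inner_le_norm e g
    rw [hU] at h1
    rw [he, one_mul] at h2 h3
    calc |b n f g| ≤ |inner ℝ (U n f) g| + |inner ℝ e f * inner ℝ e g| := abs_sub _ _
      _ ≤ ‖f‖ * ‖g‖ + ‖f‖ * ‖g‖ := by
          rw [abs_mul]; gcongr
      _ = _ := by ring
  have hcyl : ∀ S (hS : S ∈ measurableCylinders fun _ : ℤ => A) (a : ℝ),
      ∀ V (hV : V ∈ measurableCylinders fun _ : ℤ => A) (a' : ℝ), Tendsto (fun n => b n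
        (indicatorConstLp 2 (h𝒜.measurable S hS) (measure_ne_top P S) a)
        (indicatorConstLp 2 (h𝒜.measurable V hV) (measure_ne_top P V) a')) atTop (𝓝 0) := by
    intro S hS a V hV a'
    refine tendsto_const_nhds.congr' ?_
    filter_upwards [eventually_noiseMeasure_cylinder_inter (p := p) hS hV] with n hn
    simp only [b, U, e]
    rw [Lp.indicatorConstLp_compMeasurePreserving, L2.inner_indicatorConstLp_indicatorConstLp,
      L2.inner_indicatorConstLp_indicatorConstLp, L2.inner_indicatorConstLp_indicatorConstLp]
    simp only [Set.univ_inter, measureReal_def, hP, hn, ENNReal.toReal_mul]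
    simp
    ring
  have hb0 : ∀ f g, Tendsto (fun n => b n f g) atTop (𝓝 0) := by
    intro f g
    refine tendsto_zero_of_measureDense h𝒜 (l := fun n f => b n f g) (C := 2 * ‖g‖) ?_ ?_ ?_ f
    · intro n f f'
      simp only [b, map_add, inner_add_left, inner_add_right]
      ring
    · intro n f
      have := hb n f g
      linarith
    · intro S hS a
      refine tendsto_zero_of_measureDense h𝒜 (l := fun n g => b n _ g) ?_ (fun n g => hb n _ g) ?_ g
      · intro n g g'
        simp only [b, inner_add_right]
        ring
      · exact hcyl S hS a
  have hint : ∀ {f : Noise A → ℝ} (hf : MemLp f 2 P), inner ℝ e hf.toLp = ∫ ω, f ω ∂P := by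
    intro f hf
    rw [L2.inner_indicatorConstLp_one, setIntegral_univ]
    exact integral_congr_ae hf.coeFn_toLp
  have hmain : ∀ n, b n hα.toLp hβ.toLp =
      (∫ ω, α (shift n ω) * β ω ∂P) - (∫ ω, α ω ∂P) * ∫ ω, β ω ∂P := by
    intro n
    simp only [b, hint]
    congr 1
    rw [L2.inner_def]
    refine integral_congr_ae ?_
    filter_upwards [hβ.coeFn_toLp, Lp.coeFn_compMeasurePreserving hα.toLp
      (measurePreserving_shift p n), (measurePreserving_shift p n).quasiMeasurePreserving.ae
        hα.coeFn_toLp] with ω h1 h2 h3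
    have h4 : (U n hα.toLp) ω = α (shift n ω) := by
      rw [← h3]; exact h2
    rw [h1, h4]
    simp [mul_comm]
  have := (hb0 hα.toLp hβ.toLp).add_const ((∫ ω, α ω ∂P) * ∫ ω, β ω ∂P)
  simpa only [hmain, sub_add_cancel, zero_add] using this

end RandomTowers

namespace RandomTowers

/-! ### Mixing of the skew product -/

/-- In a decreasing sequence of closed subspaces, a bounded sequence of vectors `x n ∈ H n`
decorrelates from every vector that is orthogonal to the intersection. -/
lemma tendsto_inner_of_mem_orthogonal_iInf {E : Type*} [NormedAddCommGroup E]
    [InnerProductSpace ℝ E] [CompleteSpace E] {H : ℕ → Submodule ℝ E} (hH : Antitone H)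
    (hcl : ∀ n, IsClosed (H n : Set E)) {x : ℕ → E} (hx : ∀ n, x n ∈ H n) {C : ℝ}
    (hC : ∀ n, ‖x n‖ ≤ C) {y : E} (hy : y ∈ (⨅ n, H n)ᗮ) :
    Tendsto (fun n => inner ℝ (x n) y) atTop (𝓝 0) := by
  have hdouble : ∀ n, (H n)ᗮᗮ = H n := fun n => by
    rw [Submodule.orthogonal_orthogonal_eq_closure]
    exact (hcl n).submodule_topologicalClosure_eq
  have hmem : y ∈ (⨆ n, (H n)ᗮ).topologicalClosure := by
    rw [← Submodule.orthogonal_orthogonal_eq_closure, ← Submodule.iInf_orthogonal]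
    simpa only [hdouble] using hy
  have hmono : Monotone fun n => (H n)ᗮ := fun a b hab => Submodule.orthogonal_le (hH hab)
  rw [Metric.tendsto_atTop]
  intro ε hε
  have hC0 : 0 ≤ C := (norm_nonneg _).trans (hC 0)
  obtain ⟨w, hw, hyw⟩ := Metric.mem_closure_iff.1 hmem (ε / (C + 1)) (by positivity)
  obtain ⟨N, hN⟩ := (Submodule.mem_iSup_of_directed _ hmono.directed_le).1 hw
  refine ⟨N, fun n hn => ?_⟩
  have h0 : inner ℝ (x n) w = 0 :=
    Submodule.inner_right_of_mem_orthogonal (hx n) (hmono hn hN)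
  rw [dist_eq_norm] at hyw
  rw [Real.dist_eq, sub_zero]
  calc |inner ℝ (x n) y| = |inner ℝ (x n) (y - w)| := by rw [inner_sub_right, h0, sub_zero]
    _ ≤ ‖x n‖ * ‖y - w‖ := abs_real_inner_le_norm _ _
    _ ≤ C * ‖y - w‖ := by gcongr; exact hC n
    _ ≤ (C + 1) * ‖y - w‖ := by gcongr; linarith
    _ < ε := by rwa [lt_div_iff₀ (by positivity), mul_comm] at hyw

namespace RandomTower

variable {A X : Type*} [MeasurableSpace A] [MeasurableSpace X]
  {p : Measure A} [IsProbabilityMeasure p] {m : Measure X} {T : RandomTower p m}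
  {D γ : ℝ} {ν : Kernel (Noise A) (X × ℕ)}

lemma Equivariant.ae_map_towerIter (h : T.Equivariant ν) :
    ∀ᵐ ω ∂(noiseMeasure p), ∀ n : ℕ, (ν ω).map (T.towerIter ω n) = ν (shift n ω) := by
  filter_upwards [ae_forall_shift h] with ω hω n
  induction n with
  | zero => simp [towerIter, shift_zero]
  | succ n ih =>
    have e : T.towerIter ω (n + 1) = T.towerMap (shift n ω) ∘ T.towerIter ω n := rfl
    rw [e, ← Measure.map_map (measurable_towerMap _) (measurable_towerIter ω n), ih, hω n,
      shift_shift]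
    push_cast
    rw [add_comm]

/-- The `σ`-algebra of the events that depend on the noise and on the position after `n` steps. -/
@[reducible] def futureSigma (T : RandomTower p m) (n : ℕ) : MeasurableSpace (Noise A × (X × ℕ)) :=
  MeasurableSpace.comap (fun q => (q.1, T.towerIter q.1 n q.2)) inferInstance

lemma measurable_future (n : ℕ) : Measurable
    fun q : Noise A × (X × ℕ) => (q.1, T.towerIter q.1 n q.2) :=
  measurable_fst.prodMk (measurable_towerIter_uncurry n)

lemma futureSigma_le (n : ℕ) : T.futureSigma n ≤ Prod.instMeasurableSpace :=
  (measurable_future n).comap_le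

lemma antitone_futureSigma : Antitone T.futureSigma := by
  refine antitone_nat_of_succ_le fun n => ?_
  have hm : Measurable fun q : Noise A × (X × ℕ) => (q.1, T.towerMap (shift n q.1) q.2) :=
    measurable_fst.prodMk (measurable_towerMap_uncurry.comp
      (((measurable_shift _).comp measurable_fst).prodMk measurable_snd))
  rintro _ ⟨S, hS, rfl⟩
  exact ⟨_, hm hS, rfl⟩

/-- The square integrable functions of the noise and of the position after `n` steps. -/
def futureSpace (T : RandomTower p m) (ν : Kernel (Noise A) (X × ℕ)) (n : ℕ) :
    Submodule ℝ (Lp ℝ 2 (noiseMeasure p ⊗ₘ ν)) :=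
  lpMeas ℝ ℝ (T.futureSigma n) 2 (noiseMeasure p ⊗ₘ ν)

lemma antitone_futureSpace : Antitone (T.futureSpace ν) := fun _ _ hab _ hf =>
  AEStronglyMeasurable.mono (antitone_futureSigma hab) hf

lemma isClosed_futureSpace (n : ℕ) :
    IsClosed (T.futureSpace ν n : Set (Lp ℝ 2 (noiseMeasure p ⊗ₘ ν))) :=
  isClosed_aestronglyMeasurable (futureSigma_le n)

variable [IsMarkovKernel ν]

lemma Equivariant.measurePreserving_skew (h : T.Equivariant ν) (n : ℕ) :
    MeasurePreserving (T.skew n) (noiseMeasure p ⊗ₘ ν) (noiseMeasure p ⊗ₘ ν) := by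
  refine ⟨measurable_skew n, Measure.ext fun S hS => ?_⟩
  rw [Measure.map_apply (measurable_skew n) hS, Measure.compProd_apply (measurable_skew n hS),
    Measure.compProd_apply hS,
    ← (measurePreserving_shift p n).lintegral_comp (Kernel.measurable_kernel_prodMk_left hS)]
  refine lintegral_congr_ae ?_
  filter_upwards [h.ae_map_towerIter] with ω hω
  rw [← hω n, Measure.map_apply (measurable_towerIter ω n) (hS.preimage measurable_prodMk_left)]
  rfl

/-- By exactness, a random variable that is a function of the noise and of the position after `n`
steps, for every `n`, is a function of the noise alone. -/
lemma ae_eq_integral_of_mem_futureSpace (hgood : ∀ᵐ ω ∂(noiseMeasure p), T.Good D γ ω)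
    (hex : T.Exact ν) (hfib : ∀ᵐ ω ∂(noiseMeasure p), ν ω (T.fiber ω)ᶜ = 0)
    {f : Lp ℝ 2 (noiseMeasure p ⊗ₘ ν)} (hf : f ∈ ⨅ n, T.futureSpace ν n) :
    ∀ᵐ ω ∂(noiseMeasure p), ∀ᵐ z ∂(ν ω), f (ω, z) = ∫ w, f (ω, w) ∂(ν ω) := by
  have hg : ∀ n, ∃ g : Noise A × (X × ℕ) → ℝ, Measurable g ∧
      ∀ᵐ q ∂(noiseMeasure p ⊗ₘ ν), f q = g (q.1, T.towerIter q.1 n q.2) := by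
    intro n
    obtain ⟨k, hk, hfk⟩ := (Submodule.mem_iInf _).1 hf n
    obtain ⟨g, hg, rfl⟩ := StronglyMeasurable.exists_eq_measurable_comp hk
    exact ⟨g, hg.measurable, hfk⟩
  choose g hgm hfg using hg
  filter_upwards [hgood, hex, hfib, Measure.ae_ae_of_ae_compProd (ae_all_iff.2 hfg)]
    with ω h hE hfω hω
  suffices hc : ∃ a : ℝ, (fun z => f (ω, z)) =ᵐ[ν ω] Function.const _ a by
    obtain ⟨a, ha⟩ := hc
    have : ∫ w, f (ω, w) ∂(ν ω) = a := by
      rw [integral_congr_ae ha]; simp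
    rw [this]
    exact ha
  refine exists_eventuallyEq_const_of_forall_separating MeasurableSet fun U hU => ?_
  -- the set where infinitely many of the representatives of `f` lie in `U` is a tail event
  set B : Set (X × ℕ) := {z | z ∈ T.fiber ω ∧
    ∀ N, ∃ n, g (N + n) (ω, T.towerIter ω (N + n) z) ∈ U} with hB
  have hBf : ∀ z ∈ T.fiber ω, (∀ n, f (ω, z) = g n (ω, T.towerIter ω n z)) →
      (z ∈ B ↔ f (ω, z) ∈ U) := by
    intro z hz hzf
    simp only [hB, Set.mem_ofPred_eq, ← hzf]
    simp [hz]
  have htail : ∀ n : ℕ, ∃ B' : Set (X × ℕ), MeasurableSet B' ∧ B' ⊆ T.fiber (shift (n : ℤ) ω) ∧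
      B = T.fiber ω ∩ T.towerIter ω n ⁻¹' B' := by
    intro n
    refine ⟨T.fiber (shift n ω) ∩ {w | ∀ N, ∃ k, g (n + N + k)
      (ω, T.towerIter (shift n ω) (N + k) w) ∈ U}, (measurableSet_fiber _).inter ?_,
      Set.inter_subset_left, ?_⟩
    · simp only [Set.ofPred_forall, Set.ofPred_exists]
      exact MeasurableSet.iInter fun N => MeasurableSet.iUnion fun k =>
        ((hgm _).comp (measurable_prodMk_left.comp (measurable_towerIter _ _))) hU
    · ext z
      simp only [hB, Set.mem_ofPred_eq, Set.mem_inter_iff, Set.mem_preimage]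
      have e : ∀ N k, T.towerIter (shift n ω) (N + k) (T.towerIter ω n z) =
          T.towerIter ω (n + N + k) z := fun N k => by
        rw [add_assoc, towerIter_add ω n (N + k) z]
      simp only [e]
      refine ⟨fun hz => ⟨hz.1, h.towerIter_mem_fiber hz.1 n, fun N => hz.2 (n + N)⟩,
        fun hz => ⟨hz.1, fun N => ?_⟩⟩
      obtain ⟨k, hk⟩ := hz.2.2 N
      refine ⟨n + k, ?_⟩
      rwa [show N + (n + k) = n + N + k by ring]
  have hBm : MeasurableSet B := by
    obtain ⟨B', hB', -, e⟩ := htail 0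
    rw [e]
    exact (measurableSet_fiber ω).inter (measurable_towerIter ω 0 hB')
  have hin : ∀ᵐ z ∂(ν ω), z ∈ T.fiber ω := by
    filter_upwards [compl_mem_ae_iff.2 hfω] with z hz
    simpa using hz
  rcases hE B htail with h0 | h1
  · right
    filter_upwards [hin, hω, compl_mem_ae_iff.2 h0] with z hz hzf hzB
    exact fun hU => hzB ((hBf z hz hzf).2 hU)
  · left
    filter_upwards [hin, hω, (prob_compl_eq_zero_iff hBm).2 h1] with z hz hzf hzB
    exact (hBf z hz hzf).1 hzB

/-- Averaging over the fibres maps `L²` to `L²`, because variances are nonnegative. -/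
lemma memLp_integral_kernel {Ω Y : Type*} [MeasurableSpace Ω] [MeasurableSpace Y] {P : Measure Ω}
    [IsProbabilityMeasure P] {κ : Kernel Ω Y} [IsMarkovKernel κ] {f : Ω × Y → ℝ}
    (hf : MemLp f 2 (P ⊗ₘ κ)) : MemLp (fun ω => ∫ y, f (ω, y) ∂(κ ω)) 2 P := by
  have hint : ∀ {g : Ω × Y → ℝ}, Integrable g (P ⊗ₘ κ) →
      Integrable (fun ω => ∫ y, g (ω, y) ∂(κ ω)) P := fun hg => by
    simpa using Integrable.integral_compProd (κ := Kernel.const Unit P) (a := ()) hg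
  have hsm : AEStronglyMeasurable (fun ω => ∫ y, f (ω, y) ∂(κ ω)) P :=
    (hint (hf.integrable (by norm_num))).1
  refine (memLp_two_iff_integrable_sq hsm).2 ?_
  have hsq : Integrable (fun ω => ∫ y, f (ω, y) ^ 2 ∂(κ ω)) P :=
    hint hf.integrable_sq
  refine hsq.mono' (hsm.pow 2) ?_
  have h1 := (Measure.integrable_compProd_iff (hf.integrable_sq.1)).1 hf.integrable_sq
  have h2 := (Measure.integrable_compProd_iff hf.1).1 (hf.integrable (by norm_num))
  filter_upwards [h1.1, h2.1] with ω hω hω'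
  have hL : MemLp (fun y => f (ω, y)) 2 (κ ω) := (memLp_two_iff_integrable_sq hω'.1).2 hω
  have := variance_nonneg (fun y => f (ω, y)) (κ ω)
  rw [variance_eq_sub hL] at this
  rw [Real.norm_eq_abs, abs_of_nonneg (sq_nonneg _)]
  simpa using this

/-- An equivariant and exact family of measures is mixing, because the shift is. -/
lemma Exact.mixing (hgood : ∀ᵐ ω ∂(noiseMeasure p), T.Good D γ ω) (hex : T.Exact ν)
    (heq : T.Equivariant ν) (hfib : ∀ᵐ ω ∂(noiseMeasure p), ν ω (T.fiber ω)ᶜ = 0) :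
    T.Mixing ν := by
  set P := noiseMeasure p with hP
  set π := P ⊗ₘ ν with hπ
  have hskew := heq.measurePreserving_skew
  let U : ℕ → Lp ℝ 2 π →+ Lp ℝ 2 π := fun n => Lp.compMeasurePreserving (T.skew n) (hskew n)
  have hUf : ∀ n f, U n f ∈ T.futureSpace ν n := by
    intro n f
    have hm : Measurable[T.futureSigma n] (T.skew n) := by
      rintro S hS
      exact ⟨_, (((measurable_shift (n : ℤ)).comp measurable_fst).prodMk measurable_snd) hS, rfl⟩
    exact ⟨_, (Lp.stronglyMeasurable f).comp_measurable hm,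
      Lp.coeFn_compMeasurePreserving f (hskew n)⟩
  have hUn : ∀ n f, ‖U n f‖ = ‖f‖ := fun n f => Lp.norm_compMeasurePreserving f _
  -- decorrelation from functions of the noise
  have hnoise : ∀ (Φ f : Lp ℝ 2 π), f ∈ ⨅ n, T.futureSpace ν n →
      Tendsto (fun n => inner ℝ (U n Φ) f) atTop (𝓝 ((∫ q, Φ q ∂π) * ∫ q, f q ∂π)) := by
    intro Φ f hf
    have hΦ := memLp_integral_kernel (Lp.memLp Φ)
    have hfm := memLp_integral_kernel (Lp.memLp f)
    have hI : ∀ g : Lp ℝ 2 π, ∫ q, g q ∂π = ∫ ω, ∫ z, g (ω, z) ∂(ν ω) ∂P := fun g =>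
      Measure.integral_compProd ((Lp.memLp g).integrable (by norm_num))
    rw [hI, hI]
    refine (tendsto_integral_shift_mul hΦ hfm).congr fun n => ?_
    have hconst := ae_eq_integral_of_mem_futureSpace hgood hex hfib hf
    have e1 : inner ℝ (U n Φ) f = ∫ q, Φ (T.skew n q) * f q ∂π := by
      rw [L2.inner_def]
      refine integral_congr_ae ?_
      filter_upwards [Lp.coeFn_compMeasurePreserving Φ (hskew n)] with q hq
      have : U n Φ q = Φ (T.skew n q) := hq
      rw [this]
      simp [mul_comm]
    have hint : Integrable (fun q => Φ (T.skew n q) * f q) π :=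
      ((Lp.memLp Φ).comp_measurePreserving (hskew n)).integrable_mul (Lp.memLp f)
    rw [e1, Measure.integral_compProd hint]
    refine integral_congr_ae ?_
    filter_upwards [heq.ae_map_towerIter, hconst] with ω hω hc
    have hmeas : Measurable fun z => Φ (shift n ω, z) :=
      (Lp.stronglyMeasurable Φ).measurable.comp measurable_prodMk_left
    calc (∫ z, Φ (shift n ω, z) ∂(ν (shift n ω))) * ∫ z, f (ω, z) ∂(ν ω)
        = (∫ z, Φ (shift n ω, T.towerIter ω n z) ∂(ν ω)) * ∫ z, f (ω, z) ∂(ν ω) := by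
          rw [← hω n, integral_map (measurable_towerIter ω n).aemeasurable
            hmeas.aestronglyMeasurable]
      _ = ∫ z, Φ (shift n ω, T.towerIter ω n z) * ∫ w, f (ω, w) ∂(ν ω) ∂(ν ω) := by
          rw [integral_mul_const]
      _ = ∫ z, Φ (T.skew n (ω, z)) * f (ω, z) ∂(ν ω) := by
          refine integral_congr_ae ?_
          filter_upwards [hc] with z hz
          rw [hz]
          rfl
  have hmix : ∀ Φ Ψ : Lp ℝ 2 π, Tendsto (fun n => inner ℝ (U n Φ) Ψ) atTop
      (𝓝 ((∫ q, Φ q ∂π) * ∫ q, Ψ q ∂π)) := by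
    intro Φ Ψ
    set H := ⨅ n, T.futureSpace ν n with hH
    have hHc : IsClosed (H : Set (Lp ℝ 2 π)) := by
      rw [hH, Submodule.coe_iInf]
      exact isClosed_iInter isClosed_futureSpace
    have : CompleteSpace H := hHc.completeSpace_coe
    set f := H.starProjection Ψ with hf
    have hfH : f ∈ H := Submodule.starProjection_apply_mem H Ψ
    have horth : Ψ - f ∈ Hᗮ := Submodule.sub_starProjection_mem_orthogonal Ψ
    have h1 := hnoise Φ f hfH
    have h2 := tendsto_inner_of_mem_orthogonal_iInf (C := ‖Φ‖) antitone_futureSpace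
      isClosed_futureSpace (fun n => hUf n Φ) (fun n => (hUn n Φ).le) horth
    -- the constants belong to `H`, so that the projection does not change the mean
    let e : Lp ℝ 2 π := indicatorConstLp 2 MeasurableSet.univ (measure_ne_top π _) 1
    have he : e ∈ H := by
      refine (Submodule.mem_iInf _).2 fun n => ⟨fun _ => 1, stronglyMeasurable_const, ?_⟩
      filter_upwards [indicatorConstLp_coeFn (p := 2) (hs := MeasurableSet.univ)
        (hμs := measure_ne_top π _) (c := (1 : ℝ))] with q hq
      rw [hq]; simp
    have h3 : inner ℝ e (Ψ - f) = 0 := Submodule.inner_right_of_mem_orthogonal he horth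
    rw [inner_sub_right, L2.inner_indicatorConstLp_one, L2.inner_indicatorConstLp_one,
      setIntegral_univ, setIntegral_univ, sub_eq_zero] at h3
    have h4 := h1.add h2
    rw [add_zero, ← h3] at h4
    refine h4.congr fun n => ?_
    rw [← inner_add_right, add_sub_cancel]
  intro φ ψ hφ hψ
  have hI : ∀ {g : Noise A × (X × ℕ) → ℝ} (hg : MemLp g 2 π),
      ∫ ω, ∫ z, g (ω, z) ∂(ν ω) ∂P = ∫ q, (hg.toLp g : Lp ℝ 2 π) q ∂π := by
    intro g hg
    rw [← Measure.integral_compProd (hg.integrable (by norm_num))]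
    exact integral_congr_ae hg.coeFn_toLp.symm
  have hJ : ∀ n : ℕ, ∫ ω, ∫ z, φ (shift (n : ℤ) ω, T.towerIter ω n z) * ψ (ω, z) ∂(ν ω) ∂P =
      inner ℝ (U n hφ.toLp) hψ.toLp := by
    intro n
    have hint : Integrable (fun q => φ (T.skew n q) * ψ q) π :=
      (hφ.comp_measurePreserving (hskew n)).integrable_mul hψ
    rw [L2.inner_def]
    refine (Measure.integral_compProd hint).symm.trans (integral_congr_ae ?_)
    filter_upwards [Lp.coeFn_compMeasurePreserving hφ.toLp (hskew n), hψ.coeFn_toLp,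
      (hskew n).quasiMeasurePreserving.ae hφ.coeFn_toLp] with q h1 h2 h3
    have h4 : U n hφ.toLp q = φ (T.skew n q) := by rw [← h3]; exact h1
    rw [h4, h2]
    simp [mul_comm]
  have h0 := (hmix hφ.toLp hψ.toLp).sub_const ((∫ q, (hφ.toLp φ : Lp ℝ 2 π) q ∂π) *
    ∫ q, (hψ.toLp ψ : Lp ℝ 2 π) q ∂π)
  rw [sub_self] at h0
  have h1 := h0.abs
  rw [abs_zero] at h1
  refine h1.congr fun n => ?_
  rw [← hJ n, ← hI hφ, ← hI hψ]

end RandomTower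

/-- The constant weight satisfies every tail bound. -/
lemma isTailWeight_one {A : Type*} [MeasurableSpace A] (p : Measure A) [IsProbabilityMeasure p]
    (u : ℝ) {v : ℝ} (hv : v ≠ 0) : IsTailWeight p u v fun _ => 1 := by
  refine ⟨measurable_const, ⟨1, one_pos, fun _ => le_rfl⟩, fun n => ?_⟩
  rcases Nat.eq_zero_or_pos n with rfl | hn
  · simp [Real.zero_rpow hv]
  · have : ¬ ((n : ℝ) < 1) := by exact_mod_cast Nat.not_lt.2 hn
    simp [this]

end RandomTowers

end

theorem theorem2 {A X : Type*} [MeasurableSpace A] [MetricSpace X] [MeasurableSpace X]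
    [BorelSpace X] (p : Measure A) [IsProbabilityMeasure p] (m : Measure X)
    (T : RandomTowers.RandomTower p m)
    (D γ C a b u v : ℝ) (hD : 0 < D) (hγ₀ : 0 < γ) (hγ₁ : γ < 1)
    (hC : 0 < C) (ha : 1 < a) (hb : 0 ≤ b) (hu : 0 < u) (hv : 0 < v)
    (hMarkov : T.Markov) (hDist : T.BoundedDistortion D γ) (hExp : T.WeakExpansion)
    (hTail : T.QuenchedTail C a b u v) (hAper : T.Aperiodic) (hFin : T.FiniteMass)
    (hAnn : T.AnnealedTail) :
    ∃ (ν : Kernel (RandomTowers.Noise A) (X × ℕ)) (h : RandomTowers.Noise A → X × ℕ → ℝ),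
      IsMarkovKernel ν ∧
      (∀ ω, Measurable (h ω)) ∧
      (∀ᵐ ω ∂(RandomTowers.noiseMeasure p),
        ν ω = (T.refMeasure ω).withDensity (fun z => ENNReal.ofReal (h ω z))) ∧
      T.Equivariant ν ∧ T.Exact ν ∧ T.Mixing ν ∧
      ∃ K : RandomTowers.Noise A → ℝ, RandomTowers.IsTailWeight p u v K ∧
        T.MemFLip γ K h ∧ T.MemFPlus γ h := by
  have h1γ : 0 < 1 - γ := by linarith
  -- the distortion constant that one further return reproduces
  obtain ⟨c, hc, hcD⟩ : ∃ c : ℝ, 0 < c ∧ c * γ + D = c :=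
    ⟨D / (1 - γ), by positivity, by field_simp; ring⟩
  have hgood := RandomTowers.RandomTower.ae_good hMarkov hDist
  obtain ⟨ω₀, hω₀, hgen₀⟩ := (hgood.and hExp).exists
  have hsep := hω₀.isSeparable_base hgen₀
  obtain ⟨ν, h, hνm, hhm, hνh, heq, hhb, hhp⟩ :=
    RandomTowers.RandomTower.exists_equivariant_kernel hgood hsep hFin hγ₀.le hγ₁ hc.le hcD
  have hac : ∀ᵐ ω ∂(RandomTowers.noiseMeasure p), ν ω ≪ T.refMeasure ω :=
    hνh.mono fun ω hω => hω ▸ withDensity_absolutelyContinuous _ _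
  have hex := RandomTowers.RandomTower.exact_of_absolutelyContinuous hgood hExp hAper hFin hγ₀.le
    hγ₁.le hc.le hcD hac
  exact ⟨ν, h, hνm, hhm, hνh, heq, hex,
    hex.mixing hgood heq (hac.mono fun ω hω =>
      hω (RandomTowers.RandomTower.refMeasure_compl_fiber ω)),
    fun _ => 1, RandomTowers.isTailWeight_one p u hv.ne',
    RandomTowers.RandomTower.memFLip_one hgood hγ₀.le hγ₁.le hc hhb hhp,
    RandomTowers.RandomTower.memFPlus_of_regular hgood hc hhb hhp⟩
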